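/- Let $N_{\mathbb R}$ be a real vector space of finite dimension $n$ and $M_{\mathbb R}=N_{\mathbb R}^\vee$ its dual. A concave function on $N_{\mathbb R}$ is a concave function $f\colon N_{\mathbb R}\to\mathbb R\cup\{-\infty\}$, not identically $-\infty$. Its Legendre-Fenchel dual is $f^\vee(x)=\inf_{u}(\langle x,u\rangle-f(u))$, its stability set is $\operatorname{stab}(f)=\{x\in M_{\mathbb R}\mid \langle x,u\rangle-f(u)\text{ is bounded below in }u\}$, and its sup-differential at a point $u$ with $f(u)>-\infty$ is $\partial f(u)=\{x\mid\langle x,v-u\rangle\ge f(v)-f(u)\ \forall v\}$ (it is empty if $f(u)=-\infty$). For a Haar measure $\mu$ on $M_{\mathbb R}$, the Monge-Ampère measure $\mathcal M_\mu(f)$ is given on Borel sets $E$ by $\mathcal M_\mu(f)(E)=\mu\big(\bigcup_{u\in E}\partial f(u)\big)$. (1) Let $n\ge 1$ and choose linear coordinates $x_1,\dots,x_n$ on $M_{\mathbb R}$ such that $\mu$ is the measure associated to $dx_1\wedge\dots\wedge dx_n$. Put $\lambda=\sum_{i=1}^n(-1)^{i-1}x_i\,dx_1\wedge\dots\wedge\widehat{dx_i}\wedge\dots\wedge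 dx_n$. Let $f\colon N_{\mathbb R}\to\mathbb R$ be a closed (i.e. upper semicontinuous) concave function such that $D=\operatorname{stab}(f)$ is compact with piecewise smooth boundary: $\partial D$ is a finite union of smooth patches, that is, of images of compact sets $K_i\subset\mathbb R^{n-1}$ with negligible frontier under maps that are smooth near $K_i$ and that are, on the interiors of the $K_i$, injective immersions with pairwise disjoint images; $\partial D$ carries the boundary orientation, and if $D$ has empty interior, the integral over the oriented boundary is understood to be $0$. Assume that the integral $\int_{\partial D}f^\vee\lambda$ converges absolutely (which is automatic if $f^\vee$ is bounded on $D$). Then $\mathcal M_\mu(f)$ is a well-defined measure, the integrals $\int_{N_{\mathbb R}}f\,d\mathcal M_\mu(f)$ and $\int_Df^\vee\,d\mu$ converge absolutely, and $$-n!\int_{N_{\mathbb R}}f\,d\mathcal M_\mu(f)=(n+1)!\int_Df^\vee\,d\mu-n!\int_{\partial D}f^\vee\lambda .$$ (2) Let $N\subset N_{\mathbb R}$ be a lattice and $M=\{x\in M_{\mathbb R}\mid\langle x,u\rangle\in\mathbb Z\ \forall u\in N\}$ the dual lattice. Let $\operatorname{vol}_M$ be the Haar measure on $M_{\mathbb R}$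 for which $M$ has covolume $1$, and write $\mathcal M_M=\mathcal M_{\operatorname{vol}_M}$. Let $f$ be a concave function on $N_{\mathbb R}$ such that $\Delta=\operatorname{stab}(f)$ is a lattice polytope (the convex hull of a finite non-empty subset of $M$) of dimension $n$. For a facet $F$ of $\Delta$ let $L_F$ be the linear space associated to the affine hull of $F$, let $\operatorname{vol}_{M(F)}$ be the measure on that affine hull induced by the Haar measure on $L_F$ for which $M(F)=M\cap L_F$ has covolume $1$, and let $v_F\in N$ be the non-zero vector of minimal length that is orthogonal to $L_F$ and satisfies $\langle v_F,y\rangle\le\langle v_F,x\rangle$ for all $y\in F$, $x\in\Delta$; write $\langle v_F,F\rangle$ for its constant value on $F$. Then $\mathcal M_M(f)$ is a well-defined measure, $\Delta$ has finitely many facets, all the integrals below converge absolutely, and $$-n!\int_{N_{\mathbb R}}f\,d\mathcal M_M(f)=(n+1)!\int_\Delta f^\vee\,d\operatorname{vol}_M+\sum_F\langle v_F,F\rangle\,n!\int_Ff^\vee\,d\operatorname{vol}_{M(F)},$$ the sum being over the facets $F$ of $\Delta$. -/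

import Mathlib

open MeasureTheory Module
open scoped ContDiff Nat

noncomputable section

namespace ConcaveMA

section Duality

variable {N : Type*} [NormedAddCommGroup N] [NormedSpace ℝ N]

/-- A concave function on `N` with values in `ℝ ∪ {-∞}` is given by its effective domain
`C ⊆ N` (a non-empty convex set) and a real-valued function `f`, concave on `C`; the values of `f`
outside `C` are irrelevant.  The stability set of such a function is the set of the linear forms `x`
for which `u ↦ ⟨x, u⟩ - f u` is bounded below. -/
def stab (C : Set N) (f : N → ℝ) : Set (StrongDual ℝ N) :=
  {x | BddBelow ((fun u => x u - f u) '' C)}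

/-- The Legendre-Fenchel dual `f^∨(x) = inf_u (⟨x, u⟩ - f u)`.  It is meaningful as a real number
for `x ∈ stab C f`; elsewhere the dual is `-∞` and the value of this function is not used. -/
def legendreDual (C : Set N) (f : N → ℝ) (x : StrongDual ℝ N) : ℝ :=
  sInf ((fun u => x u - f u) '' C)

/-- The sup-differential of a concave function at the point `u`
(empty outside of the effective domain). -/
def supDiff (C : Set N) (f : N → ℝ) (u : N) : Set (StrongDual ℝ N) :=
  {x | u ∈ C ∧ ∀ v ∈ C, f v - f u ≤ x (v - u)}

/-- `ν` is the Monge-Ampère measure of the concave function `f` with respect to the measure `μ`: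
`ν E = μ (∂f(E))`, `∂f(E) = ⋃_{u ∈ E} ∂f(u)`, for all Borel sets `E`.  There is at most one such
measure. -/
def IsMongeAmpere [MeasurableSpace N] (μ : Measure (StrongDual ℝ N)) (C : Set N) (f : N → ℝ)
    (ν : Measure N) : Prop :=
  ∀ E : Set N, MeasurableSet E → ν E = μ (⋃ u ∈ E, supDiff C f u)

end Duality

section Boundary

variable {M : Type*} [NormedAddCommGroup M] [NormedSpace ℝ M] {m : ℕ}

/-- The differential form
`λ = ∑ i, (-1)^(i-1) x_i dx_1 ∧ … ∧ (dx_i omitted) ∧ … ∧ dx_n`, `n = m + 1`, in the linear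
coordinates given by the basis `e` (indices start from `0` here), at the point `x`, evaluated at
`m = n - 1` tangent vectors. -/
def lambdaForm (e : Basis (Fin (m + 1)) ℝ M) (x : M) (v : Fin m → M) : ℝ :=
  ∑ i : Fin (m + 1), (-1) ^ (i : ℕ) * e.coord i x *
    Matrix.det (Matrix.of fun j k : Fin m => e.coord (i.succAbove j) (v k))

/-- The partial derivatives of a parametrization. -/
def partials (γ : (Fin m → ℝ) → M) (t : Fin m → ℝ) : Fin m → M :=
  fun j => fderiv ℝ γ t (Pi.single j 1)

/-- A piecewise smooth oriented boundary of a convex body `D`: finitely many patches `γ i`, each of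
them smooth on a neighbourhood of a compact set `K i ⊆ ℝ^(n-1)` with negligible frontier, injective
and non-overlapping on the interiors, and together covering the boundary.  The sign of a patch
compares the orientation of `ℝ^(n-1)` with the boundary orientation (outward vector first; for `y`
interior to the convex set `D` and `p ∈ ∂D` the vector `p - y` points outwards).  Strict positivity
in `oriented` contains that the patches are immersions on the interiors.

The boundary is taken as the oriented boundary of the `n`-dimensional body, that is, of the interior
of `D`: for a closed convex `D` with non-empty interior, `frontier (interior D) = frontier D`; when
`D` has empty interior (measure zero) it is the empty chain. -/
structure PiecewiseSmoothBoundary (e : Basis (Fin (m + 1)) ℝ M) (D : Set M) where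
  count : ℕ
  K : Fin count → Set (Fin m → ℝ)
  γ : Fin count → (Fin m → ℝ) → M
  sgn : Fin count → ℤˣ
  isCompact_K : ∀ i, IsCompact (K i)
  volume_frontier : ∀ i, volume (frontier (K i)) = 0
  smooth : ∀ i, ∃ U : Set (Fin m → ℝ), IsOpen U ∧ K i ⊆ U ∧ ContDiffOn ℝ ∞ (γ i) U
  injOn : ∀ i, Set.InjOn (γ i) (interior (K i))
  disjoint : ∀ i j, i ≠ j → Disjoint (γ i '' interior (K i)) (γ j '' interior (K j))
  cover : ⋃ i, γ i '' K i = frontier (interior D)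
  oriented : ∀ i, ∀ t ∈ interior (K i), ∀ y ∈ interior D,
    0 < ((sgn i : ℤ) : ℝ) * e.det (Fin.cons (γ i t - y) (partials (γ i) t))

namespace PiecewiseSmoothBoundary

variable {e : Basis (Fin (m + 1)) ℝ M} {D : Set M}

/-- The coefficient of the pull-back of the form `g λ` under the patch `γ i`. -/
def pullback (P : PiecewiseSmoothBoundary e D) (g : M → ℝ) (i : Fin P.count) (t : Fin m → ℝ) : ℝ :=
  g (P.γ i t) * lambdaForm e (P.γ i t) (partials (P.γ i) t)

/-- The integral `∫_{∂D} g λ` converges absolutely. -/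
def Integrable (P : PiecewiseSmoothBoundary e D) (g : M → ℝ) : Prop :=
  ∀ i, IntegrableOn (P.pullback g i) (P.K i)

/-- The integral `∫_{∂D} g λ`. -/
def integral (P : PiecewiseSmoothBoundary e D) (g : M → ℝ) : ℝ :=
  ∑ i, ((P.sgn i : ℤ) : ℝ) * ∫ t in P.K i, P.pullback g i t

end PiecewiseSmoothBoundary

end Boundary

section Lattices

/-- The Haar measure normalized so that the lattice `L` has covolume one. -/
def latticeVol {V : Type*} [NormedAddCommGroup V] [NormedSpace ℝ V] [FiniteDimensional ℝ V]
    [MeasurableSpace V] [BorelSpace V] (L : Submodule ℤ V) : Measure V :=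
  (ENNReal.ofReal (ZLattice.covolume L Measure.addHaar))⁻¹ • Measure.addHaar

/-- The dual lattice `L^∨`: the linear forms that are integral on `L`. -/
def dualLattice {N : Type*} [NormedAddCommGroup N] [NormedSpace ℝ N] (L : Submodule ℤ N) :
    Submodule ℤ (StrongDual ℝ N) where
  carrier := {x | ∀ u ∈ L, ∃ k : ℤ, x u = k}
  add_mem' := by
    intro x y hx hy u hu
    obtain ⟨k, hk⟩ := hx u hu
    obtain ⟨l, hl⟩ := hy u hu
    exact ⟨k + l, by simp [hk, hl]⟩
  zero_mem' := fun u _ => ⟨0, by simp⟩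
  smul_mem' := by
    intro c x hx u hu
    obtain ⟨k, hk⟩ := hx u hu
    exact ⟨c * k, by simp [hk]⟩

variable {M : Type*} [NormedAddCommGroup M] [NormedSpace ℝ M]

/-- The convex hulls of finitely many points of the lattice `L`. -/
def IsLatticePolytope (L : Submodule ℤ M) (Δ : Set M) : Prop :=
  ∃ s : Finset M, s.Nonempty ∧ (∀ x ∈ s, x ∈ L) ∧ Δ = convexHull ℝ (s : Set M)

/-- The linear space associated to the affine hull of `F`. -/
def linSpace (F : Set M) : Submodule ℝ M := (affineSpan ℝ F).direction

/-- The facets of a convex set: its (non-empty) faces of codimension one. -/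
def facets (Δ : Set M) : Set (Set M) :=
  {F | F.Nonempty ∧ Convex ℝ F ∧ IsExtreme ℝ Δ F ∧
    finrank ℝ (linSpace F) + 1 = finrank ℝ (linSpace Δ)}

/-- A point of a non-empty set. -/
def somePoint (F : Set M) : M := Classical.epsilon fun p => p ∈ F

/-- The lattice `L ∩ V` in the linear space `V`. -/
def inducedLattice (L : Submodule ℤ M) (V : Submodule ℝ M) : Submodule ℤ V :=
  L.comap (V.subtype.restrictScalars ℤ)

/-- The measure on the affine hull of `F` induced by the normalized Haar measure of the lattice
`L ∩ linSpace F`, as a measure on the ambient space.  By invariance under translations it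
does not depend on the point of `F` that is used to identify `linSpace F` and the affine hull. -/
def faceVol [FiniteDimensional ℝ M] [MeasurableSpace M] [BorelSpace M] (L : Submodule ℤ M)
    (F : Set M) : Measure M :=
  (latticeVol (inducedLattice L (linSpace F))).map fun w : linSpace F => somePoint F + (w : M)

variable {N : Type*} [NormedAddCommGroup N] [NormedSpace ℝ N]

/-- The non-zero vectors of the lattice `L ⊆ N` that are orthogonal to `linSpace F` and point to
the inner side of `F` as a facet of `Δ`. -/
def innerNormals (L : Submodule ℤ N) (Δ F : Set (StrongDual ℝ N)) : Set N :=
  {v | v ∈ L ∧ v ≠ 0 ∧ (∀ x ∈ linSpace F, x v = 0) ∧ ∀ x ∈ F, ∀ y ∈ Δ, x v ≤ y v}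

/-- The vector `v_F`: the inner integral orthogonal vector of `F` of minimal length.
(For a facet of a full-dimensional lattice polytope, `innerNormals` lies on one ray, so that the
choice of the norm plays no role and the vector is unique.) -/
def facetNormal (L : Submodule ℤ N) (Δ F : Set (StrongDual ℝ N)) : N :=
  Classical.epsilon fun v => v ∈ innerNormals L Δ F ∧ ∀ w ∈ innerNormals L Δ F, ‖v‖ ≤ ‖w‖

/-- The number `⟨v_F, F⟩`: the constant value of `v_F` on the facet `F`. -/
def facetLevel (L : Submodule ℤ N) (Δ F : Set (StrongDual ℝ N)) : ℝ :=
  somePoint F (facetNormal L Δ F)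

end Lattices

end ConcaveMA

end

open ConcaveMA

set_option linter.unusedSectionVars false

namespace ConcaveMA

open Set Filter Topology Pointwise

/-! ### Legendre-Fenchel duality. -/

section Legendre

variable {N : Type*} [NormedAddCommGroup N] [NormedSpace ℝ N] {C : Set N} {f : N → ℝ}

/-! Write `g` for the Legendre dual, `D` for the stability set and `n = m + 1`. Both formulas come
from a divergence theorem on the dual side. The concave function `g` is differentiable almost
everywhere in the interior of `D`, and at such a point `x` exactly one `u` has `x` in its
sup-differential: the gradient of `g` at `x`. Hence the Monge-Ampère measure is the image of `μ` on
`D` under the gradient map, and Fenchel's equality `f u = x u - g x` turns the integral of `f` into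
`∫_D (dg(x) x - g)` (`exists_isMongeAmpere`). On the other side, `λ` is the volume form contracted
with the position vector, so `∫_{∂D} g λ` is the flux of the field `g x • x`, whose divergence is `n
g + dg(x) x` (`integral_divergence`). Eliminating the term `dg(x) x` leaves `∫ f dν = ∫_{∂D} g λ -
(n + 1) ∫_D g`.

The difficulty is that `g` may be unbounded below and its gradient may blow up at the boundary. The
flux is therefore computed along rays from the origin. There `s ^ m * (n g + dg(x) x)` at `x = s •
p` is the derivative of `s ^ n * g (s • p)`, and a concave upper semicontinuous function on a closed
interval satisfies the fundamental theorem of calculus up to the endpoints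
(`integral_deriv_pow_mul_concave`). The measure `|λ|` on the part of the boundary where rays leave
`D` is an angular measure for the cone over `D`; if `0 ∉ D`, so is `|λ|` on the part where rays
enter (`isPolar_boundaryMeasure`). The entry value, as a function of the exit point, is homogeneous
of degree `-n`, and any two angular measures of one cone agree on such functions
(`IsPolar.lintegral_eq_of_homogeneous`). So exit points are never matched with entry points by a
map.

For a lattice polytope, compactness of the stability set forces `f` to be finite everywhere
(`eq_univ_of_isCompact_stab`). The boundary is the union of the facets (`frontier_subset_facets`),
parametrized by bases of the lattices `M(F)`. On a facet `λ` is constant, given by the form `det (·,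
b₁, …, b_m)`; this form is primitive, so up to sign it is `v_F` (`facetLevel_eq`). -/

lemma legendreDual_le {x : StrongDual ℝ N} (hx : x ∈ stab C f) {u : N} (hu : u ∈ C) :
    legendreDual C f x ≤ x u - f u :=
  csInf_le hx ⟨u, hu, rfl⟩

lemma le_legendreDual (hC : C.Nonempty) {x : StrongDual ℝ N} {c : ℝ}
    (h : ∀ u ∈ C, c ≤ x u - f u) : c ≤ legendreDual C f x :=
  le_csInf (hC.image _) (by rintro _ ⟨u, hu, rfl⟩; exact h u hu)

lemma le_combo_of_mem_stab {x y : StrongDual ℝ N} (hx : x ∈ stab C f) (hy : y ∈ stab C f)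
    {a b : ℝ} (ha : 0 ≤ a) (hb : 0 ≤ b) (hab : a + b = 1) {u : N} (hu : u ∈ C) :
    a • legendreDual C f x + b • legendreDual C f y ≤ (a • x + b • y) u - f u := by
  have h1 := mul_le_mul_of_nonneg_left (legendreDual_le hx hu) ha
  have h2 := mul_le_mul_of_nonneg_left (legendreDual_le hy hu) hb
  have h3 : b = 1 - a := by linarith
  subst h3
  simp only [smul_eq_mul, add_apply, smul_apply]
  linarith

lemma convex_stab : Convex ℝ (stab C f) := by
  intro x hx y hy a b ha hb hab
  refine ⟨a • legendreDual C f x + b • legendreDual C f y, ?_⟩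
  rintro _ ⟨u, hu, rfl⟩
  exact le_combo_of_mem_stab hx hy ha hb hab hu

lemma concaveOn_legendreDual (hC : C.Nonempty) : ConcaveOn ℝ (stab C f) (legendreDual C f) :=
  ⟨convex_stab, fun _ hx _ hy _ _ ha hb hab =>
    le_legendreDual hC fun _ hu => le_combo_of_mem_stab hx hy ha hb hab hu⟩

lemma upperSemicontinuousOn_legendreDual (hC : C.Nonempty) :
    UpperSemicontinuousOn (legendreDual C f) (stab C f) := by
  intro x hx c hc
  obtain ⟨_, ⟨u, hu, rfl⟩, huc⟩ := exists_lt_of_csInf_lt (hC.image _) hc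
  have hcont : Continuous fun y : StrongDual ℝ N => y u - f u := by fun_prop
  filter_upwards [self_mem_nhdsWithin,
    mem_nhdsWithin_of_mem_nhds (hcont.continuousAt.eventually_lt_const huc)] with y hy hyc
  exact (legendreDual_le hy hu).trans_lt hyc

lemma legendreDual_eq_of_min {x : StrongDual ℝ N} {u : N} (hu : ∀ v, x u - f u ≤ x v - f v) :
    x ∈ stab univ f ∧ legendreDual univ f x = x u - f u := by
  have hx : x ∈ stab univ f := ⟨x u - f u, by rintro _ ⟨v, -, rfl⟩; exact hu v⟩
  exact ⟨hx, le_antisymm (legendreDual_le hx (mem_univ u))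
    (le_legendreDual univ_nonempty fun v _ => hu v)⟩

lemma mem_supDiff_univ_iff {x : StrongDual ℝ N} {u : N} :
    x ∈ supDiff univ f u ↔ ∀ v, x u - f u ≤ x v - f v := by
  simp only [supDiff, mem_univ, true_and, forall_true_left, mem_ofPred_eq, map_sub]
  exact forall_congr' fun v => ⟨fun h => by linarith, fun h => by linarith⟩

/-- The dual lies below the affine function `y ↦ y u - f u` and touches it at `x`, so the difference
has a local maximum there. -/
lemma fderiv_legendreDual_of_min {x : StrongDual ℝ N} (hx : x ∈ interior (stab univ f))
    (hd : DifferentiableAt ℝ (legendreDual univ f) x) {u : N}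
    (hu : ∀ v, x u - f u ≤ x v - f v) (y : StrongDual ℝ N) :
    fderiv ℝ (legendreDual univ f) x y = y u := by
  have hmax : IsLocalMax (fun y : StrongDual ℝ N => legendreDual univ f y - y u) x := by
    filter_upwards [isOpen_interior.mem_nhds hx] with y hy
    have h1 := legendreDual_le (interior_subset hy) (mem_univ u)
    have h2 := (legendreDual_eq_of_min hu).2
    linarith
  have hev : HasFDerivAt (fun y : StrongDual ℝ N => y u) (ContinuousLinearMap.apply ℝ ℝ u) x :=
    (ContinuousLinearMap.apply ℝ ℝ u).hasFDerivAt
  have h := hmax.hasFDerivAt_eq_zero (hd.hasFDerivAt.sub hev)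
  have := congrArg (fun L => L y) h
  simpa [sub_eq_zero] using this

end Legendre

/-- Rademacher's theorem: a concave function is locally Lipschitz in the interior, and being a null
set is a local property. -/
lemma ConcaveOn.ae_differentiableAt {E : Type*} [NormedAddCommGroup E] [NormedSpace ℝ E]
    [FiniteDimensional ℝ E] [MeasurableSpace E] [BorelSpace E] {μ : Measure E}
    [μ.IsAddHaarMeasure] {D : Set E} {g : E → ℝ} (hg : ConcaveOn ℝ D g) :
    ∀ᵐ x ∂μ, x ∈ interior D → DifferentiableAt ℝ g x := by
  rw [ae_iff]
  refine measure_null_of_locally_null _ fun x hx => ?_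
  simp only [Classical.not_imp, mem_ofPred_eq] at hx
  obtain ⟨K, t, ht, hK⟩ := hg.locallyLipschitzOn_interior hx.1
  rw [isOpen_interior.nhdsWithin_eq hx.1] at ht
  refine ⟨interior t ∩ {x | ¬(x ∈ interior D → DifferentiableAt ℝ g x)},
    Filter.inter_mem (mem_nhdsWithin_of_mem_nhds (interior_mem_nhds.2 ht)) self_mem_nhdsWithin, ?_⟩
  have h := hK.ae_differentiableWithinAt_of_mem (μ := μ)
  rw [ae_iff] at h
  refine measure_mono_null ?_ h
  rintro y ⟨hy, hy'⟩
  simp only [Classical.not_imp, mem_ofPred_eq] at hy' ⊢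
  exact ⟨interior_subset hy,
    fun h => hy'.2 (h.differentiableAt (mem_interior_iff_mem_nhds.1 hy))⟩

/-! ### The Monge-Ampère measure as an image under the gradient of the dual. -/

section MongeAmpere

variable {N : Type*} [NormedAddCommGroup N] [NormedSpace ℝ N] [FiniteDimensional ℝ N] {f : N → ℝ}

/-- The dual is bounded below by some `B` on a ball of radius `ε` about `x`. Testing it at `x - ε •
w`, with `w` a norming form of `u`, gives `x u - f u ≥ ε * ‖u‖ + B`, so the function to be minimized
is coercive. -/
lemma exists_min_of_mem_interior_stab (hf : Continuous f) {x : StrongDual ℝ N}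
    (hx : x ∈ interior (stab univ f)) : ∃ u, ∀ v, x u - f u ≤ x v - f v := by
  have hcont : ContinuousOn (legendreDual univ f) (interior (stab univ f)) :=
    (concaveOn_legendreDual univ_nonempty).continuousOn_interior
  obtain ⟨ε, hε, hball⟩ := Metric.nhds_basis_closedBall.mem_iff.1 (isOpen_interior.mem_nhds hx)
  obtain ⟨B, hB⟩ := ((isCompact_closedBall x ε).bddBelow_image (hcont.mono hball))
  have key : ∀ u, ε * ‖u‖ + B ≤ x u - f u := by
    intro u
    obtain ⟨w, hw, hwu⟩ := exists_dual_vector'' ℝ u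
    have hmem : x - ε • w ∈ Metric.closedBall x ε := by
      rw [mem_closedBall_iff_norm, sub_sub_cancel_left, norm_neg, norm_smul, Real.norm_of_nonneg hε.le]
      nlinarith
    have h1 : B ≤ legendreDual univ f (x - ε • w) := hB ⟨_, hmem, rfl⟩
    have h2 := legendreDual_le (interior_subset (hball hmem)) (mem_univ u)
    have h3 : w u = ‖u‖ := by simpa using hwu
    simp only [sub_apply, smul_apply, smul_eq_mul, h3] at h2
    linarith
  have hlim : Tendsto (fun u => x u - f u) (cocompact N) atTop := by
    refine tendsto_atTop_mono key (tendsto_atTop_add_const_right _ _ ?_)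
    exact (tendsto_norm_cocompact_atTop).const_mul_atTop hε
  exact Continuous.exists_forall_le (by fun_prop) hlim

/-- The evaluation isomorphism onto the bidual. -/
noncomputable def bidualEquiv (N : Type*) [NormedAddCommGroup N] [NormedSpace ℝ N]
    [FiniteDimensional ℝ N] : N ≃L[ℝ] StrongDual ℝ (StrongDual ℝ N) :=
  LinearEquiv.toContinuousLinearEquiv <| LinearEquiv.ofBijective
    (ContinuousLinearMap.apply ℝ ℝ : N →L[ℝ] StrongDual ℝ N →L[ℝ] ℝ).toLinearMap <| by
    have hinj : Function.Injective
        (ContinuousLinearMap.apply ℝ ℝ : N →L[ℝ] StrongDual ℝ N →L[ℝ] ℝ).toLinearMap := by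
      rw [← LinearMap.ker_eq_bot, LinearMap.ker_eq_bot']
      intro u hu
      refine (SeparatingDual.eq_zero_iff_forall_dual_eq_zero (R := ℝ) u).2 fun w => ?_
      exact congrArg (fun L : StrongDual ℝ N →L[ℝ] ℝ => L w) hu
    have h1 : ∀ V : Type _, ∀ [NormedAddCommGroup V] [NormedSpace ℝ V] [FiniteDimensional ℝ V],
        finrank ℝ (StrongDual ℝ V) = finrank ℝ V := by
      intro V _ _ _
      rw [← (LinearMap.toContinuousLinearMap : (V →ₗ[ℝ] ℝ) ≃ₗ[ℝ] V →L[ℝ] ℝ).finrank_eq]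
      exact Subspace.dual_finrank_eq
    exact ⟨hinj, (LinearMap.injective_iff_surjective_of_finrank_eq_finrank (by rw [h1, h1])).1 hinj⟩

lemma bidualEquiv_apply (u : N) (y : StrongDual ℝ N) : bidualEquiv N u y = y u := rfl

theorem exists_isMongeAmpere [MeasurableSpace N] [BorelSpace N]
    (μ : Measure (StrongDual ℝ N)) [μ.IsAddHaarMeasure]
    (hf : Continuous f)  :
    ∃ ν : Measure N, IsMongeAmpere μ univ f ν ∧
      (IntegrableOn (fun x => fderiv ℝ (legendreDual univ f) x x - legendreDual univ f x)
        (stab univ f) μ → Integrable f ν ∧ ∫ u, f u ∂ν =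
        ∫ x in stab univ f, (fderiv ℝ (legendreDual univ f) x x - legendreDual univ f x) ∂μ) := by
  set g := legendreDual univ f with hg
  set D := stab univ f with hD
  set T : StrongDual ℝ N → N := fun x => (bidualEquiv N).symm (fderiv ℝ g x) with hT
  have hTm : Measurable T := (bidualEquiv N).symm.continuous.measurable.comp (measurable_fderiv ℝ g)
  set D' : Set (StrongDual ℝ N) := interior D ∩ {x | DifferentiableAt ℝ g x} with hD'
  have hD'm : MeasurableSet D' :=
    isOpen_interior.measurableSet.inter (measurableSet_of_differentiableAt ℝ g)
  have hDD' : D' =ᵐ[μ] D := by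
    -- A convex set has null frontier, so only interior points of differentiability matter.
    have h1 : interior D =ᵐ[μ] D := interior_ae_eq_of_null_frontier (convex_stab.addHaar_frontier μ)
    refine EventuallyEq.trans ?_ h1
    filter_upwards [ConcaveOn.ae_differentiableAt (μ := μ)
      (concaveOn_legendreDual (C := univ) (f := f) univ_nonempty)] with x hx
    exact propext ⟨fun h => h.1, fun h => ⟨h, hx h⟩⟩
  have hkey : ∀ x ∈ D', ∀ u, x ∈ supDiff univ f u ↔ u = T x := by
    intro x hx u
    have hu : ∀ u, x ∈ supDiff univ f u → u = T x := by
      intro u hu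
      rw [mem_supDiff_univ_iff] at hu
      rw [hT, ContinuousLinearEquiv.eq_symm_apply]
      ext y
      rw [bidualEquiv_apply, fderiv_legendreDual_of_min hx.1 hx.2 hu]
    refine ⟨hu u, ?_⟩
    rintro rfl
    obtain ⟨u, hu'⟩ := exists_min_of_mem_interior_stab hf hx.1
    rw [← mem_supDiff_univ_iff] at hu'
    rwa [← hu u hu']
  have hfT : ∀ x ∈ D', f (T x) = fderiv ℝ g x x - g x := by
    intro x hx
    have h := mem_supDiff_univ_iff.1 ((hkey x hx _).2 rfl)
    rw [fderiv_legendreDual_of_min hx.1 hx.2 h, hg, (legendreDual_eq_of_min h).2]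
    ring
  refine ⟨(μ.restrict D').map T, ?_, fun hint => ?_⟩
  · intro E hE
    rw [Measure.map_apply hTm hE, Measure.restrict_apply (hTm hE)]
    have hsub : (⋃ u ∈ E, supDiff univ f u) ⊆ D := by
      intro x hx
      simp only [mem_iUnion] at hx
      obtain ⟨u, -, hx⟩ := hx
      exact (legendreDual_eq_of_min (mem_supDiff_univ_iff.1 hx)).1
    have hset : (⋃ u ∈ E, supDiff univ f u) ∩ D' = T ⁻¹' E ∩ D' := by
      ext x
      refine and_congr_left fun hxD' => ?_
      simp only [mem_iUnion, mem_preimage, exists_prop, hkey x hxD', exists_eq_right]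
    rw [← hset]
    -- The union of sup-differentials is not known to be measurable; it is enough that it lies in
    -- `D` and that `D'` has full measure in `D`.
    refine measure_congr ?_
    have h := (ae_eq_set_inter (ae_eq_refl (⋃ u ∈ E, supDiff univ f u)) hDD')
    rw [inter_eq_self_of_subset_left hsub] at h
    exact h
  · have hfm : AEStronglyMeasurable f ((μ.restrict D').map T) := hf.aestronglyMeasurable
    have hae : (fun x => f (T x)) =ᵐ[μ.restrict D'] fun x => fderiv ℝ g x x - g x := by
      filter_upwards [ae_restrict_mem hD'm] with x hx using hfT x hx
    have hr : μ.restrict D' = μ.restrict D := Measure.restrict_congr_set hDD'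
    constructor
    · rw [integrable_map_measure hfm hTm.aemeasurable]
      refine Integrable.congr ?_ hae.symm
      rw [hr]; exact hint
    · rw [integral_map hTm.aemeasurable hfm, integral_congr_ae hae, hr]

end MongeAmpere

/-! ### Concave functions on an interval. -/

section OneDim

variable {G q : ℝ → ℝ} {a b C : ℝ}

lemma chord_le_of_concaveOn (hab : a < b) (hG : ConcaveOn ℝ (Icc a b) G) {t : ℝ}
    (ht : t ∈ Icc a b) : (b - t) / (b - a) * G a + (t - a) / (b - a) * G b ≤ G t := by
  have h0 : 0 < b - a := sub_pos.2 hab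
  have h := hG.2 (left_mem_Icc.2 hab.le) (right_mem_Icc.2 hab.le)
    (div_nonneg (sub_nonneg.2 ht.2) h0.le) (div_nonneg (sub_nonneg.2 ht.1) h0.le)
    (by field_simp; ring)
  convert! h using 2
  simp only [smul_eq_mul]
  field_simp
  ring

lemma min_le_of_concaveOn_Icc (hab : a < b) (hG : ConcaveOn ℝ (Icc a b) G) {t : ℝ}
    (ht : t ∈ Icc a b) : min (G a) (G b) ≤ G t := by
  refine hG.min_le_of_mem_segment (left_mem_Icc.2 hab.le) (right_mem_Icc.2 hab.le) ?_
  rwa [segment_eq_Icc hab.le]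

/-- At an endpoint, the chord below the graph gives lower semicontinuity, and the upper half is
assumed. -/
lemma continuousOn_of_concaveOn_Icc (hab : a < b) (hG : ConcaveOn ℝ (Icc a b) G)
    (hus : UpperSemicontinuousOn G (Icc a b)) : ContinuousOn G (Icc a b) := by
  set h : ℝ → ℝ := fun t => (b - t) / (b - a) * G a + (t - a) / (b - a) * G b with hh
  have hcont : Continuous h := by fun_prop
  have h0 : b - a ≠ 0 := (sub_pos.2 hab).ne'
  have key : ∀ s ∈ Icc a b, h s = G s → ContinuousWithinAt G (Icc a b) s := by
    intro s hs hsG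
    refine tendsto_order.2 ⟨fun c hc => ?_, fun c hc => hus s hs c hc⟩
    rw [← hsG] at hc
    filter_upwards [self_mem_nhdsWithin,
      mem_nhdsWithin_of_mem_nhds (hcont.continuousAt.eventually_const_lt hc)] with t ht htc
    exact htc.trans_le (chord_le_of_concaveOn hab hG ht)
  intro s hs
  rcases eq_or_lt_of_le hs.1 with rfl | has
  · exact key _ hs (by simp only [hh]; field_simp; ring)
  rcases eq_or_lt_of_le hs.2 with rfl | hsb
  · exact key _ hs (by simp only [hh]; field_simp; ring)
  have := hG.continuousOn_interior
  rw [interior_Icc] at this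
  exact (this.continuousAt (Ioo_mem_nhds has hsb)).continuousWithinAt

/-- The right derivative is nonnegative before a maximum point `c` and nonpositive after it, so its
absolute integral is the total variation `2 * G c - G a - G b`. The derivative may be unbounded at
the endpoints; its constant sign on each side still makes it integrable. -/
lemma lintegral_rightDeriv_le (hab : a < b) (hG : ConcaveOn ℝ (Icc a b) G)
    (hcont : ContinuousOn G (Icc a b)) (hC : ∀ s ∈ Icc a b, G s ≤ C) :
    (∀ s ∈ Ioo a b, HasDerivWithinAt G (derivWithin G (Ioi s) s) (Ioi s) s) ∧
    IntegrableOn (fun s => derivWithin G (Ioi s) s) (Ioc a b) ∧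
    ∫ s in Ioc a b, ‖derivWithin G (Ioi s) s‖ ≤ 2 * C - G a - G b := by
  set p : ℝ → ℝ := fun s => derivWithin G (Ioi s) s with hp
  have hder : ∀ s ∈ Ioo a b, HasDerivWithinAt G (p s) (Ioi s) s := by
    intro s hs
    have h := hG.neg.hasDerivWithinAt_rightDeriv_of_mem_interior (x := s)
      (by rwa [interior_Icc])
    have h' := h.neg.differentiableWithinAt.hasDerivWithinAt
    simpa [hp] using h'
  obtain ⟨c, hc, hmax⟩ := isCompact_Icc.exists_isMaxOn (nonempty_Icc.2 hab.le) hcont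
  have hp1 : ∀ s ∈ Ioo a c, 0 ≤ p s := by
    intro s hs
    have hs' : s ∈ Ioo a b := ⟨hs.1, hs.2.trans_le hc.2⟩
    refine le_trans ?_ (hG.slope_le_of_hasDerivWithinAt_Ioi (Ioo_subset_Icc_self hs') hc hs.2
      (hder s hs'))
    rw [slope_def_field]
    exact div_nonneg (sub_nonneg.2 (hmax (Ioo_subset_Icc_self hs'))) (sub_nonneg.2 hs.2.le)
  have hp2 : ∀ s ∈ Ioo c b, p s ≤ 0 := by
    intro s hs
    have hs' : s ∈ Ioo a b := ⟨hc.1.trans_lt hs.1, hs.2⟩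
    have ht := (hasDerivWithinAt_iff_tendsto_slope' (by simp)).1 (hder s hs')
    refine le_of_tendsto ht ?_
    filter_upwards [Ioo_mem_nhdsGT hs.2] with t ht
    have hmem : t ∈ Icc a b := ⟨hs'.1.le.trans ht.1.le, ht.2.le⟩
    have h := hG.slope_anti_adjacent hc hmem hs.1 ht.1
    rw [slope_def_field]
    refine h.trans (div_nonpos_of_nonpos_of_nonneg (sub_nonpos.2 (hmax ?_)) (sub_nonneg.2 hs.1.le))
    exact Ioo_subset_Icc_self hs'
  have hca : ContinuousOn G (Icc a c) := hcont.mono (Icc_subset_Icc_right hc.2)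
  have hcb : ContinuousOn G (Icc c b) := hcont.mono (Icc_subset_Icc_left hc.1)
  have hder1 : ∀ s ∈ Ioo a c, HasDerivWithinAt G (p s) (Ioi s) s :=
    fun s hs => hder s ⟨hs.1, hs.2.trans_le hc.2⟩
  have hder2 : ∀ s ∈ Ioo c b, HasDerivWithinAt G (p s) (Ioi s) s :=
    fun s hs => hder s ⟨hc.1.trans_lt hs.1, hs.2⟩
  have hi1 : IntegrableOn p (Ioc a c) :=
    intervalIntegral.integrableOn_deriv_right_of_nonneg hca hder1 hp1
  have hi2 : IntegrableOn p (Ioc c b) := by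
    have h := intervalIntegral.integrableOn_deriv_right_of_nonneg hcb.neg
      (fun s hs => (hder2 s hs).neg) (fun s hs => neg_nonneg.2 (hp2 s hs))
    simpa using h.neg
  have hunion : Ioc a b = Ioc a c ∪ Ioc c b := (Ioc_union_Ioc_eq_Ioc hc.1 hc.2).symm
  refine ⟨hder, by rw [hunion]; exact hi1.union hi2, ?_⟩
  rw [hunion, setIntegral_union (Ioc_disjoint_Ioc_of_le le_rfl) measurableSet_Ioc hi1.norm hi2.norm]
  have e1 : ∫ s in Ioc a c, ‖p s‖ = G c - G a := by
    rw [integral_Ioc_eq_integral_Ioo, setIntegral_congr_fun measurableSet_Ioo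
      (fun s hs => Real.norm_of_nonneg (hp1 s hs)), ← integral_Ioc_eq_integral_Ioo,
      ← intervalIntegral.integral_of_le hc.1]
    exact intervalIntegral.integral_eq_sub_of_hasDeriv_right_of_le hc.1 hca hder1
      ((intervalIntegrable_iff_integrableOn_Ioc_of_le hc.1).2 hi1)
  have e2 : ∫ s in Ioc c b, ‖p s‖ = G c - G b := by
    rw [integral_Ioc_eq_integral_Ioo, setIntegral_congr_fun measurableSet_Ioo
      (fun s hs => Real.norm_of_nonpos (hp2 s hs)), ← integral_Ioc_eq_integral_Ioo,
      integral_neg, ← intervalIntegral.integral_of_le hc.2,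
      intervalIntegral.integral_eq_sub_of_hasDeriv_right_of_le hc.2 hcb hder2
      ((intervalIntegrable_iff_integrableOn_Ioc_of_le hc.2).2 hi2)]
    ring
  rw [e1, e2]
  linarith [hC c hc]

/-- Integration of the derivative of `s ^ (m + 1) * G s` for a concave function `G`. -/
theorem integral_deriv_pow_mul_concave (m : ℕ) (hab : a < b) (hG : ConcaveOn ℝ (Icc a b) G)
    (hus : UpperSemicontinuousOn G (Icc a b)) (hC : ∀ s ∈ Icc a b, G s ≤ C)
    (hq : ∀ᵐ s, s ∈ Ioo a b → HasDerivAt G (q s) s) :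
    ContinuousOn G (Icc a b) ∧ IntegrableOn q (Ioo a b) ∧
    ∫⁻ s in Ioo a b, ‖q s‖ₑ ≤ ENNReal.ofReal (2 * C - G a - G b) ∧
    ∫ s in Ioo a b, s ^ m * ((m + 1) * G s + s * q s) = b ^ (m + 1) * G b - a ^ (m + 1) * G a := by
  have hcont := continuousOn_of_concaveOn_Icc hab hG hus
  obtain ⟨hder, hint, hbd⟩ := lintegral_rightDeriv_le hab hG hcont hC
  set p : ℝ → ℝ := fun s => derivWithin G (Ioi s) s with hp
  -- The derivative `q` is given only almost everywhere. The fundamental theorem is applied to the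
  -- right derivative `p`, which exists at every interior point.
  have hae : ∀ᵐ s ∂volume.restrict (Ioo a b), p s = q s := by
    rw [ae_restrict_iff' measurableSet_Ioo]
    filter_upwards [hq] with s hs hs'
    exact (hs hs').hasDerivWithinAt.derivWithin (uniqueDiffWithinAt_Ioi s)
  have hint' : IntegrableOn p (Ioo a b) := hint.mono_set Ioo_subset_Ioc_self
  refine ⟨hcont, hint'.congr hae, ?_, ?_⟩
  · rw [lintegral_congr_ae (g := fun s => ‖p s‖ₑ) (hae.mono fun s hs => by simp only [hs])]
    refine le_of_eq_of_le ?_ (ENNReal.ofReal_le_ofReal hbd)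
    rw [integral_Ioc_eq_integral_Ioo, ofReal_integral_norm_eq_lintegral_enorm hint']
  · rw [integral_congr_ae (g := fun s => (m + 1) * s ^ m * G s + s ^ (m + 1) * p s)
      (hae.mono fun s hs => by simp only [hs]; ring), ← integral_Ioc_eq_integral_Ioo,
      ← intervalIntegral.integral_of_le hab.le]
    have hcp : ContinuousOn (fun s : ℝ => s ^ (m + 1) * G s) (Icc a b) :=
      (continuousOn_pow _).mul hcont
    refine intervalIntegral.integral_eq_sub_of_hasDeriv_right_of_le hab.le hcp ?_ ?_
    · intro s hs
      have h1 : HasDerivWithinAt (fun s : ℝ => s ^ (m + 1)) ((m + 1) * s ^ m) (Ioi s) s := by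
        simpa using (hasDerivAt_pow (m + 1) s).hasDerivWithinAt
      exact h1.mul (hder s hs)
    · refine IntervalIntegrable.add ?_ ?_
      · refine ContinuousOn.intervalIntegrable ?_
        rw [uIcc_of_le hab.le]
        exact ContinuousOn.mul (by fun_prop) hcont
      · refine IntervalIntegrable.continuousOn_mul ?_ (by fun_prop)
        exact (intervalIntegrable_iff_integrableOn_Ioc_of_le hab.le).2 hint

end OneDim

/-! ### Rays from the origin through a convex body. -/

section Rays

variable {E : Type*} [NormedAddCommGroup E] [NormedSpace ℝ E] {D : Set E}

/-- The open cone with apex `0` spanned by the interior of `D`. -/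
def openCone (D : Set E) : Set E := {x | ∃ s : ℝ, 0 < s ∧ s • x ∈ interior D}

/-- The parameter at which the ray of `x` enters the interior of `D`. -/
noncomputable def entry (D : Set E) (x : E) : ℝ := sInf {s : ℝ | 0 < s ∧ s • x ∈ interior D}

lemma bddBelow_entry (D : Set E) (x : E) : BddBelow {s : ℝ | 0 < s ∧ s • x ∈ interior D} :=
  ⟨0, fun _ hs => hs.1.le⟩

lemma entry_nonneg (x : E) : 0 ≤ entry D x := Real.sInf_nonneg fun _ hs => hs.1.le

lemma isOpen_openCone : IsOpen (openCone D) := by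
  have : openCone D = ⋃ s ∈ Ioi (0 : ℝ), (fun x : E => s • x) ⁻¹' interior D := by
    ext x; simp [openCone]
  rw [this]
  exact isOpen_biUnion fun s _ => isOpen_interior.preimage (continuous_const_smul s)

lemma interior_subset_openCone : interior D ⊆ openCone D :=
  fun x hx => ⟨1, one_pos, by rwa [one_smul]⟩

lemma smul_mem_openCone_iff {s : ℝ} (hs : 0 < s) {x : E} : s • x ∈ openCone D ↔ x ∈ openCone D := by
  constructor
  · rintro ⟨r, hr, h⟩
    exact ⟨r * s, mul_pos hr hs, by rwa [mul_smul]⟩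
  · rintro ⟨r, hr, h⟩
    exact ⟨r / s, div_pos hr hs, by rwa [smul_smul, div_mul_cancel₀ _ hs.ne']⟩

lemma entry_smul {s : ℝ} (hs : 0 < s) (x : E) : entry D (s • x) = s⁻¹ * entry D x := by
  have : {r : ℝ | 0 < r ∧ r • s • x ∈ interior D} =
      s⁻¹ • {r : ℝ | 0 < r ∧ r • x ∈ interior D} := by
    ext r
    rw [mem_smul_set_iff_inv_smul_mem₀ (inv_ne_zero hs.ne'), inv_inv, smul_eq_mul]
    simp only [mem_ofPred_eq, smul_smul, mul_comm s r]
    rw [mul_pos_iff_of_pos_right hs]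
  rw [entry, this, Real.sInf_smul_of_nonneg (inv_nonneg.2 hs.le), smul_eq_mul, entry]

lemma measurable_entry [MeasurableSpace E] [BorelSpace E] : Measurable (entry D) := by
  refine measurable_of_Iio fun c => ?_
  have hU : MeasurableSet (openCone D) := isOpen_openCone.measurableSet
  have hV : IsOpen (⋃ s ∈ Ioo (0 : ℝ) c, (fun x : E => s • x) ⁻¹' interior D) :=
    isOpen_biUnion fun s _ => isOpen_interior.preimage (continuous_const_smul s)
  have : entry D ⁻¹' Iio c = (⋃ s ∈ Ioo (0 : ℝ) c, (fun x : E => s • x) ⁻¹' interior D) ∪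
      ((openCone D)ᶜ ∩ {_x | 0 < c}) := by
    ext x
    simp only [mem_preimage, mem_Iio, mem_union, mem_iUnion, mem_inter_iff, mem_compl_iff,
      mem_Ioo, exists_prop, mem_ofPred_eq]
    by_cases hx : x ∈ openCone D
    · simp only [hx, not_true_eq_false, false_and, or_false]
      rw [entry, csInf_lt_iff (bddBelow_entry D x) hx]
      exact ⟨fun ⟨s, hs, hc⟩ => ⟨s, ⟨hs.1, hc⟩, hs.2⟩, fun ⟨s, hs, hc⟩ => ⟨s, ⟨hs.1, hc⟩, hs.2⟩⟩
    · have h0 : entry D x = 0 := by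
        have : {s : ℝ | 0 < s ∧ s • x ∈ interior D} = ∅ :=
          eq_empty_of_forall_notMem fun s hs => hx ⟨s, hs⟩
        rw [entry, this, Real.sInf_empty]
      simp only [hx, not_false_eq_true, true_and, h0]
      exact ⟨Or.inr, fun h => h.elim (fun ⟨s, hs, _⟩ => hs.1.trans hs.2) id⟩
  rw [this]
  exact hV.measurableSet.union (hU.compl.inter (MeasurableSet.const _))

variable {p : E}

lemma ordConnected_smul_preimage {A : Set E} (hA : Convex ℝ A) (p : E) :
    ((fun t : ℝ => t • p) ⁻¹' A).OrdConnected :=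
  (hA.linear_preimage (LinearMap.toSpanSingleton ℝ E p)).ordConnected

lemma smul_mem_interior_of_lt (hD : Convex ℝ D) (hp : p ∈ D) {r s : ℝ} (hr : r • p ∈ interior D)
    (hs : s ∈ Ico r 1) : s • p ∈ interior D := by
  have hr1 : r < 1 := hs.1.trans_lt hs.2
  have h := hD.combo_interior_self_mem_interior hr hp
    (a := (1 - s) / (1 - r)) (b := (s - r) / (1 - r)) (div_pos (by linarith [hs.2]) (by linarith))
    (div_nonneg (by linarith [hs.1]) (by linarith)) (by field_simp [(sub_pos.2 hr1).ne']; ring)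
  convert! h using 1
  rw [smul_smul, ← add_smul]
  congr 1
  field_simp [(sub_pos.2 hr1).ne']
  ring

lemma smul_mem_interior_of_gt (hD : Convex ℝ D) (hp : p ∈ D) {r s : ℝ} (hr : r • p ∈ interior D)
    (hs : s ∈ Ioc 1 r) : s • p ∈ interior D := by
  have hr1 : 0 < r - 1 := sub_pos.2 (hs.1.trans_le hs.2)
  have h := hD.combo_interior_self_mem_interior hr hp
    (a := (s - 1) / (r - 1)) (b := (r - s) / (r - 1)) (div_pos (by linarith [hs.1]) hr1)
    (div_nonneg (by linarith [hs.2]) hr1.le) (by field_simp; ring)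
  convert! h using 1
  rw [smul_smul, ← add_smul]
  congr 1
  field_simp
  ring

/-- Openness excludes the entry parameter itself. A parameter `s ≥ 1` is excluded because `p` would
lie between two interior points of the ray. -/
lemma smul_mem_interior_iff_of_exit (hD : Convex ℝ D) (hp : p ∈ D) (hp' : p ∉ interior D)
    (h : ∃ s ∈ Ioo (0 : ℝ) 1, s • p ∈ interior D) {s : ℝ} (hs : 0 < s) :
    s • p ∈ interior D ↔ s ∈ Ioo (entry D p) 1 := by
  obtain ⟨r, hr, hrp⟩ := h
  constructor
  · intro hsp
    refine ⟨?_, ?_⟩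
    · have hcont : ContinuousAt (fun t : ℝ => t • p) s := by fun_prop
      have h1 : ∀ᶠ t in 𝓝 s, t • p ∈ interior D ∧ 0 < t :=
        (hcont.eventually_mem (isOpen_interior.mem_nhds hsp)).and (lt_mem_nhds hs)
      obtain ⟨t, ht, hts⟩ := ((h1.filter_mono nhdsWithin_le_nhds).and
        (self_mem_nhdsWithin : Iio s ∈ 𝓝[<] s)).exists
      exact (csInf_le (bddBelow_entry D p) ⟨ht.2, ht.1⟩).trans_lt hts
    · by_contra! hs1
      apply hp'
      simpa using (ordConnected_smul_preimage hD.interior p).out (x := r) hrp (y := s) hsp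
        ⟨hr.2.le, hs1⟩
  · intro hs'
    obtain ⟨t, ht, hts⟩ := (csInf_lt_iff (bddBelow_entry D p) ⟨r, hr.1, hrp⟩).1 hs'.1
    exact smul_mem_interior_of_lt hD hp ht.2 ⟨hts.le, hs'.2⟩

lemma entry_lt_one_of_exit (h : ∃ s ∈ Ioo (0 : ℝ) 1, s • p ∈ interior D) : entry D p < 1 := by
  obtain ⟨r, hr, hrp⟩ := h
  exact (csInf_le (bddBelow_entry D p) ⟨hr.1, hrp⟩).trans_lt hr.2

lemma smul_mem_of_exit (hD : Convex ℝ D) (hDc : IsClosed D) (hp : p ∈ D) (hp' : p ∉ interior D)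
    (h : ∃ s ∈ Ioo (0 : ℝ) 1, s • p ∈ interior D) {s : ℝ} (hs : s ∈ Icc (entry D p) 1) :
    s • p ∈ D := by
  have h1 := entry_lt_one_of_exit h
  have hsub : Ioo (entry D p) 1 ⊆ (fun t : ℝ => t • p) ⁻¹' D := fun t ht =>
    interior_subset (s := D) ((smul_mem_interior_iff_of_exit hD hp hp' h
      ((entry_nonneg p).trans_lt ht.1)).2 ht)
  have hcl : IsClosed ((fun t : ℝ => t • p) ⁻¹' D) := hDc.preimage (by fun_prop)
  have := closure_minimal hsub hcl
  rw [closure_Ioo h1.ne] at this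
  exact this hs

/-- If the ray meets the interior at `r • x`, all points `t • r • x` with `0 < t ≤ 1` are interior,
by convexity with `0`. Otherwise the default value is `0`. -/
lemma entry_eq_zero_of_zero_mem (hD : Convex ℝ D) (h0 : (0 : E) ∈ D) (x : E) : entry D x = 0 := by
  by_cases h : {s : ℝ | 0 < s ∧ s • x ∈ interior D}.Nonempty
  · obtain ⟨r, hr, hrx⟩ := h
    refine le_antisymm (le_of_forall_pos_le_add fun ε hε => ?_) (entry_nonneg x)
    set t := min (ε / r) 1 with ht
    have ht0 : 0 < t := lt_min (div_pos hε hr) one_pos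
    have h := hD.combo_interior_self_mem_interior hrx h0 (a := t) (b := 1 - t) ht0
      (sub_nonneg.2 (min_le_right _ _)) (by ring)
    rw [smul_zero, add_zero, smul_smul] at h
    refine (csInf_le (bddBelow_entry D x) ⟨mul_pos ht0 hr, h⟩).trans ?_
    have h2 : t ≤ ε / r := min_le_left _ _
    rw [le_div_iff₀ hr] at h2
    linarith
  · rw [entry, not_nonempty_iff_eq_empty.1 h, Real.sInf_empty]

lemma entry_eq_one (hD : Convex ℝ D) (hp : p ∈ D) (hp' : p ∉ interior D)
    (h : ∃ s > (1 : ℝ), s • p ∈ interior D) : entry D p = 1 := by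
  obtain ⟨r, hr, hrp⟩ := h
  refine le_antisymm (le_of_forall_pos_le_add fun ε hε => ?_) ?_
  · have h := smul_mem_interior_of_gt hD hp hrp (s := min (1 + ε) r)
      ⟨lt_min (by linarith) hr, min_le_right _ _⟩
    refine (csInf_le (bddBelow_entry D p) ⟨lt_min (by linarith) (by linarith), h⟩).trans
      (min_le_left _ _)
  · refine le_csInf ⟨r, by linarith, hrp⟩ ?_
    rintro s ⟨hs, hsp⟩
    by_contra! hs1
    apply hp'
    simpa using (ordConnected_smul_preimage hD.interior p).out (x := s) hsp (y := r) hrp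
      ⟨hs1.le, hr.le⟩

end Rays

/-! ### Polar coordinates with an arbitrary angular measure. -/

section Polar

variable {E : Type*} [NormedAddCommGroup E] [NormedSpace ℝ E] [FiniteDimensional ℝ E]
  [MeasurableSpace E] [BorelSpace E]

/-- The measure `s ^ m ds` on `(0, ∞)`. -/
noncomputable def powMeasure (m : ℕ) : Measure ℝ :=
  (volume.restrict (Ioi 0)).withDensity fun s => ENNReal.ofReal (s ^ m)

instance (m : ℕ) : SFinite (powMeasure m) := by unfold powMeasure; infer_instance

lemma lintegral_powMeasure (m : ℕ) {h : ℝ → ENNReal} (hh : Measurable h) :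
    ∫⁻ s, h s ∂powMeasure m = ∫⁻ s in Ioi 0, ENNReal.ofReal (s ^ m) * h s := by
  rw [powMeasure, lintegral_withDensity_eq_lintegral_mul _ (by fun_prop) hh]
  rfl

lemma integral_powMeasure (m : ℕ) (h : ℝ → ℝ) :
    ∫ s, h s ∂powMeasure m = ∫ s in Ioi 0, s ^ m * h s := by
  rw [powMeasure, integral_withDensity_eq_integral_toReal_smul (by fun_prop) (by simp)]
  refine setIntegral_congr_fun measurableSet_Ioi fun s hs => ?_
  simp only [smul_eq_mul]
  rw [ENNReal.toReal_ofReal (pow_nonneg (le_of_lt hs) _)]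

/-- The measure `μ` on the cone `U` is, in polar coordinates `(p, s) ↦ s • p`, the product
of `κ` and `s ^ m ds`. -/
def IsPolar (m : ℕ) (μ : Measure E) (U : Set E) (κ : Measure E) : Prop :=
  (κ.prod (powMeasure m)).map (fun q : E × ℝ => q.2 • q.1) = μ.restrict U

variable {m : ℕ} {μ κ κ' : Measure E} {U : Set E}

lemma measurable_smul_prod : Measurable (fun q : E × ℝ => q.2 • q.1) := by fun_prop

lemma IsPolar.lintegral_eq [SFinite κ] (h : IsPolar m μ U κ) {w : E → ENNReal} (hw : Measurable w) :
    ∫⁻ x in U, w x ∂μ = ∫⁻ p, (∫⁻ s in Ioi (0 : ℝ), ENNReal.ofReal (s ^ m) * w (s • p)) ∂κ := by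
  rw [← h, lintegral_map hw measurable_smul_prod,
    lintegral_prod (fun q : E × ℝ => w (q.2 • q.1)) (hw.comp measurable_smul_prod).aemeasurable]
  refine lintegral_congr fun p => ?_
  rw [lintegral_powMeasure]
  fun_prop

lemma IsPolar.integral_eq [SFinite κ] (h : IsPolar m μ U κ) {w : E → ℝ} (hw : IntegrableOn w U μ) :
    ∫ x in U, w x ∂μ = ∫ p, (∫ s in Ioi (0 : ℝ), s ^ m * w (s • p)) ∂κ := by
  rw [IntegrableOn, ← h] at hw
  rw [← h, integral_map measurable_smul_prod.aemeasurable hw.1,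
    integral_prod (fun q : E × ℝ => w (q.2 • q.1)) (hw.comp_measurable measurable_smul_prod)]
  refine integral_congr_ae (ae_of_all _ fun p => ?_)
  exact integral_powMeasure m _

/-- Fubini in polar coordinates: almost every ray meets a null set in a null set of parameters, as
the density `s ^ m` is positive there. -/
lemma IsPolar.ae_ae [SFinite κ] (h : IsPolar m μ U κ) {P : E → Prop} (hP : MeasurableSet {x | P x})
    (hμ : ∀ᵐ x ∂μ, P x) : ∀ᵐ p ∂κ, ∀ᵐ s : ℝ, 0 < s → P (s • p) := by
  have h1 : ∫⁻ x in U, {x | P x}ᶜ.indicator (1 : E → ENNReal) x ∂μ = 0 := by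
    rw [lintegral_indicator_one hP.compl]
    exact le_antisymm ((Measure.restrict_apply_le _ _).trans_eq hμ) bot_le
  rw [h.lintegral_eq (measurable_one.indicator hP.compl), lintegral_eq_zero_iff] at h1
  · filter_upwards [h1] with p hp
    rw [Pi.zero_apply, lintegral_eq_zero_iff, EventuallyEq, ae_restrict_iff' measurableSet_Ioi] at hp
    · filter_upwards [hp] with s hs hs0
      by_contra hc
      have := hs hs0
      simp only [Pi.zero_apply, mul_eq_zero, ENNReal.ofReal_eq_zero, not_le.2 (pow_pos hs0 m),
        false_or, indicator_apply_eq_zero] at this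
      exact one_ne_zero (this hc)
    · exact (Measurable.ennreal_ofReal (by fun_prop)).mul
        ((measurable_one.indicator hP.compl).comp (by fun_prop))
  · refine Measurable.lintegral_prod_right' (ν := volume.restrict (Ioi 0)) (f := fun q : E × ℝ =>
      ENNReal.ofReal (q.2 ^ m) * {x | P x}ᶜ.indicator (1 : E → ENNReal) (q.2 • q.1)) ?_
    exact (Measurable.ennreal_ofReal (by fun_prop)).mul
        ((measurable_one.indicator hP.compl).comp measurable_smul_prod)

/-- The measure `ds / s` is invariant under scaling, so the value does not depend on `r`. -/
lemma lintegral_inv_Ioo {r : ℝ} (hr : 0 < r) :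
    ∫⁻ s in Ioo (1 / r) (2 / r), ENNReal.ofReal s⁻¹ = ENNReal.ofReal (Real.log 2) := by
  have h1 : 0 < 1 / r := by positivity
  have hle : 1 / r ≤ 2 / r := by gcongr; norm_num
  rw [← ofReal_integral_eq_lintegral_ofReal, ← integral_Ioc_eq_integral_Ioo,
    ← intervalIntegral.integral_of_le hle, integral_inv_of_pos h1 (by positivity)]
  · congr 2; field_simp
  · refine IntegrableOn.mono_set (t := Icc (1 / r) (2 / r)) ?_ Ioo_subset_Icc_self
    refine (ContinuousOn.inv₀ continuousOn_id fun s hs => ?_).integrableOn_Icc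
    exact (h1.trans_le hs.1).ne'
  · rw [EventuallyLE, ae_restrict_iff' measurableSet_Ioo]
    exact ae_of_all _ fun s hs => inv_nonneg.2 (h1.trans hs.1).le

/-- Along the ray of `p`, homogeneity turns `s ^ m * w (s • p) ds` into `w p * ds / s`, and the ray
crosses the shell `1 < ‖x‖ < 2` in an interval of `ds / s`-length `log 2`, whatever `p` is. -/
lemma IsPolar.lintegral_homogeneous [SFinite κ] (h : IsPolar m μ U κ) (h0 : ∀ᵐ p ∂κ, p ≠ 0)
    {w : E → ENNReal} (hw : Measurable w)
    (hhom : ∀ s : ℝ, 0 < s → ∀ x, w (s • x) = ENNReal.ofReal (s⁻¹ ^ (m + 1)) * w x) :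
    ∫⁻ x in U, {x | 1 < ‖x‖ ∧ ‖x‖ < 2}.indicator w x ∂μ =
      ENNReal.ofReal (Real.log 2) * ∫⁻ p, w p ∂κ := by
  have hS : MeasurableSet {x : E | 1 < ‖x‖ ∧ ‖x‖ < 2} :=
    ((isOpen_lt continuous_const continuous_norm).inter
      (isOpen_lt continuous_norm continuous_const)).measurableSet
  rw [h.lintegral_eq (hw.indicator hS), ← lintegral_const_mul _ hw]
  refine lintegral_congr_ae ?_
  filter_upwards [h0] with p hp
  have hn : 0 < ‖p‖ := norm_pos_iff.2 hp
  rw [← lintegral_inv_Ioo hn, ← lintegral_mul_const _ (by fun_prop),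
    ← lintegral_indicator measurableSet_Ioi, ← lintegral_indicator measurableSet_Ioo]
  refine lintegral_congr fun s => ?_
  by_cases hs : 0 < s
  · have hiff : s • p ∈ {x : E | 1 < ‖x‖ ∧ ‖x‖ < 2} ↔ s ∈ Ioo (1 / ‖p‖) (2 / ‖p‖) := by
      simp only [mem_ofPred_eq, norm_smul, Real.norm_of_nonneg hs.le, mem_Ioo, div_lt_iff₀ hn,
        lt_div_iff₀ hn]
    rw [indicator_of_mem (mem_Ioi.2 hs)]
    by_cases hsp : s • p ∈ {x : E | 1 < ‖x‖ ∧ ‖x‖ < 2}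
    · rw [indicator_of_mem hsp, indicator_of_mem (hiff.1 hsp), hhom s hs, ← mul_assoc,
        ← ENNReal.ofReal_mul (by positivity)]
      congr 2
      rw [inv_pow]
      field_simp
      ring
    · rw [indicator_of_notMem hsp, indicator_of_notMem (fun h => hsp (hiff.2 h)), mul_zero]
  · rw [indicator_of_notMem (by simpa using hs), indicator_of_notMem]
    rintro ⟨h1, -⟩
    exact hs ((by positivity : (0 : ℝ) < 1 / ‖p‖).trans h1)

/-- The integral over the shell depends on `μ` and `U` alone. This is what transports the boundary
term from entry points to exit points. -/
lemma IsPolar.lintegral_eq_of_homogeneous [SFinite κ] [SFinite κ'] (h : IsPolar m μ U κ)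
    (h' : IsPolar m μ U κ') (h0 : ∀ᵐ p ∂κ, p ≠ 0) (h0' : ∀ᵐ p ∂κ', p ≠ 0)
    {w : E → ENNReal} (hw : Measurable w)
    (hhom : ∀ s : ℝ, 0 < s → ∀ x, w (s • x) = ENNReal.ofReal (s⁻¹ ^ (m + 1)) * w x) :
    ∫⁻ p, w p ∂κ = ∫⁻ p, w p ∂κ' := by
  have e := (h.lintegral_homogeneous h0 hw hhom).symm.trans (h'.lintegral_homogeneous h0' hw hhom)
  refine (ENNReal.mul_right_inj ?_ ENNReal.ofReal_ne_top).1 e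
  exact (ENNReal.ofReal_pos.2 (Real.log_pos one_lt_two)).ne'

lemma IsPolar.integrable_and_integral_eq_of_homogeneous [SFinite κ] [SFinite κ']
    (h : IsPolar m μ U κ)
    (h' : IsPolar m μ U κ') (h0 : ∀ᵐ p ∂κ, p ≠ 0) (h0' : ∀ᵐ p ∂κ', p ≠ 0)
    {w : E → ℝ} (hw : Measurable w)
    (hhom : ∀ s : ℝ, 0 < s → ∀ x, w (s • x) = s⁻¹ ^ (m + 1) * w x) (hint : Integrable w κ') :
    Integrable w κ ∧ ∫ p, w p ∂κ = ∫ p, w p ∂κ' := by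
  have hi : Integrable w κ := by
    refine ⟨hw.aestronglyMeasurable, ?_⟩
    rw [HasFiniteIntegral, h.lintegral_eq_of_homogeneous h' h0 h0' hw.enorm]
    · exact hint.2
    · intro s hs x
      rw [hhom s hs, enorm_mul, Real.enorm_of_nonneg (by positivity)]
  refine ⟨hi, ?_⟩
  rw [integral_eq_lintegral_pos_part_sub_lintegral_neg_part hi,
    integral_eq_lintegral_pos_part_sub_lintegral_neg_part hint,
    h.lintegral_eq_of_homogeneous h' h0 h0' hw.ennreal_ofReal,
    h.lintegral_eq_of_homogeneous h' h0 h0' (w := fun x => ENNReal.ofReal (-w x))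
      hw.neg.ennreal_ofReal]
  · intro s hs x
    rw [hhom s hs, ← ENNReal.ofReal_mul (by positivity), mul_neg]
  · intro s hs x
    rw [hhom s hs, ← ENNReal.ofReal_mul (by positivity)]

end Polar

/-! ### The divergence theorem, ray by ray. -/

section RadialIntegration

variable {E : Type*} [NormedAddCommGroup E] [NormedSpace ℝ E]
  [MeasurableSpace E] [BorelSpace E] {D : Set E} {g : E → ℝ}

lemma measurable_indicator_of_upperSemicontinuousOn {E : Type*} [TopologicalSpace E]
    [MeasurableSpace E] [BorelSpace E] {D : Set E} {g : E → ℝ} (hDc : IsClosed D)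
    (hg : UpperSemicontinuousOn g D) : Measurable (D.indicator g) := by
  refine measurable_of_Iio fun c => ?_
  choose! V hVo hV using fun x (hx : x ∈ D ∧ g x < c) =>
    mem_nhdsWithin.1 (hg x hx.1 c hx.2)
  have h1 : D ∩ {x | g x < c} = D ∩ ⋃ x ∈ D ∩ {x | g x < c}, V x := by
    ext y
    constructor
    · intro hy
      exact ⟨hy.1, mem_biUnion hy (hV y hy).1⟩
    · rintro ⟨hy, hy'⟩
      obtain ⟨x, hx, hyx⟩ := mem_iUnion₂.1 hy'
      exact ⟨hy, (hV x hx).2 ⟨hyx, hy⟩⟩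
  have h2 : MeasurableSet (D ∩ {x | g x < c}) := by
    rw [h1]
    exact hDc.measurableSet.inter (isOpen_biUnion fun x hx => hVo x hx).measurableSet
  have h3 : D.indicator g ⁻¹' Iio c = (D ∩ {x | g x < c}) ∪ (Dᶜ ∩ {_x | (0 : ℝ) < c}) := by
    ext x
    by_cases hx : x ∈ D <;> simp [hx]
  rw [h3]
  exact h2.union (hDc.measurableSet.compl.inter (MeasurableSet.const _))

/-- Along the ray of an exit point. -/
lemma radial_aux {E : Type*} [NormedAddCommGroup E] [NormedSpace ℝ E] {D : Set E} {g : E → ℝ}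
    [FiniteDimensional ℝ E] (hD : Convex ℝ D) (hDc : IsCompact D)
    (hg : ConcaveOn ℝ D g) (hus : UpperSemicontinuousOn g D) {C : ℝ} (hC : ∀ x ∈ D, g x ≤ C)
    (m : ℕ) {p : E} (hp : p ∈ D) (hp' : p ∉ interior D)
    (hex : ∃ s ∈ Ioo (0 : ℝ) 1, s • p ∈ interior D)
    (hdiff : ∀ᵐ s : ℝ, 0 < s → s • p ∈ interior D → DifferentiableAt ℝ g (s • p)) :
    (∫⁻ s in Ioi (0 : ℝ), ENNReal.ofReal (s ^ m) * ‖(interior D).indicator g (s • p)‖ₑ ≤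
      ENNReal.ofReal (2 * |C| + |g p| + |g (entry D p • p)|)) ∧
    (∫⁻ s in Ioi (0 : ℝ), ENNReal.ofReal (s ^ m) *
        ‖(interior D).indicator (fun x => fderiv ℝ g x x) (s • p)‖ₑ ≤
      ENNReal.ofReal (2 * |C| + |g p| + |g (entry D p • p)|)) ∧
    ∫ s in Ioi (0 : ℝ), s ^ m *
        (interior D).indicator (fun x => (m + 1) * g x + fderiv ℝ g x x) (s • p) =
      g p - entry D p ^ (m + 1) * g (entry D p • p) := by
  set a := entry D p with ha
  have ha0 : 0 ≤ a := entry_nonneg p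
  have ha1 : a < 1 := entry_lt_one_of_exit hex
  have hmem : ∀ s ∈ Icc a 1, s • p ∈ D := fun s hs => smul_mem_of_exit hD hDc.isClosed hp hp' hex hs
  have hint : ∀ s : ℝ, 0 < s → (s • p ∈ interior D ↔ s ∈ Ioo a 1) := fun s hs =>
    smul_mem_interior_iff_of_exit hD hp hp' hex hs
  have hsub : Ioo a 1 ⊆ Ioi 0 := fun s hs => ha0.trans_lt hs.1
  set G : ℝ → ℝ := fun s => g (s • p) with hG
  have hGc : ConcaveOn ℝ (Icc a 1) G :=
    (hg.comp_linearMap (LinearMap.toSpanSingleton ℝ E p)).subset hmem (convex_Icc _ _)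
  have hGu : UpperSemicontinuousOn G (Icc a 1) :=
    hus.comp (g := fun s : ℝ => s • p) (by fun_prop) hmem
  have hd : ∀ᵐ s, s ∈ Ioo a 1 → HasDerivAt G (fderiv ℝ g (s • p) p) s := by
    filter_upwards [hdiff] with s hs hs'
    have h1 := (hs (hsub hs') ((hint s (hsub hs')).2 hs')).hasFDerivAt
    have h2 : HasDerivAt (fun t : ℝ => t • p) p s := by
      simpa using (hasDerivAt_id s).smul_const p
    exact h1.comp_hasDerivAt s h2
  obtain ⟨hcont, -, hq, hI⟩ := integral_deriv_pow_mul_concave m ha1 hGc hGu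
    (fun s hs => hC _ (hmem s hs)) hd
  have hind : ∀ (w : E → ℝ) (s : ℝ), (Ioi (0 : ℝ)).indicator
      (fun s => ENNReal.ofReal (s ^ m) * ‖(interior D).indicator w (s • p)‖ₑ) s =
      (Ioo a 1).indicator (fun s => ENNReal.ofReal (s ^ m) * ‖w (s • p)‖ₑ) s := by
    intro w s
    by_cases hs : 0 < s
    · rw [indicator_of_mem (mem_Ioi.2 hs)]
      by_cases hs' : s ∈ Ioo a 1
      · rw [indicator_of_mem hs', indicator_of_mem ((hint s hs).2 hs')]
      · rw [indicator_of_notMem hs', indicator_of_notMem (fun h => hs' ((hint s hs).1 h)), enorm_zero,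
          mul_zero]
    · rw [indicator_of_notMem (by simpa using hs), indicator_of_notMem (fun h => hs (hsub h))]
  -- The ray leaves `D` at parameter `1`, so the density is at most `1` inside.
  have hpow : ∀ s ∈ Ioo a 1, ENNReal.ofReal (s ^ m) ≤ 1 := by
    intro s hs
    rw [ENNReal.ofReal_le_one]
    exact pow_le_one₀ (hsub hs).le hs.2.le
  have hG1 : G 1 = g p := by simp [hG]
  refine ⟨?_, ?_, ?_⟩
  · rw [← lintegral_indicator measurableSet_Ioi, lintegral_congr (hind g),
      lintegral_indicator measurableSet_Ioo]
    calc _ ≤ ∫⁻ s in Ioo a 1, ENNReal.ofReal (2 * |C| + |g p| + |g (a • p)|) := by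
          refine setLIntegral_mono' measurableSet_Ioo fun s hs => ?_
          refine (mul_le_mul' (hpow s hs) le_rfl).trans ?_
          rw [one_mul, ← ofReal_norm]
          refine ENNReal.ofReal_le_ofReal ?_
          have h1 := hC _ (hmem s (Ioo_subset_Icc_self hs))
          have h2 := min_le_of_concaveOn_Icc ha1 hGc (Ioo_subset_Icc_self hs)
          rw [hG1] at h2
          rw [Real.norm_eq_abs, abs_le]
          have h3 := abs_nonneg C
          have h4 := neg_abs_le (g p)
          have h5 := neg_abs_le (g (a • p))
          have h6 := le_abs_self C
          have h7 := abs_nonneg (g p)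
          have h8 := abs_nonneg (g (a • p))
          rcases min_le_iff.1 h2 with h | h
          · change g (a • p) ≤ g (s • p) at h
            constructor <;> linarith
          · change g p ≤ g (s • p) at h
            constructor <;> linarith
      _ ≤ _ := by
          rw [setLIntegral_const, Real.volume_Ioo]
          refine mul_le_of_le_one_right' ?_
          rw [ENNReal.ofReal_le_one]
          linarith
  · rw [← lintegral_indicator measurableSet_Ioi, lintegral_congr (hind _),
      lintegral_indicator measurableSet_Ioo]
    calc _ ≤ ∫⁻ s in Ioo a 1, ‖fderiv ℝ g (s • p) p‖ₑ := by
          refine setLIntegral_mono' measurableSet_Ioo fun s hs => ?_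
          rw [map_smul, smul_eq_mul, enorm_mul, ← mul_assoc]
          refine mul_le_of_le_one_left' ?_
          rw [Real.enorm_of_nonneg (hsub hs).le]
          refine mul_le_one' (hpow s hs) ?_
          rw [ENNReal.ofReal_le_one]
          exact hs.2.le
      _ ≤ _ := by
          refine hq.trans (ENNReal.ofReal_le_ofReal ?_)
          rw [hG1]
          change 2 * C - g (a • p) - g p ≤ _
          linarith [neg_abs_le (g p), neg_abs_le (g (a • p)), le_abs_self C]
  · rw [hG1, one_pow, one_mul] at hI
    refine Eq.trans ?_ hI
    rw [← integral_indicator measurableSet_Ioi, ← integral_indicator measurableSet_Ioo]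
    refine integral_congr_ae (ae_of_all _ fun s => ?_)
    by_cases hs : 0 < s
    · simp only [indicator_of_mem (mem_Ioi.2 hs)]
      by_cases hs' : s ∈ Ioo a 1
      · rw [indicator_of_mem hs', indicator_of_mem ((hint s hs).2 hs'), map_smul, smul_eq_mul]
      · rw [indicator_of_notMem hs', indicator_of_notMem (fun h => hs' ((hint s hs).1 h)), mul_zero]
    · rw [indicator_of_notMem (by simpa using hs), indicator_of_notMem (fun h => hs (hsub h))]

/-- Integration of the divergence of the vector field `g x • x`, for a concave function `g`, in
polar coordinates. -/
theorem integral_divergence_of_isPolar [FiniteDimensional ℝ E] (hD : Convex ℝ D) (hDc : IsCompact D)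
    (hg : ConcaveOn ℝ D g) (hus : UpperSemicontinuousOn g D) (m : ℕ)
    (μ : Measure E) [μ.IsAddHaarMeasure] {κ κ' : Measure E} [IsFiniteMeasure κ] [IsFiniteMeasure κ']
    (hκ : IsPolar m μ (openCone D) κ) (hκ' : (0 : E) ∉ D → IsPolar m μ (openCone D) κ')
    (hκ0 : (0 : E) ∈ D → κ' = 0)
    (hex : ∀ᵐ p ∂κ, p ∈ D ∧ p ∉ interior D ∧ ∃ s ∈ Ioo (0 : ℝ) 1, s • p ∈ interior D)
    (hen : ∀ᵐ p ∂κ', p ∈ D ∧ p ∉ interior D ∧ ∃ s > (1 : ℝ), s • p ∈ interior D)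
    (hgκ : Integrable g κ) (hgκ' : Integrable g κ') :
    IntegrableOn g D μ ∧ IntegrableOn (fun x => fderiv ℝ g x x) D μ ∧
      ∫ x in D, ((m + 1) * g x + fderiv ℝ g x x) ∂μ = ∫ p, g p ∂κ - ∫ p, g p ∂κ' := by
  obtain ⟨C, hC⟩ : ∃ C, ∀ x ∈ D, g x ≤ C := by
    obtain ⟨C, hC⟩ := hus.bddAbove_of_isCompact hDc
    exact ⟨C, fun x hx => hC ⟨x, hx, rfl⟩⟩
  have hgm : Measurable (D.indicator g) :=
    measurable_indicator_of_upperSemicontinuousOn hDc.isClosed hus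
  have hgm' : Measurable ((interior D).indicator g) := by
    have : (interior D).indicator g = (interior D).indicator (D.indicator g) := by
      rw [indicator_indicator, inter_eq_self_of_subset_left interior_subset]
    rw [this]; exact hgm.indicator isOpen_interior.measurableSet
  have hfm : Measurable fun x => fderiv ℝ g x x :=
    (continuous_fst.clm_apply continuous_snd).measurable.comp
      ((measurable_fderiv ℝ g).prodMk measurable_id)
  have hfm' : Measurable ((interior D).indicator fun x => fderiv ℝ g x x) :=
    hfm.indicator isOpen_interior.measurableSet
  -- the boundary value at the entry point
  set w : E → ℝ := fun x => entry D x ^ (m + 1) * D.indicator g (entry D x • x) with hw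
  have hwm : Measurable w :=
    (measurable_entry.pow_const _).mul (hgm.comp (measurable_entry.smul measurable_id))
  have hwhom : ∀ s : ℝ, 0 < s → ∀ x, w (s • x) = s⁻¹ ^ (m + 1) * w x := by
    intro s hs x
    simp only [hw, entry_smul hs, smul_smul]
    rw [mul_pow, mul_assoc, mul_right_comm, inv_mul_cancel₀ hs.ne', one_mul]
  have hmemD : ∀ᵐ p ∂κ, entry D p • p ∈ D := by
    filter_upwards [hex] with p hp
    exact smul_mem_of_exit hD hDc.isClosed hp.1 hp.2.1 hp.2.2
      ⟨le_rfl, (entry_lt_one_of_exit hp.2.2).le⟩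
  -- If `0 ∈ D`, rays enter at parameter `0` and the factor `entry D x ^ (m + 1)` kills the term.
  -- Otherwise `w` coincides with `g` at entry points, and homogeneity moves the integral from `κ'`
  -- to `κ`.
  have hwκ : Integrable w κ ∧ ∫ p, w p ∂κ = ∫ p, g p ∂κ' := by
    by_cases h0 : (0 : E) ∈ D
    · have : w = 0 := by
        funext x
        simp [hw, entry_eq_zero_of_zero_mem hD h0]
      rw [this, hκ0 h0]
      exact ⟨integrable_zero _ _ _, by simp⟩
    · have hw1 : w =ᵐ[κ'] g := by
        filter_upwards [hen] with p hp
        simp only [hw, entry_eq_one hD hp.1 hp.2.1 hp.2.2, one_pow, one_smul, one_mul,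
          indicator_of_mem hp.1]
      have h := hκ.integrable_and_integral_eq_of_homogeneous (hκ' h0)
        (hex.mono fun p hp h => h0 (h ▸ hp.1)) (hen.mono fun p hp h => h0 (h ▸ hp.1)) hwm hwhom
        (hgκ'.congr hw1.symm)
      exact ⟨h.1, h.2.trans (integral_congr_ae hw1)⟩
  -- The entry value is needed without its weight, to dominate the ray integrals. When `0 ∉ D`,
  -- points of `D` have norm between `δ` and `R`, so the entry parameter is at least `c = δ / (|R| +
  -- 1)` and the weight can be divided out.
  have hentry : Integrable (fun p => D.indicator g (entry D p • p)) κ := by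
    by_cases h0 : (0 : E) ∈ D
    · simp only [entry_eq_zero_of_zero_mem hD h0, zero_smul]
      exact integrable_const _
    · obtain ⟨δ, hδ, hball⟩ := Metric.nhds_basis_ball.mem_iff.1
        (hDc.isClosed.isOpen_compl.mem_nhds (show (0 : E) ∈ Dᶜ from h0))
      obtain ⟨R, hR⟩ := hDc.isBounded.exists_norm_le
      set c := δ / (|R| + 1) with hc
      have hc0 : 0 < c := by positivity
      refine (hwκ.1.norm.const_mul ((c ^ (m + 1))⁻¹)).mono'
        (hgm.comp (measurable_entry.smul measurable_id)).aestronglyMeasurable ?_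
      filter_upwards [hex, hmemD] with p hp hpD
      have h1 : δ ≤ ‖entry D p • p‖ := by
        by_contra! h
        exact hball (mem_ball_zero_iff.2 h) hpD
      have h2 : c ≤ entry D p := by
        rw [norm_smul, Real.norm_of_nonneg (entry_nonneg p)] at h1
        rw [hc, div_le_iff₀ (by positivity)]
        refine h1.trans (mul_le_mul_of_nonneg_left ?_ (entry_nonneg p))
        linarith [hR p hp.1, le_abs_self R]
      rw [hw, norm_mul, ← mul_assoc, norm_pow, Real.norm_of_nonneg (entry_nonneg p)]
      refine le_mul_of_one_le_left (norm_nonneg _) ?_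
      rw [inv_mul_eq_div, one_le_div (by positivity)]
      gcongr
  have hdiff : ∀ᵐ p ∂κ, ∀ᵐ s : ℝ, 0 < s → s • p ∈ interior D → DifferentiableAt ℝ g (s • p) := by
    refine hκ.ae_ae (P := fun x => x ∈ interior D → DifferentiableAt ℝ g x) ?_
      (ConcaveOn.ae_differentiableAt hg)
    have : {x | x ∈ interior D → DifferentiableAt ℝ g x} =
      (interior D)ᶜ ∪ {x | DifferentiableAt ℝ g x} := by
      ext x; exact imp_iff_not_or
    rw [this]
    exact isOpen_interior.measurableSet.compl.union (measurableSet_of_differentiableAt ℝ g)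
  have hray := hex.and hdiff
  set B : E → ℝ := fun p => 2 * |C| + |g p| + |D.indicator g (entry D p • p)| with hB
  have hBint : Integrable B κ := ((integrable_const _).add hgκ.abs).add hentry.abs
  have hBfin : ∫⁻ p, ENNReal.ofReal (B p) ∂κ < ⊤ := by
    have := hBint.lintegral_lt_top
    exact this
  have hfin : ∀ v : E → ℝ, Measurable ((interior D).indicator v) →
      (∀ᵐ p ∂κ, ∫⁻ s in Ioi (0 : ℝ), ENNReal.ofReal (s ^ m) * ‖(interior D).indicator v (s • p)‖ₑ ≤
      ENNReal.ofReal (B p)) → IntegrableOn ((interior D).indicator v) (openCone D) μ := by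
    intro v hv hle
    refine ⟨hv.aestronglyMeasurable, ?_⟩
    rw [HasFiniteIntegral, hκ.lintegral_eq hv.enorm]
    exact (lintegral_mono_ae hle).trans_lt hBfin
  have hi1 : IntegrableOn ((interior D).indicator g) (openCone D) μ := by
    refine hfin g hgm' ?_
    filter_upwards [hray, hmemD] with p hp hpD
    rw [hB]; simp only [indicator_of_mem hpD]
    exact (radial_aux hD hDc hg hus hC m hp.1.1 hp.1.2.1 hp.1.2.2 hp.2).1
  have hi2 : IntegrableOn ((interior D).indicator fun x => fderiv ℝ g x x) (openCone D) μ := by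
    refine hfin _ hfm' ?_
    filter_upwards [hray, hmemD] with p hp hpD
    rw [hB]; simp only [indicator_of_mem hpD]
    exact (radial_aux hD hDc hg hus hC m hp.1.1 hp.1.2.1 hp.1.2.2 hp.2).2.1
  have hDi : μ.restrict D = μ.restrict (interior D) :=
    (Measure.restrict_congr_set (interior_ae_eq_of_null_frontier (hD.addHaar_frontier μ))).symm
  have hUi : ∀ v : E → ℝ, IntegrableOn ((interior D).indicator v) (openCone D) μ ↔
      IntegrableOn v D μ := by
    intro v
    rw [IntegrableOn, integrable_indicator_iff isOpen_interior.measurableSet, IntegrableOn,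
      Measure.restrict_restrict isOpen_interior.measurableSet,
      inter_eq_self_of_subset_left interior_subset_openCone, ← hDi, IntegrableOn]
  have hUe : ∀ v : E → ℝ, ∫ x in openCone D, (interior D).indicator v x ∂μ = ∫ x in D, v x ∂μ := by
    intro v
    rw [integral_indicator isOpen_interior.measurableSet,
      Measure.restrict_restrict isOpen_interior.measurableSet,
      inter_eq_self_of_subset_left interior_subset_openCone, ← hDi]
  rw [hUi] at hi1 hi2
  refine ⟨hi1, hi2, ?_⟩
  have hi3 : IntegrableOn (fun x => (m + 1) * g x + fderiv ℝ g x x) D μ :=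
    (hi1.const_mul _).add hi2
  -- Each ray contributes its exit value minus `w p`.
  rw [← hUe, hκ.integral_eq ((hUi _).2 hi3), ← hwκ.2, ← integral_sub hgκ hwκ.1]
  refine integral_congr_ae ?_
  filter_upwards [hray, hmemD] with p hp hpD
  rw [hw]; simp only [indicator_of_mem hpD]
  exact (radial_aux hD hDc hg hus hC m hp.1.1 hp.1.2.1 hp.1.2.2 hp.2).2.2

end RadialIntegration

/-! ### Change of variables on the cone over a patch. -/

section ConePatch

variable {E : Type*} [NormedAddCommGroup E] [NormedSpace ℝ E] {m : ℕ}

/-- Laplace expansion along the first column: `λ` is the volume form contracted with the position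
vector. -/
lemma det_cons_eq_lambdaForm (e : Basis (Fin (m + 1)) ℝ E) (x : E) (v : Fin m → E) :
    e.det (Fin.cons x v) = lambdaForm e x v := by
  rw [Basis.det_apply, Matrix.det_succ_column_zero, lambdaForm]
  refine Finset.sum_congr rfl fun i _ => ?_
  rfl

/-- The linear form `x ↦ det (x, v)`. -/
noncomputable def conormal (e : Basis (Fin (m + 1)) ℝ E) (v : Fin m → E) : E →ₗ[ℝ] ℝ where
  toFun x := e.det (Fin.cons x v)
  map_add' x y := congrArg (fun A => A v) (e.det.curryLeft.map_add x y)
  map_smul' c x := congrArg (fun A => A v) (e.det.curryLeft.map_smul c x)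

lemma conormal_apply (e : Basis (Fin (m + 1)) ℝ E) (v : Fin m → E) (x : E) :
    conormal e v x = e.det (Fin.cons x v) := rfl

lemma conormal_tangent (e : Basis (Fin (m + 1)) ℝ E) (v : Fin m → E) (j : Fin m) :
    conormal e v (v j) = 0 :=
  e.det.map_eq_zero_of_eq _ (i := 0) (j := j.succ) (by simp) (Fin.succ_ne_zero j).symm

lemma det_cons_smul (e : Basis (Fin (m + 1)) ℝ E) (x : E) (v : Fin m → E) (s : ℝ) :
    e.det (Fin.cons x (s • v)) = s ^ m * e.det (Fin.cons x v) := by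
  have h := (e.det.curryLeft x).toMultilinearMap.map_smul_univ (fun _ => s) v
  simp only [Finset.prod_const, Finset.card_univ, Fintype.card_fin, smul_eq_mul] at h
  exact h

lemma addHaar_eq_map_equivFun_symm [MeasurableSpace E] [BorelSpace E] [FiniteDimensional ℝ E]
    {ι : Type*} [Fintype ι] (e : Basis ι ℝ E) :
    e.addHaar = (volume : Measure (ι → ℝ)).map e.equivFunL.symm := by
  have h := e.map_addHaar e.equivFunL
  have h2 : (e.map e.equivFunL.toLinearEquiv).addHaar = (volume : Measure (ι → ℝ)) := by
    have : e.map e.equivFunL.toLinearEquiv = Pi.basisFun ℝ ι := by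
      classical
      refine Basis.eq_of_apply_eq fun i => ?_
      ext j
      simp [Basis.map_apply, Pi.single_apply, Finsupp.single_apply, eq_comm]
    rw [this, Basis.addHaar, Basis.parallelepiped_basisFun, addHaarMeasure_eq_volume_pi]
  rw [← h2, ← h, Measure.map_map e.equivFunL.symm.continuous.measurable
    e.equivFunL.continuous.measurable]
  simp

variable (e : Basis (Fin (m + 1)) ℝ E) (γ : (Fin m → ℝ) → E) {A : Set (Fin m → ℝ)}

/-- The cone over a patch, in coordinates. -/
noncomputable def coneMap (z : Fin (m + 1) → ℝ) : Fin (m + 1) → ℝ :=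
  z 0 • e.equivFun (γ (Fin.tail z))

/-- The domain of the cone over the patch with parameters in `A`. -/
def coneDomain (A : Set (Fin m → ℝ)) : Set (Fin (m + 1) → ℝ) := {z | 0 < z 0 ∧ Fin.tail z ∈ A}

/-- `Fin.tail` as a continuous linear map. -/
noncomputable def tailL (m : ℕ) : (Fin (m + 1) → ℝ) →L[ℝ] (Fin m → ℝ) :=
  ContinuousLinearMap.pi fun j => ContinuousLinearMap.proj j.succ

lemma tailL_apply (z : Fin (m + 1) → ℝ) : tailL m z = Fin.tail z := rfl

lemma measurableSet_coneDomain (hA : MeasurableSet A) : MeasurableSet (coneDomain A) :=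
  (measurableSet_lt measurable_const (measurable_pi_apply 0)).inter
    ((tailL m).continuous.measurable hA)

/-- The derivative of `coneMap`. -/
noncomputable def coneMapDeriv [FiniteDimensional ℝ E] (z : Fin (m + 1) → ℝ) :
    (Fin (m + 1) → ℝ) →L[ℝ] (Fin (m + 1) → ℝ) :=
  z 0 • (e.equivFunL.toContinuousLinearMap ∘L (fderiv ℝ γ (Fin.tail z)) ∘L tailL m) +
    (ContinuousLinearMap.proj 0 : (Fin (m + 1) → ℝ) →L[ℝ] ℝ).smulRight
      (e.equivFun (γ (Fin.tail z)))

variable {γ}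

lemma hasFDerivAt_coneMap [FiniteDimensional ℝ E] {z : Fin (m + 1) → ℝ}
    (h : DifferentiableAt ℝ γ (Fin.tail z)) :
    HasFDerivAt (coneMap e γ) (coneMapDeriv e γ z) z := by
  have h1 : HasFDerivAt (fun z : Fin (m + 1) → ℝ => z 0)
      (ContinuousLinearMap.proj 0 : (Fin (m + 1) → ℝ) →L[ℝ] ℝ) z :=
    hasFDerivAt_apply 0 z
  have h2 : HasFDerivAt (fun z : Fin (m + 1) → ℝ => e.equivFunL (γ (tailL m z)))
      (e.equivFunL.toContinuousLinearMap ∘L (fderiv ℝ γ (Fin.tail z)) ∘L tailL m) z :=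
    e.equivFunL.toContinuousLinearMap.hasFDerivAt.comp z
      (HasFDerivAt.comp z (f := tailL m) h.hasFDerivAt (tailL m).hasFDerivAt)
  exact h1.smul h2

/-- The columns of the Jacobian are `γ` and the `m` vectors `s • ∂ⱼγ`, which yields the radial
density `s ^ m` and the angular density `λ`. -/
lemma det_coneMapDeriv [FiniteDimensional ℝ E] (z : Fin (m + 1) → ℝ) :
    (coneMapDeriv e γ z).det =
      z 0 ^ m * lambdaForm e (γ (Fin.tail z)) (partials γ (Fin.tail z)) := by
  rw [← det_cons_eq_lambdaForm, ← det_cons_smul, ContinuousLinearMap.det, ← LinearMap.det_toMatrix',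
    Basis.det_apply]
  congr 1
  ext i j
  rw [LinearMap.toMatrix'_apply, Basis.toMatrix_apply]
  refine Fin.cases ?_ (fun k => ?_) j
  · have : Fin.tail (α := fun _ => ℝ) (Pi.single (0 : Fin (m + 1)) (1 : ℝ)) = 0 := by
      ext k; simp [Fin.tail]
    simp [coneMapDeriv, tailL_apply, this]
  · have : Fin.tail (α := fun _ => ℝ) (Pi.single k.succ (1 : ℝ)) = Pi.single k 1 := by
      ext l; simp [Fin.tail, Pi.single_apply]
    simp [coneMapDeriv, tailL_apply, this, partials]

lemma image_cone_eq [FiniteDimensional ℝ E] :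
    (fun q : ℝ × (Fin m → ℝ) => q.1 • γ q.2) '' (Ioi 0 ×ˢ A) =
    e.equivFunL ⁻¹' (coneMap e γ '' coneDomain A) := by
  ext x
  constructor
  · rintro ⟨⟨s, t⟩, ⟨hs, ht⟩, rfl⟩
    refine ⟨Fin.cons s t, ⟨by simpa using hs, by simpa using ht⟩, ?_⟩
    simp only [coneMap, Fin.cons_zero, Fin.tail_cons, map_smul]
    rfl
  · rintro ⟨z, ⟨hz, hzA⟩, hzx⟩
    refine ⟨(z 0, Fin.tail z), ⟨hz, hzA⟩, ?_⟩
    apply e.equivFunL.injective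
    rw [← hzx]
    simp only [coneMap, map_smul]
    rfl

lemma injOn_coneMap
    (hinj : ∀ t ∈ A, ∀ t' ∈ A, ∀ s > (0 : ℝ), ∀ s' > (0 : ℝ), s • γ t = s' • γ t' →
      s = s' ∧ t = t') : InjOn (coneMap e γ) (coneDomain A) := by
  intro z hz z' hz' h
  simp only [coneMap, ← map_smul] at h
  obtain ⟨h1, h2⟩ := hinj _ hz.2 _ hz'.2 _ hz.1 _ hz'.1 (e.equivFun.injective h)
  rw [← Fin.cons_self_tail z, ← Fin.cons_self_tail z', h1, h2]

lemma continuous_lambdaForm [FiniteDimensional ℝ E] :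
    Continuous fun q : E × (Fin m → E) => lambdaForm e q.1 q.2 := by
  have hc : ∀ i, Continuous (e.coord i) := fun i => LinearMap.continuous_of_finiteDimensional _
  unfold lambdaForm
  refine continuous_finsetSum _ fun i _ => ?_
  refine (continuous_const.mul ((hc i).comp continuous_fst)).mul (Continuous.matrix_det ?_)
  refine continuous_matrix fun j k => ?_
  exact (hc _).comp ((continuous_apply k).comp continuous_snd)

variable [FiniteDimensional ℝ E] [MeasurableSpace E] [BorelSpace E]

lemma measurableSet_image_cone (e : Basis (Fin (m + 1)) ℝ E) (hA : MeasurableSet A)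
    (hγ : ∀ t ∈ A, DifferentiableAt ℝ γ t)
    (hinj : ∀ t ∈ A, ∀ t' ∈ A, ∀ s > (0 : ℝ), ∀ s' > (0 : ℝ), s • γ t = s' • γ t' →
      s = s' ∧ t = t') :
    MeasurableSet ((fun q : ℝ × (Fin m → ℝ) => q.1 • γ q.2) '' (Ioi 0 ×ˢ A)) := by
  rw [image_cone_eq e]
  refine e.equivFunL.continuous.measurable ?_
  exact measurable_image_of_fderivWithin (measurableSet_coneDomain hA)
    (fun z hz => (hasFDerivAt_coneMap e (hγ _ hz.2)).hasFDerivWithinAt) (injOn_coneMap e hinj)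

/-- The cone over a null set of parameters is null. -/
lemma addHaar_image_cone_eq_zero (hA : volume A = 0) (hγ : ∀ t ∈ A, DifferentiableAt ℝ γ t) :
    e.addHaar ((fun q : ℝ × (Fin m → ℝ) => q.1 • γ q.2) '' (Ioi 0 ×ˢ A)) = 0 := by
  have hdom : volume (coneDomain A) = 0 := by
    have h : coneDomain A ⊆ MeasurableEquiv.piFinSuccAbove (fun _ => ℝ) 0 ⁻¹' (univ ×ˢ A) :=
      fun z hz => ⟨mem_univ _, hz.2⟩
    refine measure_mono_null h ?_
    rw [(volume_preserving_piFinSuccAbove (fun _ => ℝ) 0).measure_preimage_equiv]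
    rw [Measure.volume_eq_prod, Measure.prod_prod, hA, mul_zero]
  have h0 := addHaar_image_eq_zero_of_differentiableOn_of_addHaar_eq_zero volume
    (f := coneMap e γ) (fun z (hz : z ∈ coneDomain A) =>
      (hasFDerivAt_coneMap e (hγ _ hz.2)).differentiableAt.differentiableWithinAt) hdom
  rw [image_cone_eq e, addHaar_eq_map_equivFun_symm e]
  have := e.equivFunL.symm.toHomeomorph.measurableEmbedding.map_apply volume
    (e.equivFunL ⁻¹' (coneMap e γ '' coneDomain A))
  refine this.trans ?_
  convert! h0 using 2
  ext z
  simp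

lemma measurable_lambdaForm {p : (Fin m → ℝ) → E} {v : (Fin m → ℝ) → Fin m → E}
    (hp : Measurable p) (hv : Measurable v) : Measurable fun t => lambdaForm e (p t) (v t) := by
  have := FiniteDimensional.proper ℝ E
  have hc : Measurable fun q : E × (Fin m → E) => lambdaForm e q.1 q.2 :=
    (continuous_lambdaForm e).measurable
  exact hc.comp (hp.prodMk hv)

lemma measurable_partials : Measurable (partials γ) :=
  measurable_pi_iff.2 fun _ => measurable_fderiv_apply_const ℝ γ _

lemma measurable_indicator_of_continuousOn {X E : Type*} [TopologicalSpace X] [MeasurableSpace X]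
    [OpensMeasurableSpace X] [TopologicalSpace E] [Zero E] [MeasurableSpace E] [BorelSpace E]
    {A : Set X} {γ : X → E} (hA : MeasurableSet A) (hγ : ContinuousOn γ A) :
    Measurable (A.indicator γ) := by
  classical
  rw [← piecewise_eq_indicator]
  exact hγ.measurable_piecewise continuousOn_const hA

/-- Integration over the cone over a patch. -/
theorem lintegral_image_cone (hA : MeasurableSet A) (hγ : ∀ t ∈ A, DifferentiableAt ℝ γ t)
    (hinj : ∀ t ∈ A, ∀ t' ∈ A, ∀ s > (0 : ℝ), ∀ s' > (0 : ℝ), s • γ t = s' • γ t' →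
      s = s' ∧ t = t') {h : E → ENNReal} (hh : Measurable h) :
    ∫⁻ x in (fun q : ℝ × (Fin m → ℝ) => q.1 • γ q.2) '' (Ioi 0 ×ˢ A), h x ∂e.addHaar =
      ∫⁻ t in A, ENNReal.ofReal |lambdaForm e (γ t) (partials γ t)| *
        ∫⁻ s in Ioi (0 : ℝ), ENNReal.ofReal (s ^ m) * h (s • γ t) := by
  have hemb := e.equivFunL.symm.toHomeomorph.measurableEmbedding
  have e1 : ∫⁻ x in (fun q : ℝ × (Fin m → ℝ) => q.1 • γ q.2) '' (Ioi 0 ×ˢ A), h x ∂e.addHaar =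
      ∫⁻ z in coneMap e γ '' coneDomain A, h (e.equivFunL.symm z) := by
    rw [image_cone_eq e, addHaar_eq_map_equivFun_symm e]
    have := hemb.restrict_map volume (e.equivFunL ⁻¹' (coneMap e γ '' coneDomain A))
    refine (congrArg (fun ν => ∫⁻ x, h x ∂ν) this).trans ?_
    rw [hemb.lintegral_map]
    congr 2
    ext z
    simp
  -- The map `γ` is controlled only on `A`, so its extension by zero is used to have a measurable
  -- integrand on the whole space.
  have hm : Measurable (A.indicator γ) :=
    measurable_indicator_of_continuousOn hA (fun t ht => (hγ t ht).continuousAt.continuousWithinAt)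
  have hl : Measurable fun t => lambdaForm e (A.indicator γ t) (partials γ t) :=
    measurable_lambdaForm e hm measurable_partials
  set H : ℝ × (Fin m → ℝ) → ENNReal := fun q =>
    ENNReal.ofReal |lambdaForm e (A.indicator γ q.2) (partials γ q.2)| *
      (ENNReal.ofReal (q.1 ^ m) * h (q.1 • A.indicator γ q.2)) with hH
  have hHm : Measurable H := by
    refine Measurable.mul (Measurable.ennreal_ofReal ?_) (Measurable.mul (by fun_prop) ?_)
    · exact (continuous_abs.measurable.comp hl).comp measurable_snd
    · exact hh.comp (measurable_fst.smul (hm.comp measurable_snd))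
  have hψ := volume_preserving_piFinSuccAbove (n := m) (fun _ => ℝ) 0
  have hdom : coneDomain A = MeasurableEquiv.piFinSuccAbove (fun _ => ℝ) 0 ⁻¹' (Ioi 0 ×ˢ A) := rfl
  rw [e1, lintegral_image_eq_lintegral_abs_det_fderiv_mul volume (measurableSet_coneDomain hA)
    (fun z hz => (hasFDerivAt_coneMap e (hγ _ hz.2)).hasFDerivWithinAt) (injOn_coneMap e hinj)]
  have e2 : ∫⁻ z in coneDomain A, ENNReal.ofReal |(coneMapDeriv e γ z).det| *
      h (e.equivFunL.symm (coneMap e γ z)) =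
      ∫⁻ z in coneDomain A, H (MeasurableEquiv.piFinSuccAbove (fun _ => ℝ) 0 z) := by
    refine setLIntegral_congr_fun (measurableSet_coneDomain hA) fun z hz => ?_
    have hz2 : (MeasurableEquiv.piFinSuccAbove (fun _ => ℝ) 0 z) = (z 0, Fin.tail z) := rfl
    have hz3 : e.equivFunL.symm (coneMap e γ z) = z 0 • γ (Fin.tail z) := by
      rw [ContinuousLinearEquiv.symm_apply_eq, map_smul]
      rfl
    simp only [hz2, hz3, hH, indicator_of_mem hz.2]
    rw [det_coneMapDeriv, abs_mul, abs_of_nonneg (pow_nonneg hz.1.le m), mul_comm (z 0 ^ m),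
      ENNReal.ofReal_mul (abs_nonneg _), mul_assoc]
  rw [e2, hdom, hψ.setLIntegral_comp_preimage (measurableSet_Ioi.prod hA) hHm,
    Measure.volume_eq_prod, ← Measure.prod_restrict, lintegral_prod_symm _ hHm.aemeasurable]
  refine setLIntegral_congr_fun hA fun t ht => ?_
  simp only [hH, indicator_of_mem ht]
  rw [lintegral_const_mul]
  exact Measurable.mul (by fun_prop) (hh.comp (by fun_prop))

end ConePatch

/-! ### Patches and their tangent hyperplanes. -/

namespace PiecewiseSmoothBoundary

variable {E : Type*} [NormedAddCommGroup E] [NormedSpace ℝ E] {m : ℕ}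
  {e : Basis (Fin (m + 1)) ℝ E} {D : Set E} (P : PiecewiseSmoothBoundary e D)

/-- The linear form whose kernel is the tangent space of a patch and which increases in the
outward direction. -/
noncomputable def outward (i : Fin P.count) (t : Fin m → ℝ) : E →ₗ[ℝ] ℝ :=
  ((P.sgn i : ℤ) : ℝ) • conormal e (partials (P.γ i) t)

variable {P} {i j : Fin P.count} {t t' : Fin m → ℝ}

lemma outward_apply_self :
    P.outward i t (P.γ i t) = ((P.sgn i : ℤ) : ℝ) * lambdaForm e (P.γ i t) (partials (P.γ i) t) := by
  rw [← det_cons_eq_lambdaForm]; rfl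

lemma outward_lt (ht : t ∈ interior (P.K i)) {y : E} (hy : y ∈ interior D) :
    P.outward i t y < P.outward i t (P.γ i t) := by
  have h : 0 < P.outward i t (P.γ i t - y) := P.oriented i t ht y hy
  rw [map_sub] at h
  linarith

/-- The patches cover the frontier of the interior, which is empty for a body of empty interior. -/
lemma interior_nonempty_of_mem (ht : t ∈ P.K i) : (interior D).Nonempty := by
  have h : P.γ i t ∈ frontier (interior D) := by
    rw [← P.cover]
    exact mem_iUnion.2 ⟨i, mem_image_of_mem _ ht⟩
  by_contra! hne
  simp [hne] at h

lemma mem_of_mem_K (hDc : IsClosed D) (ht : t ∈ P.K i) :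
    P.γ i t ∈ D ∧ P.γ i t ∉ interior D := by
  have h : P.γ i t ∈ frontier (interior D) := by
    rw [← P.cover]
    exact mem_iUnion.2 ⟨i, mem_image_of_mem _ ht⟩
  rw [isOpen_interior.frontier_eq] at h
  exact ⟨closure_minimal interior_subset hDc h.1, h.2⟩

lemma differentiableAt (ht : t ∈ P.K i) : DifferentiableAt ℝ (P.γ i) t := by
  obtain ⟨U, hU, hKU, hγ⟩ := P.smooth i
  exact (hγ.contDiffAt (hU.mem_nhds (hKU ht))).differentiableAt (by simp)

lemma continuousOn : ContinuousOn (P.γ i) (P.K i) :=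
  fun _ ht => (differentiableAt ht).continuousAt.continuousWithinAt

lemma continuousOn_partials : ContinuousOn (partials (P.γ i)) (P.K i) := by
  obtain ⟨U, hU, hKU, hγ⟩ := P.smooth i
  refine continuousOn_pi.2 fun j => ?_
  exact ((hγ.continuousOn_fderiv_of_isOpen hU (by simp)).mono hKU).clm_apply continuousOn_const

lemma continuousOn_lambdaForm [FiniteDimensional ℝ E] :
    ContinuousOn (fun t => lambdaForm e (P.γ i t) (partials (P.γ i) t)) (P.K i) :=
  by
  have hc : Continuous fun q : E × (Fin m → E) => lambdaForm e q.1 q.2 := continuous_lambdaForm e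
  have hp : ContinuousOn (fun t => (P.γ i t, partials (P.γ i) t)) (P.K i) :=
    continuousOn.prodMk continuousOn_partials
  generalize lambdaForm e = l at *
  exact hc.comp_continuousOn hp

/-- The tangent hyperplane of a patch supports `D`: the orientation condition on the interior passes
to its closure, which contains `D`. -/
lemma outward_le (hD : Convex ℝ D) (ht : t ∈ interior (P.K i)) [FiniteDimensional ℝ E] {y : E}
    (hy : y ∈ D) : P.outward i t y ≤ P.outward i t (P.γ i t) := by
  have hne := interior_nonempty_of_mem (interior_subset ht)
  have hcl : y ∈ closure (interior D) := by
    rw [hD.closure_interior_eq_closure_of_nonempty_interior hne]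
    exact subset_closure hy
  have hcont : Continuous (P.outward i t) := LinearMap.continuous_of_finiteDimensional _
  exact closure_minimal (fun z hz => (outward_lt ht hz).le)
    (isClosed_le hcont continuous_const) hcl

/-- Near an interior point of a patch, the body `D` fills the inner side of the tangent
hyperplane. -/
lemma eventually_mem_interior [FiniteDimensional ℝ E] (hD : Convex ℝ D) (hDc : IsClosed D)
    (ht : t ∈ interior (P.K i))
    {z : E} (hz : P.outward i t z < 0) :
    ∀ᶠ ε in 𝓝[>] (0 : ℝ), P.γ i t + ε • z ∈ interior D := by
  obtain ⟨y, hy⟩ := interior_nonempty_of_mem (interior_subset ht)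
  set p := P.γ i t with hp
  set ℓ := P.outward i t with hℓ
  have hv : ℓ (y - p) < 0 := by rw [map_sub]; linarith [outward_lt ht hy]
  have hdet : e.det (Fin.cons (y - p) (partials (P.γ i) t)) ≠ 0 := by
    intro h0
    have : ℓ (y - p) = 0 := by
      change ((P.sgn i : ℤ) : ℝ) * e.det (Fin.cons (y - p) (partials (P.γ i) t)) = 0
      rw [h0, mul_zero]
    exact hv.ne this
  have hspan := (Basis.is_basis_iff_det e (v := Fin.cons (y - p) (partials (P.γ i) t))).2
    (isUnit_iff_ne_zero.2 hdet)
  obtain ⟨c, hc⟩ := (Submodule.mem_span_range_iff_exists_fun ℝ).1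
    (hspan.2 ▸ Submodule.mem_top : z ∈ Submodule.span ℝ (range _))
  rw [Fin.sum_univ_succ] at hc
  simp only [Fin.cons_zero, Fin.cons_succ] at hc
  set w : Fin m → ℝ := fun j => c j.succ with hw
  set W : E := fderiv ℝ (P.γ i) t w with hWdef
  have hW : W = ∑ j, w j • partials (P.γ i) t j := by
    rw [hWdef]
    conv_lhs => rw [pi_eq_sum_univ' w]
    simp only [map_sum, map_smul]
    rfl
  -- The direction `z` splits into a positive multiple of the inward vector `y - p` and a tangent
  -- vector `W`, realized as the velocity of the curve `q` in the boundary.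
  have hzc : z = c 0 • (y - p) + W := by rw [hW, ← hc]
  have hℓW : ℓ W = 0 := by
    rw [hW, map_sum]
    refine Finset.sum_eq_zero fun j _ => ?_
    rw [map_smul]
    change _ • (_ * conormal e (partials (P.γ i) t) (partials (P.γ i) t j)) = 0
    rw [conormal_tangent, mul_zero, smul_zero]
  have hc0 : 0 < c 0 := by
    rw [hzc, map_add, map_smul, hℓW, add_zero, smul_eq_mul] at hz
    by_contra! h
    nlinarith
  set q : ℝ → E := fun ε => P.γ i (t + ε • w) with hq
  have hq0 : HasDerivAt q W 0 := by
    have h1 : HasDerivAt (fun ε : ℝ => t + ε • w) w 0 := by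
      simpa using ((hasDerivAt_id (0 : ℝ)).smul_const w).const_add t
    have h2 : HasFDerivAt (P.γ i) (fderiv ℝ (P.γ i) t) (t + (0 : ℝ) • w) := by
      rw [zero_smul, add_zero]
      exact (differentiableAt (interior_subset ht)).hasFDerivAt
    exact h2.comp_hasDerivAt 0 h1
  have hq00 : q 0 = p := by simp [hq, hp]
  have hqD : ∀ᶠ ε in 𝓝[>] (0 : ℝ), q ε ∈ D := by
    have h1 : ContinuousAt (fun ε : ℝ => t + ε • w) 0 := by fun_prop
    have h2 : ∀ᶠ ε in 𝓝 (0 : ℝ), t + ε • w ∈ interior (P.K i) :=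
      h1.eventually_mem (by simpa using isOpen_interior.mem_nhds ht)
    filter_upwards [h2.filter_mono nhdsWithin_le_nhds] with ε hε
    exact (mem_of_mem_K hDc (interior_subset hε)).1
  have hslope : Tendsto (fun ε : ℝ => ε⁻¹ • (q ε - p)) (𝓝[>] 0) (𝓝 W) := by
    have h := (hasDerivAt_iff_tendsto_slope_zero.1 hq0).mono_left
      (nhdsWithin_mono 0 (fun x (hx : 0 < x) => hx.ne' : Ioi (0 : ℝ) ⊆ {0}ᶜ))
    simp only [zero_add, hq00] at h
    exact h
  have hqlim : Tendsto q (𝓝[>] 0) (𝓝 p) := by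
    have := hq0.continuousAt.tendsto.mono_left (nhdsWithin_le_nhds (s := Ioi 0))
    rwa [hq00] at this
  -- This point is chosen so that `p + ε • z` is exactly the combination of it and `q ε` with
  -- weights `ε * c 0` and `1 - ε * c 0`. It tends to `y`, hence is eventually interior, and `q ε`
  -- lies in `D`.
  have hylim : Tendsto (fun ε : ℝ => (c 0)⁻¹ • (W - ε⁻¹ • (q ε - p)) + (y - p) + q ε) (𝓝[>] 0)
      (𝓝 y) := by
    have := ((((tendsto_const_nhds (x := W)).sub hslope).const_smul (c 0)⁻¹).add
      (tendsto_const_nhds (x := y - p))).add hqlim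
    simpa using this
  have hsmall : ∀ᶠ ε in 𝓝[>] (0 : ℝ), ε < (c 0)⁻¹ :=
    (gt_mem_nhds (inv_pos.2 hc0) |> mem_nhdsWithin_of_mem_nhds)
  filter_upwards [hqD, hylim.eventually_mem (isOpen_interior.mem_nhds hy), self_mem_nhdsWithin,
    hsmall] with ε hεD hεy hε hεs
  have hε0 : (0 : ℝ) < ε := hε
  have h1 : ε * c 0 < 1 := by rwa [lt_inv_comm₀ hε0 hc0, ← one_div, lt_div_iff₀ hε0, mul_comm] at hεs 
  have h := hD.combo_interior_self_mem_interior hεy hεD (mul_pos hε0 hc0) (sub_nonneg.2 h1.le)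
    (by ring)
  convert! h using 1
  rw [hzc]
  have e1 : (ε * c 0) • ((c 0)⁻¹ • (W - ε⁻¹ • (q ε - p)) + (y - p) + q ε) =
      ε • W - (q ε - p) + (ε * c 0) • (y - p) + (ε * c 0) • q ε := by
    rw [smul_add, smul_add, smul_smul, mul_assoc, mul_inv_cancel₀ hc0.ne', mul_one, smul_sub,
      smul_smul, mul_inv_cancel₀ hε0.ne', one_smul]
  rw [e1, sub_smul, one_smul, smul_add, smul_smul]
  abel

end PiecewiseSmoothBoundary

/-! ### Boundary parts facing away from and towards the origin, and their angular measures. -/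

namespace PiecewiseSmoothBoundary

variable {E : Type*} [NormedAddCommGroup E] [NormedSpace ℝ E] [FiniteDimensional ℝ E] {m : ℕ}
  {e : Basis (Fin (m + 1)) ℝ E} {D : Set E} (P : PiecewiseSmoothBoundary e D)

/-- The part of a patch where the position vector points outwards (`σ = 1`)
or inwards (`σ = -1`). -/
def part (σ : ℝ) (i : Fin P.count) : Set (Fin m → ℝ) :=
  {t | t ∈ interior (P.K i) ∧ 0 < σ * P.outward i t (P.γ i t)}

variable {P} {σ : ℝ} {i j : Fin P.count} {t t' : Fin m → ℝ}

lemma part_subset : P.part σ i ⊆ interior (P.K i) := fun _ ht => ht.1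

lemma part_subset_K : P.part σ i ⊆ P.K i := part_subset.trans interior_subset

lemma isOpen_part : IsOpen (P.part σ i) := by
  have h : ContinuousOn (fun t => σ * P.outward i t (P.γ i t)) (interior (P.K i)) := by
    simp only [outward_apply_self]
    exact continuousOn_const.mul (continuousOn_const.mul
      (continuousOn_lambdaForm.mono interior_subset))
  exact h.isOpen_inter_preimage isOpen_interior isOpen_Ioi

/-- Each of the two points maximizes its own outward form over `D`. As they are positive multiples
of one another and the forms have the same nonzero sign at them, comparing both ways forces the
ratio to be `1`; then the patches do not overlap. -/
lemma part_injective (hD : Convex ℝ D) (hDc : IsClosed D) (hσ : σ = 1 ∨ σ = -1)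
    (ht : t ∈ P.part σ i) (ht' : t' ∈ P.part σ j) {s s' : ℝ} (hs : 0 < s) (hs' : 0 < s')
    (h : s • P.γ i t = s' • P.γ j t') : s = s' ∧ i = j ∧ t = t' := by
  have h1 := outward_le hD ht.1 (mem_of_mem_K hDc (interior_subset ht'.1)).1
  have h2 := outward_le hD ht'.1 (mem_of_mem_K hDc (interior_subset ht.1)).1
  have e1 : P.γ j t' = (s / s') • P.γ i t := by
    rw [div_eq_inv_mul, mul_smul, h, inv_smul_smul₀ hs'.ne']
  have e2 : P.γ i t = (s' / s) • P.γ j t' := by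
    rw [div_eq_inv_mul, mul_smul, ← h, inv_smul_smul₀ hs.ne']
  have hss : s = s' := by
    rw [e1, map_smul, smul_eq_mul, div_mul_eq_mul_div, div_le_iff₀ hs'] at h1
    rw [e2, map_smul, smul_eq_mul, div_mul_eq_mul_div, div_le_iff₀ hs] at h2
    have h3 := ht.2
    have h4 := ht'.2
    rcases hσ with rfl | rfl
    · rw [one_mul] at h3 h4
      exact le_antisymm (le_of_mul_le_mul_right (by linarith) h3)
        (le_of_mul_le_mul_right (by linarith) h4)
    · rw [neg_one_mul, neg_pos] at h3 h4
      exact le_antisymm (by nlinarith) (by nlinarith)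
  subst hss
  have hγ : P.γ i t = P.γ j t' := by rw [e1, div_self hs.ne', one_smul]
  have hij : i = j := by
    by_contra hne
    exact (P.disjoint i j hne).le_bot ⟨mem_image_of_mem _ ht.1, hγ ▸ mem_image_of_mem _ ht'.1⟩
  subst hij
  exact ⟨rfl, rfl, P.injOn i ht.1 ht'.1 hγ⟩

lemma exists_smul_mem_interior (hD : Convex ℝ D) (hDc : IsClosed D) (ht : t ∈ P.part σ i) :
    ∃ ε ∈ Ioo (0 : ℝ) 1, (1 - ε * σ) • P.γ i t ∈ interior D := by
  have hz : P.outward i t (-(σ • P.γ i t)) < 0 := by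
    rw [map_neg, map_smul, smul_eq_mul, neg_lt_zero]
    exact ht.2
  obtain ⟨ε, hε, hε'⟩ := ((eventually_mem_interior hD hDc ht.1 hz).and
    (Ioo_mem_nhdsGT one_pos)).exists
  refine ⟨ε, hε', ?_⟩
  convert! hε using 1
  rw [sub_smul, one_smul, mul_smul, smul_neg, sub_eq_add_neg]

lemma mem_openCone_of_mem_part (hD : Convex ℝ D) (hDc : IsClosed D) (hσ : σ = 1 ∨ σ = -1)
    (ht : t ∈ P.part σ i) : P.γ i t ∈ openCone D := by
  obtain ⟨ε, hε, h⟩ := exists_smul_mem_interior hD hDc ht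
  refine ⟨_, ?_, h⟩
  rcases hσ with rfl | rfl <;> linarith [hε.1, hε.2]

/-- The outward form is at most its value at the patch point, also at the origin, so that value is
nonnegative. -/
lemma part_eq_empty_of_zero_mem (hD : Convex ℝ D) (h0 : (0 : E) ∈ D) : P.part (-1) i = ∅ := by
  refine eq_empty_of_forall_notMem fun t ht => ?_
  have h1 := outward_le hD ht.1 h0
  have h2 := ht.2
  rw [map_zero] at h1
  linarith

variable (P) in
lemma exists_mem_K_of_mem (hD : Convex ℝ D) {y : E} (hy : y ∈ interior D)
    {p : E} (hp : p ∈ D) (hp' : p ∉ interior D) : ∃ i, ∃ t ∈ P.K i, P.γ i t = p := by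
  have : p ∈ frontier (interior D) := by
    rw [isOpen_interior.frontier_eq]
    refine ⟨?_, hp'⟩
    rw [hD.closure_interior_eq_closure_of_nonempty_interior ⟨y, hy⟩]
    exact subset_closure hp
  rw [← P.cover] at this
  obtain ⟨i, t, ht, h⟩ := mem_iUnion.1 this
  exact ⟨i, t, ht, h⟩

variable (P) in
-- Take the last multiple `r • x` in `D`. Since `x` is interior, the outward form there satisfies `ℓ
-- x < r * ℓ x` with `r > 1`, hence is positive. Membership in the part is conditional because the
-- boundary point may come from the frontier of a parameter set, which is dealt with as a null set.
lemma cover_exit (hD : Convex ℝ D) (hDc : IsCompact D) {x : E} (hx0 : x ≠ 0)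
    (hx : x ∈ interior D) :
    ∃ i, ∃ t ∈ P.K i, (t ∈ interior (P.K i) → t ∈ P.part 1 i) ∧ ∃ s > (0 : ℝ), x = s • P.γ i t := by
  have hcl : IsClosed ((fun r : ℝ => r • x) ⁻¹' D ∩ Ici 1) :=
    (hDc.isClosed.preimage (by fun_prop)).inter isClosed_Ici
  obtain ⟨R, hR⟩ := hDc.isBounded.exists_norm_le
  have hbdd : ((fun r : ℝ => r • x) ⁻¹' D ∩ Ici 1) ⊆ Icc 1 (R / ‖x‖) := by
    rintro r ⟨hr, hr1⟩
    refine ⟨hr1, ?_⟩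
    rw [le_div_iff₀ (norm_pos_iff.2 hx0)]
    have := hR _ hr
    rwa [norm_smul, Real.norm_of_nonneg (zero_le_one.trans hr1)] at this
  have hx1 : (1 : ℝ) ∈ (fun r : ℝ => r • x) ⁻¹' D ∩ Ici 1 :=
    ⟨show (1 : ℝ) • x ∈ D by rw [one_smul]; exact interior_subset hx, self_mem_Ici⟩
  obtain ⟨r, ⟨hr, hr1⟩, hmax⟩ := (isCompact_Icc.of_isClosed_subset hcl hbdd).exists_isGreatest ⟨1, hx1⟩
  have hr1 : 1 ≤ r := hr1
  have hrint : r • x ∉ interior D := by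
    intro h
    have hcont : ContinuousAt (fun r : ℝ => r • x) r := by fun_prop
    obtain ⟨r', hr', hrr'⟩ := (((hcont.eventually_mem (isOpen_interior.mem_nhds h)).filter_mono
      nhdsWithin_le_nhds).and (self_mem_nhdsWithin : Ioi r ∈ 𝓝[>] r)).exists
    have hrr' : r < r' := hrr'
    exact hrr'.not_ge (hmax ⟨interior_subset (s := D) hr', hr1.trans hrr'.le⟩)
  have hr1' : 1 < r := by
    refine hr1.lt_of_ne fun h => hrint ?_
    rwa [← h, one_smul]
  obtain ⟨i, t, ht, hp⟩ := P.exists_mem_K_of_mem hD hx hr hrint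
  refine ⟨i, t, ht, fun hti => ⟨hti, ?_⟩, r⁻¹, by positivity, ?_⟩
  · have h := outward_lt hti hx
    rw [hp, map_smul, smul_eq_mul] at h
    rw [hp, map_smul, smul_eq_mul, one_mul]
    have : 0 < P.outward i t x := by nlinarith
    positivity
  · rw [hp, inv_smul_smul₀ (by positivity)]

variable (P) in
-- Take the first multiple of `x` in `D`; it is not zero as `0 ∉ D`. Here `r < 1`, so the sign is
-- reversed.
lemma cover_entry (hD : Convex ℝ D) (hDc : IsCompact D) (h0 : (0 : E) ∉ D) {x : E}
    (hx : x ∈ interior D) :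
    ∃ i, ∃ t ∈ P.K i, (t ∈ interior (P.K i) → t ∈ P.part (-1) i) ∧
      ∃ s > (0 : ℝ), x = s • P.γ i t := by
  have hcl : IsClosed ((fun r : ℝ => r • x) ⁻¹' D) := hDc.isClosed.preimage (by fun_prop)
  have hx1 : (1 : ℝ) ∈ Icc (0 : ℝ) 1 ∩ (fun r : ℝ => r • x) ⁻¹' D :=
    ⟨right_mem_Icc.2 zero_le_one, show (1 : ℝ) • x ∈ D by rw [one_smul]; exact interior_subset hx⟩
  obtain ⟨r, ⟨hr1, hr⟩, hmin⟩ := (isCompact_Icc.inter_right hcl).exists_isLeast ⟨1, hx1⟩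
  have hr0 : 0 < r := by
    refine hr1.1.lt_of_ne fun h => h0 ?_
    have : r • x ∈ D := hr
    rwa [← h, zero_smul] at this
  have hrint : r • x ∉ interior D := by
    intro h
    have hcont : ContinuousAt (fun r : ℝ => r • x) r := by fun_prop
    obtain ⟨r', ⟨hr', hr0'⟩, hrr'⟩ := ((((hcont.eventually_mem (isOpen_interior.mem_nhds h)).and
      (lt_mem_nhds hr0)).filter_mono nhdsWithin_le_nhds).and
      (self_mem_nhdsWithin : Iio r ∈ 𝓝[<] r)).exists
    have hrr' : r' < r := hrr'
    exact hrr'.not_ge (hmin ⟨⟨hr0'.le, hrr'.le.trans hr1.2⟩, interior_subset (s := D) hr'⟩)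
  have hr1' : r < 1 := by
    refine hr1.2.lt_of_ne fun h => hrint ?_
    rwa [h, one_smul]
  obtain ⟨i, t, ht, hp⟩ := P.exists_mem_K_of_mem hD hx hr hrint
  refine ⟨i, t, ht, fun hti => ⟨hti, ?_⟩, r⁻¹, by positivity, ?_⟩
  · have h := outward_lt hti hx
    rw [hp, map_smul, smul_eq_mul] at h
    rw [hp, map_smul, smul_eq_mul]
    have : P.outward i t x < 0 := by nlinarith
    nlinarith
  · rw [hp, inv_smul_smul₀ (by positivity)]

variable [MeasurableSpace E] [BorelSpace E]

lemma measurableSet_part : MeasurableSet (P.part σ i) := isOpen_part.measurableSet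

lemma measurable_indicator_γ : Measurable ((P.part σ i).indicator (P.γ i)) :=
  measurable_indicator_of_continuousOn measurableSet_part (continuousOn.mono part_subset_K)

variable (P) in
/-- The density of the measure induced by `λ` on the part of a patch. -/
noncomputable def density (σ : ℝ) (i : Fin P.count) (t : Fin m → ℝ) : ENNReal :=
  ENNReal.ofReal |lambdaForm e ((P.part σ i).indicator (P.γ i) t) (partials (P.γ i) t)|

lemma measurable_density : Measurable (P.density σ i) := by
  have h : Measurable fun t =>
      lambdaForm e ((P.part σ i).indicator (P.γ i) t) (partials (P.γ i) t) :=
    measurable_lambdaForm e measurable_indicator_γ measurable_partials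
  exact (continuous_abs.measurable.comp h).ennreal_ofReal

lemma density_of_mem (ht : t ∈ P.part σ i) :
    P.density σ i t = ENNReal.ofReal |lambdaForm e (P.γ i t) (partials (P.γ i) t)| := by
  rw [density, indicator_of_mem ht]

variable (P) in
/-- The measure induced by `|λ|` on the parts of the boundary where the position vector points
outwards, respectively inwards. -/
noncomputable def boundaryMeasure (σ : ℝ) : Measure E :=
  ∑ i, (((volume.restrict (P.part σ i)).withDensity (P.density σ i)).map
    ((P.part σ i).indicator (P.γ i)))

lemma lintegral_boundaryMeasure {h : E → ENNReal} (hh : Measurable h) :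
    ∫⁻ p, h p ∂P.boundaryMeasure σ =
      ∑ i, ∫⁻ t in P.part σ i, ENNReal.ofReal |lambdaForm e (P.γ i t) (partials (P.γ i) t)| *
        h (P.γ i t) := by
  rw [boundaryMeasure, lintegral_finsetSum_measure]
  refine Finset.sum_congr rfl fun i _ => ?_
  rw [lintegral_map hh measurable_indicator_γ,
    lintegral_withDensity_eq_lintegral_mul _ measurable_density
      (g := fun t => h ((P.part σ i).indicator (P.γ i) t)) (hh.comp measurable_indicator_γ)]
  refine setLIntegral_congr_fun measurableSet_part fun t ht => ?_
  simp only [Pi.mul_apply, density_of_mem ht, indicator_of_mem ht]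

lemma ae_boundaryMeasure {Q : E → Prop} (hQ : MeasurableSet {p | Q p})
    (h : ∀ i, ∀ t ∈ P.part σ i, Q (P.γ i t)) : ∀ᵐ p ∂P.boundaryMeasure σ, Q p := by
  have h1 : ∫⁻ p, {p | Q p}ᶜ.indicator (1 : E → ENNReal) p ∂P.boundaryMeasure σ = 0 := by
    rw [lintegral_boundaryMeasure (measurable_one.indicator hQ.compl)]
    refine Finset.sum_eq_zero fun i _ => ?_
    rw [setLIntegral_congr_fun (g := fun _ => 0) measurableSet_part, lintegral_zero]
    intro t ht
    have : P.γ i t ∉ {p | Q p}ᶜ := fun hn => hn (h i t ht)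
    simp only [indicator_of_notMem this, mul_zero]
  rwa [lintegral_indicator_one hQ.compl] at h1

lemma integrableOn_lambdaForm :
    IntegrableOn (fun t => lambdaForm e (P.γ i t) (partials (P.γ i) t)) (P.K i) :=
  continuousOn_lambdaForm.integrableOn_compact (P.isCompact_K i)

instance : IsFiniteMeasure (P.boundaryMeasure σ) := by
  refine ⟨?_⟩
  rw [← lintegral_one, lintegral_boundaryMeasure measurable_const]
  refine ENNReal.sum_lt_top.2 fun i _ => ?_
  have h := (integrableOn_lambdaForm (i := i)).mono_set (part_subset_K (σ := σ))
  simp only [mul_one]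
  have h2 := h.2
  simp only [HasFiniteIntegral, Real.enorm_eq_ofReal_abs] at h2
  exact h2

/-- The cones over the parts are disjoint and fill the open cone up to the origin and the null cones
over the frontiers of the parameter sets. On each of them the change of variables gives the polar
formula. Exit and entry differ only in `hcover`. -/
theorem isPolar_boundaryMeasure (hD : Convex ℝ D) (hDc : IsClosed D) (hσ : σ = 1 ∨ σ = -1)
    (hcover : ∀ x ∈ interior D, x ≠ 0 → ∃ i, ∃ t ∈ P.K i, (t ∈ interior (P.K i) → t ∈ P.part σ i) ∧
      ∃ s > (0 : ℝ), x = s • P.γ i t) :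
    IsPolar m e.addHaar (openCone D) (P.boundaryMeasure σ) := by
  -- Needed for the origin to be a null set.
  have : Nontrivial E := ⟨e 0, 0, e.ne_zero 0⟩
  set c : Fin P.count → Set (Fin m → ℝ) → Set E := fun i A =>
    (fun q : ℝ × (Fin m → ℝ) => q.1 • P.γ i q.2) '' (Ioi 0 ×ˢ A) with hc
  have hinj : ∀ i, ∀ t ∈ P.part σ i, ∀ t' ∈ P.part σ i, ∀ s > (0 : ℝ), ∀ s' > (0 : ℝ),
      s • P.γ i t = s' • P.γ i t' → s = s' ∧ t = t' := fun i t ht t' ht' s hs s' hs' h =>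
    ⟨(part_injective hD hDc hσ ht ht' hs hs' h).1, (part_injective hD hDc hσ ht ht' hs hs' h).2.2⟩
  have hdiff : ∀ i, ∀ t ∈ P.part σ i, DifferentiableAt ℝ (P.γ i) t := fun i t ht =>
    differentiableAt (part_subset_K ht)
  have hmeas : ∀ i, MeasurableSet (c i (P.part σ i)) := fun i =>
    measurableSet_image_cone e measurableSet_part (hdiff i) (hinj i)
  have hdisj : Pairwise (Function.onFun Disjoint fun i => c i (P.part σ i)) := by
    intro i j hij
    refine disjoint_left.2 ?_
    rintro x ⟨⟨s, t⟩, ⟨hs, ht⟩, hx⟩ ⟨⟨s', t'⟩, ⟨hs', ht'⟩, hx'⟩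
    exact hij (part_injective hD hDc hσ ht ht' hs hs' (hx.trans hx'.symm)).2.1
  have hU : openCone D =ᵐ[e.addHaar] ⋃ i, c i (P.part σ i) := by
    have hsub : (⋃ i, c i (P.part σ i)) ⊆ openCone D := by
      refine iUnion_subset fun i => ?_
      rintro _ ⟨⟨s, t⟩, ⟨hs, ht⟩, rfl⟩
      exact (smul_mem_openCone_iff hs).2 (mem_openCone_of_mem_part hD hDc hσ ht)
    have hnull : e.addHaar ({0} ∪ ⋃ i, c i (frontier (P.K i))) = 0 := by
      refine measure_union_null (measure_singleton 0) (measure_iUnion_null fun i => ?_)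
      exact addHaar_image_cone_eq_zero e (P.volume_frontier i) fun t ht =>
        differentiableAt ((P.isCompact_K i).isClosed.frontier_subset ht)
    filter_upwards [compl_mem_ae_iff.2 hnull] with x hx
    refine propext ⟨fun hxU => ?_, fun h => hsub h⟩
    obtain ⟨r, hr, hrx⟩ := hxU
    have hx0 : x ≠ 0 := fun h => hx (Or.inl h)
    obtain ⟨i, t, ht, hti, s, hs, hxs⟩ := hcover (r • x) hrx (smul_ne_zero hr.ne' hx0)
    have hx2 : x = (r⁻¹ * s) • P.γ i t := by
      rw [mul_smul, ← hxs, inv_smul_smul₀ hr.ne']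
    have hrs : 0 < r⁻¹ * s := by positivity
    refine mem_iUnion.2 ⟨i, (r⁻¹ * s, t), ⟨hrs, hti ?_⟩, hx2.symm⟩
    by_contra hni
    refine hx (Or.inr (mem_iUnion.2 ⟨i, (r⁻¹ * s, t), ⟨hrs, ?_⟩, hx2.symm⟩))
    exact ⟨subset_closure ht, hni⟩
  refine Measure.ext_of_lintegral _ fun h hh => ?_
  have hinner : Measurable fun p : E => ∫⁻ s in Ioi (0 : ℝ), ENNReal.ofReal (s ^ m) * h (s • p) := by
    refine Measurable.lintegral_prod_right' (ν := volume.restrict (Ioi (0 : ℝ)))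
      (f := fun q : E × ℝ => ENNReal.ofReal (q.2 ^ m) * h (q.2 • q.1)) ?_
    exact (Measurable.ennreal_ofReal (by fun_prop)).mul (hh.comp measurable_smul_prod)
  rw [lintegral_map hh measurable_smul_prod,
    lintegral_prod (fun q : E × ℝ => h (q.2 • q.1)) (hh.comp measurable_smul_prod).aemeasurable,
    Measure.restrict_congr_set hU, lintegral_iUnion hmeas hdisj, tsum_fintype]
  have e1 : ∀ p : E, ∫⁻ s, h (s • p) ∂powMeasure m =
      ∫⁻ s in Ioi (0 : ℝ), ENNReal.ofReal (s ^ m) * h (s • p) := fun p =>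
    lintegral_powMeasure m (hh.comp (by fun_prop))
  rw [lintegral_congr e1, lintegral_boundaryMeasure hinner]
  refine Finset.sum_congr rfl fun i _ => ?_
  exact (lintegral_image_cone e measurableSet_part (hdiff i) (hinj i) hh).symm

end PiecewiseSmoothBoundary

/-! ### The boundary integral as exit minus entry. -/

namespace PiecewiseSmoothBoundary

variable {E : Type*} [NormedAddCommGroup E] [NormedSpace ℝ E] [FiniteDimensional ℝ E] {m : ℕ}
  [MeasurableSpace E] [BorelSpace E]
  {e : Basis (Fin (m + 1)) ℝ E} {D : Set E} {P : PiecewiseSmoothBoundary e D} {g : E → ℝ} {σ : ℝ}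

lemma ae_mem_boundaryMeasure (hDc : IsClosed D) : ∀ᵐ p ∂P.boundaryMeasure σ, p ∈ D :=
  ae_boundaryMeasure hDc.measurableSet fun _ _ ht => (mem_of_mem_K hDc (part_subset_K ht)).1

lemma ae_eq_indicator (hDc : IsClosed D) : D.indicator g =ᵐ[P.boundaryMeasure σ] g := by
  filter_upwards [ae_mem_boundaryMeasure hDc] with p hp using indicator_of_mem hp g

lemma integrable_boundaryMeasure (hDc : IsClosed D) (hg : Measurable (D.indicator g))
    (hP : P.Integrable g) : MeasureTheory.Integrable g (P.boundaryMeasure σ) := by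
  refine MeasureTheory.Integrable.congr ?_ (ae_eq_indicator hDc)
  refine ⟨hg.aestronglyMeasurable, ?_⟩
  rw [HasFiniteIntegral, lintegral_boundaryMeasure hg.enorm]
  refine ENNReal.sum_lt_top.2 fun i _ => ?_
  have h := ((hP i).mono_set (part_subset_K (σ := σ))).2
  refine lt_of_eq_of_lt (setLIntegral_congr_fun measurableSet_part fun t ht => ?_) h
  rw [indicator_of_mem (mem_of_mem_K hDc (part_subset_K ht)).1, pullback, enorm_mul,
    ← Real.enorm_eq_ofReal_abs, mul_comm]

lemma integral_boundaryMeasure (hDc : IsClosed D) (hg : Measurable (D.indicator g))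
    (hP : P.Integrable g) : ∫ p, g p ∂P.boundaryMeasure σ =
      ∑ i, ∫ t in P.part σ i, |lambdaForm e (P.γ i t) (partials (P.γ i) t)| * g (P.γ i t) := by
  have hi := (integrable_boundaryMeasure (σ := σ) hDc hg hP).congr (ae_eq_indicator hDc).symm
  rw [← integral_congr_ae (ae_eq_indicator hDc)]
  rw [boundaryMeasure] at hi ⊢
  rw [integral_finsetSum_measure (integrable_finsetSum_measure.1 hi)]
  refine Finset.sum_congr rfl fun i _ => ?_
  rw [integral_map measurable_indicator_γ.aemeasurable hg.aestronglyMeasurable,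
    integral_withDensity_eq_integral_toReal_smul measurable_density
      (ae_of_all _ fun _ => ENNReal.ofReal_lt_top)]
  refine setIntegral_congr_fun measurableSet_part fun t ht => ?_
  simp only [density_of_mem ht, indicator_of_mem ht,
    indicator_of_mem (mem_of_mem_K hDc (part_subset_K ht)).1, smul_eq_mul,
    ENNReal.toReal_ofReal (abs_nonneg _)]

/-- The signed density of a patch is the outward form at the position vector: positive on the exit
part, negative on the entry part, and without contribution where rays are tangent. The frontiers of
the parameter sets are null. -/
lemma integral_eq_sub (hDc : IsClosed D) (hg : Measurable (D.indicator g)) (hP : P.Integrable g) :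
    P.integral g = ∫ p, g p ∂P.boundaryMeasure 1 - ∫ p, g p ∂P.boundaryMeasure (-1) := by
  rw [integral_boundaryMeasure hDc hg hP, integral_boundaryMeasure hDc hg hP,
    ← Finset.sum_sub_distrib, integral]
  refine Finset.sum_congr rfl fun i _ => ?_
  set v : (Fin m → ℝ) → ℝ :=
    fun t => |lambdaForm e (P.γ i t) (partials (P.γ i) t)| * g (P.γ i t) with hv
  have hsgn : |((P.sgn i : ℤ) : ℝ)| = 1 := by
    rcases Int.units_eq_one_or (P.sgn i) with h | h <;> simp [h]
  have hint : ∀ σ, IntegrableOn v (P.part σ i) := by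
    intro σ
    have h := (hP i).mono_set (part_subset_K (σ := σ))
    have h2 := h.norm
    have hvm : AEStronglyMeasurable v (volume.restrict (P.part σ i)) := by
      have h1 : Measurable ((P.part σ i).indicator (P.γ i)) := measurable_indicator_γ
      have h2 : Measurable fun t =>
          lambdaForm e ((P.part σ i).indicator (P.γ i) t) (partials (P.γ i) t) :=
        measurable_lambdaForm e h1 measurable_partials
      have h3 := ((hg.comp h1).mul (continuous_abs.measurable.comp h2)).aestronglyMeasurable
        (μ := volume.restrict (P.part σ i))
      refine h3.congr ?_
      filter_upwards [ae_restrict_mem measurableSet_part] with t ht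
      simp only [hv, Pi.mul_apply, Function.comp_apply, indicator_of_mem ht,
        indicator_of_mem (mem_of_mem_K hDc (part_subset_K ht)).1, mul_comm]
    refine h2.mono' hvm (ae_of_all _ fun t => ?_)
    rw [hv, pullback, norm_mul, norm_mul, Real.norm_eq_abs, abs_abs, Real.norm_eq_abs,
      Real.norm_eq_abs, mul_comm]
  have hK : volume.restrict (P.K i) = volume.restrict (interior (P.K i)) :=
    (Measure.restrict_congr_set (interior_ae_eq_of_null_frontier (P.volume_frontier i))).symm
  have hr : ∀ σ, ∫ t in P.part σ i, v t = ∫ t in interior (P.K i), (P.part σ i).indicator v t := by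
    intro σ
    rw [setIntegral_indicator measurableSet_part, inter_eq_self_of_subset_right part_subset]
  have hri : ∀ σ, IntegrableOn ((P.part σ i).indicator v) (interior (P.K i)) := by
    intro σ
    exact ((integrable_indicator_iff measurableSet_part).2 (hint σ)).integrableOn
  rw [hr, hr, ← integral_sub (hri 1) (hri (-1)), hK, ← integral_const_mul]
  refine setIntegral_congr_fun isOpen_interior.measurableSet fun t ht => ?_
  have habs : |lambdaForm e (P.γ i t) (partials (P.γ i) t)| = |P.outward i t (P.γ i t)| := by
    rw [outward_apply_self, abs_mul, hsgn, one_mul]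
  have hpb : ((P.sgn i : ℤ) : ℝ) * P.pullback g i t = P.outward i t (P.γ i t) * g (P.γ i t) := by
    rw [outward_apply_self, pullback]; ring
  simp only [hpb]
  rcases lt_trichotomy (P.outward i t (P.γ i t)) 0 with h | h | h
  · rw [indicator_of_notMem (s := P.part 1 i) (fun hn => by linarith [hn.2]),
      indicator_of_mem (s := P.part (-1) i) ⟨ht, by linarith⟩, hv]
    simp only [habs, abs_of_neg h]
    ring
  · rw [indicator_of_notMem (s := P.part 1 i) (fun hn => by linarith [hn.2]),
      indicator_of_notMem (s := P.part (-1) i) (fun hn => by linarith [hn.2]), h]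
    ring
  · rw [indicator_of_mem (s := P.part 1 i) ⟨ht, by linarith⟩,
      indicator_of_notMem (s := P.part (-1) i) (fun hn => by linarith [hn.2]), hv]
    simp only [habs, abs_of_pos h]
    ring

lemma ae_exists_smul_mem_interior (hD : Convex ℝ D) (hDc : IsClosed D) :
    ∀ᵐ p ∂P.boundaryMeasure σ, p ∈ D ∧ p ∉ interior D ∧
      ∃ ε ∈ Ioo (0 : ℝ) 1, (1 - ε * σ) • p ∈ interior D := by
  refine ae_boundaryMeasure ?_ fun i t ht =>
    ⟨(mem_of_mem_K hDc (part_subset_K ht)).1, (mem_of_mem_K hDc (part_subset_K ht)).2,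
      exists_smul_mem_interior hD hDc ht⟩
  have h : {p : E | ∃ ε ∈ Ioo (0 : ℝ) 1, (1 - ε * σ) • p ∈ interior D} =
      ⋃ ε ∈ Ioo (0 : ℝ) 1, (fun p : E => (1 - ε * σ) • p) ⁻¹' interior D := by
    ext p
    simp only [mem_ofPred_eq, mem_iUnion, exists_prop, mem_preimage]
  have ho : IsOpen {p : E | ∃ ε ∈ Ioo (0 : ℝ) 1, (1 - ε * σ) • p ∈ interior D} := by
    rw [h]
    exact isOpen_biUnion fun ε _ => isOpen_interior.preimage (continuous_const_smul _)
  exact hDc.measurableSet.inter (isOpen_interior.measurableSet.compl.inter ho.measurableSet)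

/-- The divergence theorem for the vector field `g x • x` on a compact convex set, where `g` is
a closed concave function. -/
theorem integral_divergence (hD : Convex ℝ D) (hDc : IsCompact D) (hg : ConcaveOn ℝ D g)
    (hus : UpperSemicontinuousOn g D) (hP : P.Integrable g) :
    IntegrableOn g D e.addHaar ∧ IntegrableOn (fun x => fderiv ℝ g x x) D e.addHaar ∧
      ∫ x in D, ((m + 1) * g x + fderiv ℝ g x x) ∂e.addHaar = P.integral g := by
  have hgm := measurable_indicator_of_upperSemicontinuousOn hDc.isClosed hus
  rw [integral_eq_sub hDc.isClosed hgm hP]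
  refine integral_divergence_of_isPolar hD hDc hg hus m e.addHaar
    (isPolar_boundaryMeasure hD hDc.isClosed (Or.inl rfl)
      fun x hx hx0 => P.cover_exit hD hDc hx0 hx)
    (fun h0 => isPolar_boundaryMeasure hD hDc.isClosed (Or.inr rfl)
      fun x hx _ => P.cover_entry hD hDc h0 hx)
    (fun h0 => ?_) ?_ ?_ (integrable_boundaryMeasure hDc.isClosed hgm hP)
    (integrable_boundaryMeasure hDc.isClosed hgm hP)
  · refine Finset.sum_eq_zero fun i _ => ?_
    rw [part_eq_empty_of_zero_mem hD h0, Measure.restrict_empty]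
    simp
  · filter_upwards [ae_exists_smul_mem_interior hD hDc.isClosed] with p hp
    obtain ⟨h1, h2, ε, hε, h⟩ := hp
    exact ⟨h1, h2, 1 - ε * 1, ⟨by linarith [hε.2], by linarith [hε.1]⟩, h⟩
  · filter_upwards [ae_exists_smul_mem_interior hD hDc.isClosed] with p hp
    obtain ⟨h1, h2, ε, hε, h⟩ := hp
    exact ⟨h1, h2, 1 - ε * -1, by linarith [hε.1], h⟩

end PiecewiseSmoothBoundary

/-- The integral of a concave function with respect to its Monge-Ampère measure. -/
theorem integral_mongeAmpere_of_boundary {N : Type*} [NormedAddCommGroup N] [NormedSpace ℝ N]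
    [FiniteDimensional ℝ N] [MeasurableSpace N] [BorelSpace N] {m : ℕ}
    (e : Basis (Fin (m + 1)) ℝ (StrongDual ℝ N)) {f : N → ℝ} (hf : ConcaveOn ℝ univ f)
    (hD : IsCompact (stab univ f)) (P : PiecewiseSmoothBoundary e (stab univ f))
    (hP : P.Integrable (legendreDual univ f)) :
    ∃ ν : Measure N, IsMongeAmpere e.addHaar univ f ν ∧ Integrable f ν ∧
      IntegrableOn (legendreDual univ f) (stab univ f) e.addHaar ∧
      -((m + 1)! : ℝ) * ∫ u, f u ∂ν =
        ((m + 1 + 1)! : ℝ) * ∫ x in stab univ f, legendreDual univ f x ∂e.addHaar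
          - ((m + 1)! : ℝ) * P.integral (legendreDual univ f) := by
  obtain ⟨ν, hν, hint⟩ := exists_isMongeAmpere e.addHaar hf.locallyLipschitz.continuous
  obtain ⟨h1, h2, h3⟩ := P.integral_divergence convex_stab hD
    (concaveOn_legendreDual univ_nonempty) (upperSemicontinuousOn_legendreDual univ_nonempty) hP
  obtain ⟨h4, h5⟩ := hint (h2.sub h1)
  refine ⟨ν, hν, h4, h1, ?_⟩
  -- Both sides are now combinations of `∫ g` and `∫ dg(x) x`; the latter cancels, and `m + 2`
  -- copies of `∫ g` remain.
  rw [h5, ← h3, integral_sub h2 h1, integral_add (h1.const_mul _) h2, integral_const_mul,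
    Nat.factorial_succ (m + 1)]
  push_cast
  ring

/-! ### Faces of polytopes. -/

section Polytopes

variable {E : Type*} [NormedAddCommGroup E] [NormedSpace ℝ E]

/-- If a point of `F` is a convex combination giving positive weight to `y`, it equals `y` or lies
in the open segment from `y` to the barycentre of the rest, so `y ∈ F`. Hence a convex face is
determined by the points of `s` in it. -/
lemma isExtreme_convexHull_eq {s : Finset E} {F : Set E}
    (hF : IsExtreme ℝ (convexHull ℝ (s : Set E)) F) (hc : Convex ℝ F) :
    F = convexHull ℝ ((s : Set E) ∩ F) := by
  classical
  refine Subset.antisymm (fun x hx => ?_) (convexHull_min inter_subset_right hc)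
  obtain ⟨w, hw0, hw1, hwx⟩ := Finset.mem_convexHull'.1 (hF.subset hx)
  have hsF : ∀ y ∈ s, w y ≠ 0 → y ∈ F := by
    intro y hy hwy
    have hpos : 0 < w y := (hw0 y hy).lt_of_ne' hwy
    have hsum : w y + ∑ z ∈ s.erase y, w z = 1 := by rw [Finset.add_sum_erase _ _ hy, hw1]
    have hsumx : w y • y + ∑ z ∈ s.erase y, w z • z = x := by
      rw [Finset.add_sum_erase _ (fun z => w z • z) hy, hwx]
    have hnn : ∀ z ∈ s.erase y, 0 ≤ w z := fun z hz => hw0 z (Finset.mem_of_mem_erase hz)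
    rcases (Finset.sum_nonneg hnn).eq_or_lt with h0 | h0
    · have hz : ∀ z ∈ s.erase y, w z = 0 := (Finset.sum_eq_zero_iff_of_nonneg hnn).1 h0.symm
      have : ∑ z ∈ s.erase y, w z • z = 0 :=
        Finset.sum_eq_zero fun z hz' => by rw [hz z hz', zero_smul]
      rw [← h0, add_zero] at hsum
      rw [this, add_zero, hsum, one_smul] at hsumx
      rwa [hsumx]
    · set c := ∑ z ∈ s.erase y, w z with hc'
      have hx' : c⁻¹ • ∑ z ∈ s.erase y, w z • z ∈ convexHull ℝ (s : Set E) := by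
        have h1 := (s.erase y).centerMass_mem_convexHull hnn h0 (z := id) (s := (s : Set E))
          fun z hz => Finset.mem_coe.2 (Finset.mem_of_mem_erase hz)
        exact h1
      refine hF.left_mem_of_mem_openSegment (subset_convexHull ℝ _ (Finset.mem_coe.2 hy)) hx' hx
        ⟨w y, c, hpos, h0, hsum, ?_⟩
      rw [smul_inv_smul₀ h0.ne', hsumx]
  rw [← hwx, ← Finset.sum_filter_of_ne (p := fun y => w y ≠ 0) fun y _ h hw => h (by simp [hw])]
  refine (convex_convexHull ℝ _).sum_mem (fun y hy => hw0 y (Finset.mem_filter.1 hy).1) ?_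
    fun y hy => ?_
  · rw [Finset.sum_filter_ne_zero, hw1]
  · obtain ⟨h1, h2⟩ := Finset.mem_filter.1 hy
    exact subset_convexHull ℝ _ ⟨h1, hsF y h1 h2⟩

variable [FiniteDimensional ℝ E]

lemma finite_facets {s : Finset E} : (facets (convexHull ℝ (s : Set E))).Finite := by
  refine Set.Finite.of_finite_image (f := fun F => (s : Set E) ∩ F)
    (Set.Finite.subset (s.finite_toSet.finite_subsets) ?_) ?_
  · rintro _ ⟨F, -, rfl⟩
    exact inter_subset_left
  · intro F hF F' hF' h
    rw [isExtreme_convexHull_eq hF.2.2.1 hF.2.1, isExtreme_convexHull_eq hF'.2.2.1 hF'.2.1]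
    exact congrArg _ h

lemma isCompact_of_mem_facets {s : Finset E} {F : Set E}
    (hF : F ∈ facets (convexHull ℝ (s : Set E))) : IsCompact F := by
  rw [isExtreme_convexHull_eq hF.2.2.1 hF.2.1]
  exact (s.finite_toSet.subset inter_subset_left).isCompact_convexHull ℝ

lemma linSpace_eq_top {Δ : Set E} (hne : (interior Δ).Nonempty) :
    linSpace Δ = ⊤ := by
  have h : affineSpan ℝ Δ = ⊤ :=
    top_unique ((isOpen_interior.affineSpan_eq_top hne).ge.trans
      (affineSpan_mono ℝ interior_subset))
  rw [linSpace, h, AffineSubspace.direction_top]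

/-- A boundary point of a polytope lies in a proper face. -/
lemma exists_face {s : Finset E} (hne : (interior (convexHull ℝ (s : Set E))).Nonempty) {x : E}
    (hx : x ∈ frontier (convexHull ℝ (s : Set E))) :
    ∃ F : Set E, x ∈ F ∧ Convex ℝ F ∧ IsExtreme ℝ (convexHull ℝ (s : Set E)) F ∧
      finrank ℝ (vectorSpan ℝ F) + 1 ≤ finrank ℝ E := by
  set Δ := convexHull ℝ (s : Set E) with hΔ
  have hconv : Convex ℝ Δ := convex_convexHull ℝ _
  have hcl : IsClosed Δ := s.finite_toSet.isClosed_convexHull ℝ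
  obtain ⟨l, hl⟩ := geometric_hahn_banach_open_point hconv.interior isOpen_interior hx.2
  have hle : ∀ y ∈ Δ, l y ≤ l x := by
    intro y hy
    have : y ∈ closure (interior Δ) := by
      rw [hconv.closure_interior_eq_closure_of_nonempty_interior hne]
      exact subset_closure hy
    exact closure_minimal (fun z hz => (hl z hz).le) (isClosed_le l.continuous continuous_const) this
  refine ⟨Δ ∩ {y | l y = l x}, ⟨hcl.frontier_subset hx, rfl⟩, ?_, ?_, ?_⟩
  · exact hconv.inter (convex_hyperplane l.toLinearMap.isLinear _)
  · refine ⟨inter_subset_left, ?_⟩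
    rintro y hy z hz w ⟨-, hw⟩ ⟨a, b, ha, hb, hab, rfl⟩
    refine ⟨hy, le_antisymm (hle y hy) ?_⟩
    have hw : l (a • y + b • z) = l x := hw
    rw [map_add, map_smul, map_smul, smul_eq_mul, smul_eq_mul] at hw
    have h1 := mul_le_mul_of_nonneg_left (hle z hz) hb.le
    have h2 : a * l x ≤ a * l y := by
      have : a = 1 - b := by linarith
      subst this
      linarith
    exact le_of_mul_le_mul_left h2 ha
  · have hlt : vectorSpan ℝ (Δ ∩ {y | l y = l x}) < ⊤ := by
      refine lt_of_le_of_lt (b := LinearMap.ker l.toLinearMap) ?_ ?_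
      · rw [vectorSpan_def, Submodule.span_le]
        rintro _ ⟨y, hy, z, hz, rfl⟩
        have h1 : l y = l x := hy.2
        have h2 : l z = l x := hz.2
        simp [h1, h2]
      · rw [lt_top_iff_ne_top]
        intro h
        obtain ⟨y, hy⟩ := hne
        have h1 := hl y hy
        have h2 : ∀ z, l z = 0 := fun z => by
          have : z ∈ LinearMap.ker l.toLinearMap := h ▸ Submodule.mem_top
          exact this
        rw [h2, h2] at h1
        exact lt_irrefl _ h1
    exact Submodule.finrank_lt hlt.ne

/-- If `x` lay on no facet, projecting a neighbourhood of `x` radially from an interior point `y`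
would land in faces of codimension at least two. The neighbourhood would then be covered by finitely
many affine spans of such faces with `y`, all proper and therefore null. -/
theorem frontier_subset_facets {s : Finset E}
    (hne : (interior (convexHull ℝ (s : Set E))).Nonempty) :
    frontier (convexHull ℝ (s : Set E)) ⊆ ⋃₀ facets (convexHull ℝ (s : Set E)) := by
  let : MeasurableSpace E := borel E
  have : BorelSpace E := ⟨rfl⟩
  set Δ := convexHull ℝ (s : Set E) with hΔ
  have hconv : Convex ℝ Δ := convex_convexHull ℝ _
  intro x hx
  by_contra hxZ
  have hZc : IsClosed (⋃₀ facets Δ) := by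
    rw [sUnion_eq_biUnion]
    exact finite_facets.isClosed_biUnion fun F hF => (isCompact_of_mem_facets hF).isClosed
  obtain ⟨y, hy⟩ := id hne
  -- the radial projection onto the boundary with centre `y`
  set B : Set E := (fun z => y + z) ⁻¹' Δ with hB
  have hBc : Convex ℝ B := hconv.translate_preimage_right y
  have hhom : ∀ A : Set E, (fun z => y + z) ⁻¹' interior A = interior ((fun z => y + z) ⁻¹' A) :=
    fun A => (Homeomorph.addLeft y).preimage_interior A
  have hfr : ∀ A : Set E, (fun z => y + z) ⁻¹' frontier A = frontier ((fun z => y + z) ⁻¹' A) :=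
    fun A => (Homeomorph.addLeft y).preimage_frontier A
  have hB0 : B ∈ 𝓝 0 := by
    rw [← mem_interior_iff_mem_nhds, hB, ← hhom]
    simpa using hy
  have hgc : Continuous (gauge B) := continuous_gauge hBc hB0
  have hgx : gauge B (x - y) = 1 := by
    rw [gauge_eq_one_iff_mem_frontier hBc hB0, hB, ← hfr]
    simpa using hx
  set π : E → E := fun z => y + (gauge B (z - y))⁻¹ • (z - y) with hπ
  have hgcx : ContinuousAt (fun z => gauge B (z - y)) x :=
    (hgc.comp (continuous_id.sub continuous_const)).continuousAt
  have hπc : ContinuousAt π x := by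
    refine continuousAt_const.add (ContinuousAt.smul (hgcx.inv₀ ?_) (by fun_prop))
    rw [hgx]; exact one_ne_zero
  have hπx : π x = x := by simp [hπ, hgx]
  have hev : ∀ᶠ z in 𝓝 x, π z ∈ (⋃₀ facets Δ)ᶜ ∧ 0 < gauge B (z - y) := by
    refine (hπc.eventually_mem ?_).and (hgcx.eventually (lt_mem_nhds ?_))
    · rw [hπx]; exact hZc.isOpen_compl.mem_nhds hxZ
    · show 0 < gauge B (x - y)
      rw [hgx]; exact one_pos
  -- Adding `y` raises the dimension by at most one, so the strict inequality keeps the span proper.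
  set T : Set (Set E) := {t | t ⊆ (s : Set E) ∧ finrank ℝ (vectorSpan ℝ t) + 1 < finrank ℝ E} with hT
  have hTfin : T.Finite := s.finite_toSet.finite_subsets.subset fun t ht => ht.1
  have hnull : Measure.addHaar (⋃ t ∈ T, (affineSpan ℝ (insert y t) : Set E)) = 0 := by
    rw [measure_biUnion_null_iff hTfin.countable]
    intro t ht
    refine Measure.addHaar_affineSubspace _ _ fun htop => ?_
    have h1 : vectorSpan ℝ (insert y t) = ⊤ := by
      rw [← direction_affineSpan, htop, AffineSubspace.direction_top]
    have h2 := finrank_vectorSpan_insert_le_set ℝ t y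
    rw [h1, finrank_top] at h2
    have := ht.2
    omega
  have hsub : ∀ᶠ z in 𝓝 x, z ∈ ⋃ t ∈ T, (affineSpan ℝ (insert y t) : Set E) := by
    filter_upwards [hev] with z hz
    obtain ⟨hz1, hz2⟩ := hz
    have hπz : π z ∈ frontier Δ := by
      have : gauge B ((gauge B (z - y))⁻¹ • (z - y)) = 1 := by
        rw [gauge_smul_of_nonneg (inv_nonneg.2 hz2.le), smul_eq_mul, inv_mul_cancel₀ hz2.ne']
      rw [gauge_eq_one_iff_mem_frontier hBc hB0, hB, ← hfr] at this
      exact this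
    obtain ⟨F, hzF, hFc, hFe, hFd⟩ := exists_face hne hπz
    have hF := isExtreme_convexHull_eq hFe hFc
    have hvs : vectorSpan ℝ F = vectorSpan ℝ ((s : Set E) ∩ F) := by
      conv_lhs => rw [hF]
      rw [← direction_affineSpan, affineSpan_convexHull, direction_affineSpan]
    have hlt : finrank ℝ (vectorSpan ℝ F) + 1 < finrank ℝ E := by
      refine hFd.lt_of_ne fun h => hz1 ⟨F, ⟨⟨_, hzF⟩, hFc, hFe, ?_⟩, hzF⟩
      rw [linSpace_eq_top hne, finrank_top, linSpace, direction_affineSpan, h]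
    refine mem_biUnion (show (s : Set E) ∩ F ∈ T from ⟨inter_subset_left, hvs ▸ hlt⟩) ?_
    have h1 : π z ∈ affineSpan ℝ (insert y ((s : Set E) ∩ F)) := by
      refine affineSpan_mono ℝ (subset_insert _ _) ?_
      refine convexHull_subset_affineSpan _ ?_
      rw [← hF]; exact hzF
    have h2 : y ∈ affineSpan ℝ (insert y ((s : Set E) ∩ F)) :=
      subset_affineSpan ℝ _ (mem_insert _ _)
    have h3 := AffineMap.lineMap_mem (gauge B (z - y)) h2 h1
    convert! h3 using 1
    rw [AffineMap.lineMap_apply, hπ]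
    simp only [vsub_eq_sub, vadd_eq_add, add_sub_cancel_left]
    rw [smul_inv_smul₀ hz2.ne', sub_add_cancel]
  have hpos : 0 < Measure.addHaar (⋃ t ∈ T, (affineSpan ℝ (insert y t) : Set E)) :=
    Measure.measure_pos_of_mem_nhds _ hsub
  exact hpos.ne' hnull

end Polytopes

lemma exists_mem_openSegment_of_mem_interior {V : Type*} [NormedAddCommGroup V] [NormedSpace ℝ V]
    {K : Set V} {t : V} (ht : t ∈ interior K) (y : V) : ∃ z ∈ K, t ∈ openSegment ℝ y z := by
  have hc : Tendsto (fun r : ℝ => t + r • (t - y)) (𝓝[>] 0) (𝓝 t) := by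
    have : Continuous fun r : ℝ => t + r • (t - y) := by fun_prop
    have h := this.tendsto 0
    rw [zero_smul, add_zero] at h
    exact h.mono_left nhdsWithin_le_nhds
  obtain ⟨r, hr, hr0⟩ := ((hc.eventually (mem_interior_iff_mem_nhds.1 ht)).and
    (eventually_mem_of_tendsto_nhdsWithin tendsto_id)).exists
  have hr0 : 0 < r := hr0
  have h1 : 0 < 1 + r := by positivity
  refine ⟨_, hr, r / (1 + r), 1 / (1 + r), by positivity, by positivity, by field_simp; ring, ?_⟩
  have h2 : (1 + r) • t = r • y + (t + r • (t - y)) := by module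
  calc (r / (1 + r)) • y + (1 / (1 + r)) • (t + r • (t - y))
      = (1 / (1 + r)) • (r • y + (t + r • (t - y))) := by module
    _ = t := by rw [← h2, smul_smul, one_div_mul_cancel h1.ne', one_smul]

/-! ### Facets as the patches of a piecewise smooth boundary. -/

section PolytopeBoundary

variable {E : Type*} [NormedAddCommGroup E] [NormedSpace ℝ E] [FiniteDimensional ℝ E] {m : ℕ}

lemma somePoint_mem {F : Set E} (hF : F.Nonempty) : somePoint F ∈ F :=
  Classical.epsilon_spec hF

lemma sub_mem_linSpace {F : Set E} {x y : E} (hx : x ∈ F) (hy : y ∈ F) : x - y ∈ linSpace F := by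
  rw [linSpace, direction_affineSpan]
  exact vsub_mem_vectorSpan ℝ hx hy

section FacetChart

/-- The affine chart of `p + V` given by a basis of `V`. -/
noncomputable def facetChart (p : E) {V : Submodule ℝ E} (b : Basis (Fin m) ℝ V) (t : Fin m → ℝ) : E :=
  p + (b.equivFunL.symm t : E)

variable (p : E) {V : Submodule ℝ E} (b : Basis (Fin m) ℝ V)

lemma facetChart_injective : Function.Injective (facetChart p b) := fun _ _ h =>
  b.equivFunL.symm.injective (Subtype.ext (add_left_cancel h))

lemma contDiff_facetChart : ContDiff ℝ ∞ (facetChart p b) :=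
  contDiff_const.add (V.subtypeL.comp
    (b.equivFunL.symm : (Fin m → ℝ) →L[ℝ] V)).contDiff

lemma isClosedEmbedding_facetChart : IsClosedEmbedding (facetChart p b) :=
  (Homeomorph.addLeft p).isClosedEmbedding.comp
    ((Submodule.closed_of_finiteDimensional V).isClosedEmbedding_subtypeVal.comp
      b.equivFunL.symm.toHomeomorph.isClosedEmbedding)

lemma mem_range_facetChart {y : E} : y ∈ range (facetChart p b) ↔ y - p ∈ V := by
  constructor
  · rintro ⟨t, rfl⟩
    rw [facetChart, add_sub_cancel_left]
    exact (b.equivFunL.symm t).2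
  · intro h
    refine ⟨b.equivFunL ⟨y - p, h⟩, ?_⟩
    rw [facetChart, ContinuousLinearEquiv.symm_apply_apply, add_sub_cancel]

lemma partials_facetChart (t : Fin m → ℝ) :
    partials (facetChart p b) t = fun j => (b j : E) := by
  funext j
  have h : HasFDerivAt (facetChart p b) (V.subtypeL.comp
      (b.equivFunL.symm : (Fin m → ℝ) →L[ℝ] V)) t :=
    ((V.subtypeL.comp (b.equivFunL.symm : (Fin m → ℝ) →L[ℝ] V)).hasFDerivAt (x := t)).const_add p
  rw [partials, h.fderiv]
  change ((b.equivFunL.symm (Pi.single j 1) : V) : E) = _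
  congr 1
  change b.equivFun.symm (Pi.single j 1) = _
  classical
  rw [Basis.equivFun_symm_apply]
  simp [Pi.single_apply]

lemma facetChart_mem_openSegment {t t₁ t₂ : Fin m → ℝ} (h : t ∈ openSegment ℝ t₁ t₂) :
    facetChart p b t ∈ openSegment ℝ (facetChart p b t₁) (facetChart p b t₂) := by
  obtain ⟨α, β, hα, hβ, hαβ, rfl⟩ := h
  refine ⟨α, β, hα, hβ, hαβ, ?_⟩
  simp only [facetChart, map_add, map_smul, Submodule.coe_add, Submodule.coe_smul]
  have : p = (α + β) • p := by rw [hαβ, one_smul]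
  conv_rhs => rw [this]
  module

lemma convex_preimage_facetChart {F : Set E} (hF : Convex ℝ F) :
    Convex ℝ (facetChart p b ⁻¹' F) := by
  have h := (hF.translate_preimage_right p).linear_preimage
    (V.subtype ∘ₗ (b.equivFun.symm : (Fin m → ℝ) →ₗ[ℝ] V))
  exact h

end FacetChart

lemma exists_facetChart_eq {F : Set E} (b : Basis (Fin m) ℝ (linSpace F)) {p y : E} (hp : p ∈ F)
    (hy : y ∈ F) : ∃ t, facetChart p b t = y :=
  (mem_range_facetChart p b).2 (sub_mem_linSpace hy hp)

lemma nonempty_interior_preimage_facetChart {F : Set E} (hF : Convex ℝ F)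
    (b : Basis (Fin m) ℝ (linSpace F)) {p : E} (hp : p ∈ F) :
    (interior (facetChart p b ⁻¹' F)).Nonempty := by
  have hK := convex_preimage_facetChart p b hF
  obtain ⟨t₀, ht₀⟩ := exists_facetChart_eq b hp hp
  have hne : (facetChart p b ⁻¹' F).Nonempty := ⟨t₀, by rw [mem_preimage, ht₀]; exact hp⟩
  rw [hK.interior_nonempty_iff_affineSpan_eq_top,
    AffineSubspace.affineSpan_eq_top_iff_vectorSpan_eq_top_of_nonempty ℝ _ _ hne]
  set A : (Fin m → ℝ) →ₗ[ℝ] E :=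
    (linSpace F).subtype ∘ₗ (b.equivFun.symm : (Fin m → ℝ) →ₗ[ℝ] linSpace F) with hA
  have hAi : Function.Injective A := Subtype.val_injective.comp b.equivFun.symm.injective
  have hAsub : ∀ t t', A t - A t' = facetChart p b t - facetChart p b t' := fun t t' => by
    rw [facetChart, facetChart, add_sub_add_left_eq_sub]
    rfl
  refine Submodule.map_injective_of_injective hAi (le_antisymm (Submodule.map_mono le_top) ?_)
  have h1 : Submodule.map A ⊤ ≤ linSpace F := by
    rintro _ ⟨t, -, rfl⟩
    exact (b.equivFun.symm t).2
  have h2 : linSpace F = Submodule.span ℝ (F -ᵥ F) := by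
    rw [linSpace, direction_affineSpan, vectorSpan_def]
  refine h1.trans (h2.le.trans (Submodule.span_le.2 ?_))
  rintro _ ⟨y, hy, z, hz, rfl⟩
  obtain ⟨t, rfl⟩ := exists_facetChart_eq b hp hy
  obtain ⟨t', rfl⟩ := exists_facetChart_eq b hp hz
  refine ⟨t - t', vsub_mem_vectorSpan ℝ hy hz, ?_⟩
  rw [map_sub, hAsub]; rfl

lemma conormal_ne_zero (e : Basis (Fin (m + 1)) ℝ E) {V : Submodule ℝ E} (b : Basis (Fin m) ℝ V)
    {x : E} (hx : x ∉ V) : conormal e (fun j => (b j : E)) x ≠ 0 := by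
  rw [conormal_apply]
  have hspan : Submodule.span ℝ (range fun j => (b j : E)) = V := by
    have h : (range fun j => (b j : E)) = V.subtype '' range b := by rw [← range_comp]; rfl
    rw [h, Submodule.span_image, b.span_eq, Submodule.map_subtype_top]
  have hli : LinearIndependent ℝ (Fin.cons x fun j => (b j : E) : Fin (m + 1) → E) := by
    rw [linearIndependent_finCons, hspan]
    exact ⟨b.linearIndependent.map' V.subtype V.ker_subtype, hx⟩
  have hcard : Fintype.card (Fin (m + 1)) = finrank ℝ E := (finrank_eq_card_basis e).symm
  exact (((Basis.is_basis_iff_det e).1 ⟨hli, hli.span_eq_top_of_card_eq_finrank' hcard⟩).ne_zero)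

lemma conormal_eq_zero (e : Basis (Fin (m + 1)) ℝ E) {V : Submodule ℝ E} (b : Basis (Fin m) ℝ V)
    {x : E} (hx : x ∈ V) : conormal e (fun j => (b j : E)) x = 0 := by
  have h := b.sum_repr ⟨x, hx⟩
  have h' : ∑ j, b.repr ⟨x, hx⟩ j • (b j : E) = x := by
    have := congrArg V.subtype h
    rwa [map_sum] at this
  rw [← h', map_sum]
  refine Finset.sum_eq_zero fun j _ => ?_
  rw [map_smul, conormal_tangent e (fun j => (b j : E)) j, smul_zero]

section Facets

variable {s : Finset E} {F F' : Set E}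

/-- Extend the segment from `y` through a relative interior point of `F` slightly, staying in `F`;
extremality then puts `y` into `F`. -/
lemma mem_facet_of_sub_mem_linSpace {Δ : Set E} (hF : F ∈ facets Δ) (b : Basis (Fin m) ℝ (linSpace F))
    {p y : E} (hp : p ∈ F) (hy : y ∈ Δ) (hyp : y - p ∈ linSpace F) : y ∈ F := by
  obtain ⟨t, ht⟩ := nonempty_interior_preimage_facetChart hF.2.1 b hp
  obtain ⟨t', rfl⟩ := (mem_range_facetChart p b).2 hyp
  obtain ⟨t'', h1, h2⟩ := exists_mem_openSegment_of_mem_interior ht t'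
  exact hF.2.2.1.left_mem_of_mem_openSegment hy (hF.2.2.1.subset h1)
    (interior_subset (s := facetChart p b ⁻¹' F) ht)
    (facetChart_mem_openSegment p b h2)

/-- The same extension argument, with extremality of `F'`. It shows that distinct facets have
disjoint relative interiors. -/
lemma facet_subset_of_inter {Δ : Set E} (hF : F ∈ facets Δ) (hF' : F' ∈ facets Δ)
    (b : Basis (Fin m) ℝ (linSpace F)) {p : E} (hp : p ∈ F) {t : Fin m → ℝ}
    (ht : t ∈ interior (facetChart p b ⁻¹' F)) (hx : facetChart p b t ∈ F') : F ⊆ F' := by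
  intro y hy
  obtain ⟨t', rfl⟩ := exists_facetChart_eq b hp hy
  obtain ⟨t'', h1, h2⟩ := exists_mem_openSegment_of_mem_interior ht t'
  exact hF'.2.2.1.left_mem_of_mem_openSegment (hF.2.2.1.subset hy) (hF.2.2.1.subset h1) hx
    (facetChart_mem_openSegment p b h2)

/-- A face containing an interior point is everything, against its codimension. -/
lemma disjoint_facet_interior {Δ : Set E} (hF : F ∈ facets Δ) : Disjoint F (interior Δ) := by
  rw [Set.disjoint_left]
  intro x hxF hx
  have : F = Δ := by
    refine hF.2.2.1.subset.antisymm fun y hy => ?_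
    obtain ⟨z, hz, h⟩ := exists_mem_openSegment_of_mem_interior hx y
    exact hF.2.2.1.left_mem_of_mem_openSegment hy hz hxF h
  have h := hF.2.2.2
  rw [this] at h
  omega

lemma sUnion_facets_eq_frontier (hne : (interior (convexHull ℝ (s : Set E))).Nonempty) :
    ⋃₀ facets (convexHull ℝ (s : Set E)) = frontier (interior (convexHull ℝ (s : Set E))) := by
  have hconv : Convex ℝ (convexHull ℝ (s : Set E)) := convex_convexHull ℝ _
  have hfr : frontier (interior (convexHull ℝ (s : Set E))) = frontier (convexHull ℝ (s : Set E)) := by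
    rw [frontier, frontier, hconv.closure_interior_eq_closure_of_nonempty_interior hne,
      interior_interior]
  rw [hfr]
  refine Subset.antisymm (sUnion_subset fun F hF x hx => ?_) (frontier_subset_facets hne)
  exact ⟨subset_closure (hF.2.2.1.subset hx), (disjoint_facet_interior hF).notMem_of_mem_left hx⟩

/-- An interior point on the hyperplane of `F` would belong to `F`. So the conormal never takes its
facet value on the connected interior and stays on one side of it. -/
lemma exists_sign_conormal (e : Basis (Fin (m + 1)) ℝ E) {Δ : Set E} (hΔ : Convex ℝ Δ)
    (hne : (interior Δ).Nonempty) (hF : F ∈ facets Δ) (b : Basis (Fin m) ℝ (linSpace F)) {p : E}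
    (hp : p ∈ F) : ∃ σ : ℤˣ, ∀ y ∈ interior Δ,
      0 < ((σ : ℤ) : ℝ) * (conormal e (fun j => (b j : E)) p
        - conormal e (fun j => (b j : E)) y) := by
  set l := conormal e (fun j => (b j : E)) with hl
  have hc : ContinuousOn l (interior Δ) := l.continuous_of_finiteDimensional.continuousOn
  have hlp : ∀ y ∈ interior Δ, l y ≠ l p := by
    intro y hy h
    refine (disjoint_facet_interior hF).notMem_of_mem_right hy ?_
    refine mem_facet_of_sub_mem_linSpace hF b hp (interior_subset hy) (by_contra fun h' => ?_)
    exact conormal_ne_zero e b h' (by rw [map_sub, ← hl, h, sub_self])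
  have hpc := hΔ.interior.isPreconnected
  obtain ⟨y₀, hy₀⟩ := hne
  rcases (hlp y₀ hy₀).lt_or_gt with h | h
  · refine ⟨1, fun y hy => ?_⟩
    rcases (hlp y hy).lt_or_gt with h' | h'
    · simpa using h'
    · obtain ⟨z, hz, hz'⟩ := hpc.intermediate_value hy₀ hy hc ⟨h.le, h'.le⟩
      exact absurd hz' (hlp z hz)
  · refine ⟨-1, fun y hy => ?_⟩
    rcases (hlp y hy).lt_or_gt with h' | h'
    · obtain ⟨z, hz, hz'⟩ := hpc.intermediate_value hy hy₀ hc ⟨h'.le, h.le⟩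
      exact absurd hz' (hlp z hz)
    · simpa using h'

/-- The boundary of a polytope, decomposed into its facets. -/
theorem exists_piecewiseSmoothBoundary (e : Basis (Fin (m + 1)) ℝ E)
    {Δ : Set E} (hΔ : Δ = convexHull ℝ (s : Set E))
    (hne : (interior Δ).Nonempty)
    (b : ∀ F : facets Δ, Basis (Fin m) ℝ (linSpace (F : Set E)))
    (σ : facets Δ → ℤˣ)
    (hσ : ∀ F : facets Δ, ∀ y ∈ interior Δ,
      0 < ((σ F : ℤ) : ℝ) * (conormal e (fun j => (b F j : E)) (somePoint (F : Set E))
        - conormal e (fun j => (b F j : E)) y)) :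
    ∃ P : PiecewiseSmoothBoundary e Δ, ∀ g : E → ℝ,
      ((∀ F : facets Δ,
        IntegrableOn (fun t => g (facetChart (somePoint (F : Set E)) (b F) t))
          (facetChart (somePoint (F : Set E)) (b F) ⁻¹' F)) → P.Integrable g) ∧
      P.integral g = ∑ᶠ F : facets Δ, ((σ F : ℤ) : ℝ) *
        conormal e (fun j => (b F j : E)) (somePoint (F : Set E)) *
        ∫ t in facetChart (somePoint (F : Set E)) (b F) ⁻¹' F,
          g (facetChart (somePoint (F : Set E)) (b F) t) := by
  classical
  have hfin : (facets Δ).Finite := hΔ ▸ finite_facets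
  have hcov : ⋃₀ facets Δ = frontier (interior Δ) := by
    subst hΔ
    exact sUnion_facets_eq_frontier hne
  have : Fintype (facets Δ) := hfin.fintype
  have hsp : ∀ F : facets Δ, somePoint (F : Set E) ∈ (F : Set E) := fun F => somePoint_mem F.2.1
  -- The conormal vanishes on the directions of the facet, so `λ` is constant along it.
  have hlam : ∀ (F : facets Δ) (t : Fin m → ℝ),
      lambdaForm e (facetChart (somePoint (F : Set E)) (b F) t)
        (partials (facetChart (somePoint (F : Set E)) (b F)) t) =
      conormal e (fun j => (b F j : E)) (somePoint (F : Set E)) := by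
    intro F t
    rw [partials_facetChart, ← det_cons_eq_lambdaForm, ← conormal_apply, facetChart, map_add,
      conormal_eq_zero e (b F) (SetLike.coe_mem _), add_zero]
  set q := (Fintype.equivFin (facets Δ)).symm with hq
  refine ⟨⟨Fintype.card (facets Δ),
    fun i => facetChart (somePoint (q i : Set E)) (b (q i)) ⁻¹' (q i : Set E),
    fun i => facetChart (somePoint (q i : Set E)) (b (q i)), fun i => σ (q i),
    fun i => (isClosedEmbedding_facetChart _ _).isCompact_preimage
      (isCompact_of_mem_facets (s := s) (hΔ ▸ (q i).2)),
    fun i => (convex_preimage_facetChart _ _ (q i).2.2.1).addHaar_frontier volume,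
    fun i => ⟨univ, isOpen_univ, subset_univ _, (contDiff_facetChart _ _).contDiffOn⟩,
    fun i => (facetChart_injective _ _).injOn, ?_, ?_, ?_⟩, ?_⟩
  · intro i j hij
    rw [Set.disjoint_left]
    rintro _ ⟨t, ht, rfl⟩ ⟨t', ht', h⟩
    refine hij (q.injective (Subtype.ext (Subset.antisymm ?_ ?_)))
    · refine facet_subset_of_inter (q i).2 (q j).2 (b (q i)) (hsp _) ht ?_
      rw [← h]
      exact interior_subset (s := facetChart (somePoint (q j : Set E)) (b (q j)) ⁻¹' (q j : Set E)) ht'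
    · refine facet_subset_of_inter (q j).2 (q i).2 (b (q j)) (hsp _) ht' ?_
      rw [h]
      exact interior_subset (s := facetChart (somePoint (q i : Set E)) (b (q i)) ⁻¹' (q i : Set E)) ht
  · rw [← hcov, sUnion_eq_iUnion, ← q.surjective.iUnion_comp]
    refine iUnion_congr fun i => ?_
    rw [image_preimage_eq_iff]
    exact fun y hy => exists_facetChart_eq _ (hsp _) hy
  · intro i t ht y hy
    have h := hσ (q i) y hy
    rw [partials_facetChart, ← conormal_apply, map_sub, facetChart, map_add,
      conormal_eq_zero e (b (q i)) (SetLike.coe_mem _), add_zero]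
    exact h
  · intro g
    refine ⟨fun hg i => ?_, ?_⟩
    · change IntegrableOn (fun t => g (facetChart (somePoint (q i : Set E)) (b (q i)) t) *
        lambdaForm e (facetChart (somePoint (q i : Set E)) (b (q i)) t)
          (partials (facetChart (somePoint (q i : Set E)) (b (q i))) t))
        (facetChart (somePoint (q i : Set E)) (b (q i)) ⁻¹' (q i : Set E))
      simp only [hlam]
      exact (hg (q i)).mul_const _
    · rw [finsum_eq_sum_of_fintype, ← q.sum_comp]
      refine Finset.sum_congr rfl fun i _ => ?_
      simp only [PiecewiseSmoothBoundary.pullback, hlam]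
      rw [integral_mul_const]
      ring

end Facets

end PolytopeBoundary

/-! ### Lattice volumes in coordinates. -/

section LatticeVolume

variable {V : Type*} [NormedAddCommGroup V] [NormedSpace ℝ V] [FiniteDimensional ℝ V]
  [MeasurableSpace V] [BorelSpace V]

/-- The fundamental domain and the closed parallelepiped of `b` differ by a null set, so the
covolume is the mass of the parallelepiped, the unit of `b.addHaar`. -/
lemma latticeVol_span {ι : Type*} [Fintype ι] (b : Basis ι ℝ V) :
    latticeVol (Submodule.span ℤ (range b)) = b.addHaar := by
  set κ : Measure V := Measure.addHaar with hκ
  have h1 := ZLattice.covolume_eq_measure_fundamentalDomain (Submodule.span ℤ (range b)) κ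
    (ZSpan.isAddFundamentalDomain b κ)
  have h2 : κ (ZSpan.fundamentalDomain b) = κ b.parallelepiped :=
    measure_congr (ZSpan.fundamentalDomain_ae_parallelepiped b κ)
  have h3 : κ = κ b.parallelepiped • b.addHaar := by
    rw [Basis.addHaar]
    exact Measure.addHaarMeasure_unique κ b.parallelepiped
  have hpos : κ b.parallelepiped ≠ 0 :=
    (Measure.measure_pos_of_nonempty_interior κ b.parallelepiped.interior_nonempty).ne'
  have hfin : κ b.parallelepiped ≠ ⊤ := b.parallelepiped.isCompact.measure_ne_top
  rw [latticeVol, ← hκ, h1, measureReal_def, h2, ENNReal.ofReal_toReal hfin]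
  conv_lhs => rw [h3]
  rw [smul_smul]
  conv_lhs => rw [← h3]
  rw [ENNReal.inv_mul_cancel hpos hfin, one_smul]

end LatticeVolume

/-! ### Dual lattices and dual bases. -/

section DualLattice

variable {N : Type*} [NormedAddCommGroup N] [NormedSpace ℝ N] [FiniteDimensional ℝ N]

lemma exists_basis_span_eq {L : Submodule ℤ N} [DiscreteTopology L] [IsZLattice ℝ L] {n : ℕ}
    (hn : finrank ℝ N = n) :
    ∃ b : Basis (Fin n) ℝ N, Submodule.span ℤ (range b) = L := by
  have h : finrank ℤ L = n := by rw [ZLattice.rank ℝ L, hn]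
  exact ⟨(finBasisOfFinrankEq ℤ L h).ofZLatticeBasis ℝ L, Basis.ofZLatticeBasis_span ℝ L _⟩

/-- The dual basis, in the space of continuous linear forms. -/
noncomputable def strongDualBasis {n : ℕ} (b : Basis (Fin n) ℝ N) :
    Basis (Fin n) ℝ (StrongDual ℝ N) :=
  b.dualBasis.map LinearMap.toContinuousLinearMap

lemma strongDualBasis_apply {n : ℕ} (b : Basis (Fin n) ℝ N) (i : Fin n) (u : N) :
    strongDualBasis b i u = b.repr u i := by
  simp [strongDualBasis]

lemma strongDualBasis_repr {n : ℕ} (b : Basis (Fin n) ℝ N) (x : StrongDual ℝ N) (i : Fin n) :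
    (strongDualBasis b).repr x i = x (b i) := by
  simp [strongDualBasis]

lemma span_strongDualBasis {n : ℕ} (b : Basis (Fin n) ℝ N) {L : Submodule ℤ N}
    (hL : Submodule.span ℤ (range b) = L) :
    Submodule.span ℤ (range (strongDualBasis b)) = dualLattice L := by
  ext x
  rw [(strongDualBasis b).mem_span_iff_repr_mem ℤ x]
  simp only [strongDualBasis_repr]
  constructor
  · intro h u hu
    choose k hk using h
    have hu' := (b.mem_span_iff_repr_mem ℤ u).1 (hL ▸ hu)
    choose c hc using hu'
    refine ⟨∑ i, c i * k i, ?_⟩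
    rw [← b.sum_repr u, map_sum]
    push_cast
    refine Finset.sum_congr rfl fun i _ => ?_
    rw [map_smul, ← hk i, ← hc i]
    rfl
  · intro h i
    obtain ⟨k, hk⟩ := h (b i) (hL ▸ Submodule.subset_span (mem_range_self i))
    exact ⟨k, hk.symm⟩

lemma mem_lattice_iff {n : ℕ} (b : Basis (Fin n) ℝ N) {L : Submodule ℤ N}
    (hL : Submodule.span ℤ (range b) = L) {u : N} :
    u ∈ L ↔ ∀ x ∈ dualLattice L, ∃ k : ℤ, x u = k := by
  refine ⟨fun hu x hx => hx u hu, fun h => ?_⟩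
  rw [← hL, b.mem_span_iff_repr_mem ℤ u]
  intro i
  obtain ⟨k, hk⟩ := h (strongDualBasis b i) (by
    rw [← span_strongDualBasis b hL]
    exact Submodule.subset_span (mem_range_self i))
  exact ⟨k, by rw [← strongDualBasis_apply, hk]; rfl⟩

end DualLattice

/-! ### The lattice of a facet. -/

section InducedLattice

variable {E : Type*} [NormedAddCommGroup E] [NormedSpace ℝ E] [FiniteDimensional ℝ E] {m : ℕ}

/-- The lattice `Λ ∩ linSpace F` for a facet `F` of a lattice polytope has full rank. -/
lemma exists_basis_inducedLattice {Λ : Submodule ℤ E} [DiscreteTopology Λ] {s : Finset E}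
    (hs : ∀ x ∈ s, x ∈ Λ) {F : Set E} (hF : F ∈ facets (convexHull ℝ (s : Set E)))
    (hm : finrank ℝ (linSpace F) = m) :
    ∃ b : Basis (Fin m) ℝ (linSpace F),
      Submodule.span ℤ (range b) = inducedLattice Λ (linSpace F) := by
  have hd : DiscreteTopology (inducedLattice Λ (linSpace F)) :=
    ZLattice.comap_discreteTopology ℝ Λ (e := (linSpace F).subtype) continuous_subtype_val
      Subtype.val_injective
  have hz : IsZLattice ℝ (inducedLattice Λ (linSpace F)) := by
    refine ⟨?_⟩
    refine Submodule.map_injective_of_injective (linSpace F).injective_subtype ?_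
    rw [Submodule.map_span, Submodule.map_subtype_top]
    refine le_antisymm (Submodule.span_le.2 ?_) ?_
    · rintro _ ⟨y, -, rfl⟩
      exact y.2
    · have h1 : linSpace F = Submodule.span ℝ (((s : Set E) ∩ F) -ᵥ ((s : Set E) ∩ F)) := by
        conv_lhs => rw [isExtreme_convexHull_eq hF.2.2.1 hF.2.1]
        rw [linSpace, affineSpan_convexHull, direction_affineSpan, vectorSpan_def]
      refine h1.le.trans (Submodule.span_mono ?_)
      rintro _ ⟨y, hy, z, hz, rfl⟩
      exact ⟨⟨y - z, sub_mem_linSpace hy.2 hz.2⟩, sub_mem (hs y hy.1) (hs z hz.1), rfl⟩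
  exact exists_basis_span_eq hm

variable [MeasurableSpace E] [BorelSpace E]

lemma faceVol_eq_map {Λ : Submodule ℤ E} {F : Set E} (b : Basis (Fin m) ℝ (linSpace F))
    (hb : Submodule.span ℤ (range b) = inducedLattice Λ (linSpace F)) :
    faceVol Λ F = volume.map (facetChart (somePoint F) b) := by
  rw [faceVol, ← hb, latticeVol_span, addHaar_eq_map_equivFun_symm, Measure.map_map]
  · rfl
  · exact (continuous_const.add continuous_subtype_val).measurable
  · exact b.equivFunL.symm.continuous.measurable

end InducedLattice

/-! ### Primitivity of the conormal of a lattice basis. -/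

section Primitive

variable {E : Type*} [NormedAddCommGroup E] [NormedSpace ℝ E] [FiniteDimensional ℝ E] {m : ℕ}

lemma conormal_isInt (e : Basis (Fin (m + 1)) ℝ E) {v : Fin m → E}
    (hv : ∀ j, v j ∈ Submodule.span ℤ (range e)) {x : E} (hx : x ∈ Submodule.span ℤ (range e)) :
    ∃ k : ℤ, conormal e v x = k := by
  have hall : ∀ j, (Fin.cons x v : Fin (m + 1) → E) j ∈ Submodule.span ℤ (range e) :=
    Fin.cases hx hv
  choose c hc using fun i j => (e.mem_span_iff_repr_mem ℤ _).1 (hall j) i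
  refine ⟨Matrix.det (Matrix.of c), ?_⟩
  rw [conormal_apply, Basis.det_apply, Int.cast_det]
  congr 1
  ext i j
  exact (hc i j).symm

/-- If `v` is a basis of the lattice points in the hyperplane `V`, then the conormal form is
surjective onto the integers. -/
lemma exists_conormal_eq_one (e : Basis (Fin (m + 1)) ℝ E) {V : Submodule ℝ E}
    (b : Basis (Fin m) ℝ V)
    (hb : Submodule.span ℤ (range b) = inducedLattice (Submodule.span ℤ (range e)) V) :
    ∃ x ∈ Submodule.span ℤ (range e), conormal e (fun j => (b j : E)) x = 1 := by
  set Λ := Submodule.span ℤ (range e) with hΛ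
  have hbΛ : ∀ j, (b j : E) ∈ Λ := fun j => by
    have : b j ∈ inducedLattice Λ V := hb ▸ Submodule.subset_span (mem_range_self j)
    exact this
  set l := conormal e (fun j => (b j : E)) with hl
  have hint : ∀ x ∈ Λ, ∃ k : ℤ, l x = k := fun x hx => conormal_isInt e hbΛ hx
  -- the additive group of values is generated by some `d`
  choose! k hk using hint
  set S : AddSubgroup ℤ :=
    { carrier := {c | ∃ x ∈ Λ, l x = c}
      add_mem' := by
        rintro a c ⟨x, hx, hxa⟩ ⟨y, hy, hyc⟩
        exact ⟨x + y, add_mem hx hy, by rw [map_add, hxa, hyc]; push_cast; rfl⟩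
      zero_mem' := ⟨0, zero_mem _, by simp⟩
      neg_mem' := by
        rintro a ⟨x, hx, hxa⟩
        exact ⟨-x, neg_mem hx, by rw [map_neg, hxa]; push_cast; rfl⟩ } with hS
  obtain ⟨d, hd⟩ := Int.subgroup_cyclic S
  have hdS : d ∈ S := hd ▸ AddSubgroup.mem_closure_singleton_self d
  obtain ⟨x₁, hx₁, hx₁d⟩ := hdS
  have hdec : ∀ i, ∃ (a : ℤ), e i - a • x₁ ∈ V := by
    intro i
    have hi : e i ∈ Λ := Submodule.subset_span (mem_range_self i)
    have : k (e i) ∈ S := ⟨e i, hi, hk _ hi⟩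
    rw [hd, AddSubgroup.mem_closure_singleton] at this
    obtain ⟨a, ha⟩ := this
    refine ⟨a, by_contra fun h => conormal_ne_zero e b h ?_⟩
    rw [map_sub, ← hl, hk _ hi, map_zsmul, hx₁d, ← ha]
    simp
  choose a ha using hdec
  have hc : ∀ i, ∃ c : Fin m → ℤ, ∑ j, c j • b j = (⟨_, ha i⟩ : V) := by
    intro i
    refine (Submodule.mem_span_range_iff_exists_fun ℤ).1 ?_
    rw [hb]
    exact sub_mem (Submodule.subset_span (mem_range_self i)) (Submodule.smul_mem _ _ hx₁)
  choose c hc using hc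
  -- The basis `e` is an integral combination `A` of `x₁` and the `b j`. Determinants give `d *
  -- A.det = 1`, since the determinant of `B` in `e` is the value `d` of the conormal at `x₁`.
  set B : Fin (m + 1) → E := Fin.cons x₁ fun j => (b j : E) with hB
  set A : Matrix (Fin (m + 1)) (Fin (m + 1)) ℤ :=
    Matrix.of fun j i => (Fin.cons (a i) (c i) : Fin (m + 1) → ℤ) j with hA
  have heB : ∀ i, e i = ∑ j, A j i • B j := by
    intro i
    have h' : ∑ j, c i j • (b j : E) = e i - a i • x₁ := by
      have h := congrArg V.subtype (hc i)
      rw [map_sum] at h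
      exact h
    rw [Fin.sum_univ_succ]
    simp only [hA, hB, Matrix.of_apply, Fin.cons_zero, Fin.cons_succ]
    rw [h', add_sub_cancel]
  have hmul : e.toMatrix B * A.map (fun z : ℤ => (z : ℝ)) = 1 := by
    ext i j
    have h := congrArg (e.coord i) (heB j)
    rw [map_sum] at h
    simp only [map_zsmul, zsmul_eq_mul, Basis.coord_apply, Basis.repr_self] at h
    rw [Matrix.mul_apply, Matrix.one_apply]
    simp only [Basis.toMatrix_apply, Matrix.map_apply]
    rw [Finset.sum_congr rfl fun q _ => mul_comm _ _, ← h, Finsupp.single_apply]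
    simp [eq_comm]
  have hdet := congrArg Matrix.det hmul
  rw [Matrix.det_mul, Matrix.det_one, ← Basis.det_apply, hB, ← conormal_apply, ← hl, hx₁d,
    ← Int.cast_det] at hdet
  have hu : d * A.det = 1 := by exact_mod_cast hdet
  refine ⟨A.det • x₁, Submodule.smul_mem _ _ hx₁, ?_⟩
  rw [map_zsmul, hx₁d, zsmul_eq_mul, mul_comm]
  exact_mod_cast hu

end Primitive

/-! ### Identification of the minimal inner normal. -/

section FacetNormal

variable {N : Type*} [NormedAddCommGroup N] [NormedSpace ℝ N] [FiniteDimensional ℝ N] {m : ℕ}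

/-- The candidate for `v_F` is minus the outward conormal, read in the bidual. It is integral, and
since the conormal takes the value `1` on the dual lattice, every inner integral normal is a
positive integer multiple of it. Hence it is the unique shortest one in any norm. -/
lemma facetLevel_eq (bN : Basis (Fin (m + 1)) ℝ N) {L : Submodule ℤ N}
    (hL : Submodule.span ℤ (range bN) = L) {Δ F : Set (StrongDual ℝ N)} (hΔ : Convex ℝ Δ)
    (hne : (interior Δ).Nonempty) (hF : F ∈ facets Δ) (b : Basis (Fin m) ℝ (linSpace F))
    (hb : Submodule.span ℤ (range b) = inducedLattice (dualLattice L) (linSpace F)) {σ : ℤˣ}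
    (hσ : ∀ y ∈ interior Δ,
      0 < ((σ : ℤ) : ℝ) * (conormal (strongDualBasis bN) (fun j => (b j : StrongDual ℝ N))
        (somePoint F) - conormal (strongDualBasis bN) (fun j => (b j : StrongDual ℝ N)) y)) :
    facetLevel L Δ F = -(((σ : ℤ) : ℝ) *
      conormal (strongDualBasis bN) (fun j => (b j : StrongDual ℝ N)) (somePoint F)) := by
  set p := somePoint F with hp
  have hpF : p ∈ F := somePoint_mem hF.1
  set e := strongDualBasis bN with he
  have hspan : Submodule.span ℤ (range e) = dualLattice L := span_strongDualBasis bN hL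
  rw [← hspan] at hb
  have hbΛ : ∀ j, (b j : StrongDual ℝ N) ∈ Submodule.span ℤ (range e) := fun j => by
    have : b j ∈ inducedLattice (Submodule.span ℤ (range e)) (linSpace F) :=
      hb ▸ Submodule.subset_span (mem_range_self j)
    exact this
  have hint := fun x hx => conormal_isInt e hbΛ (x := x) hx
  obtain ⟨x₁, hx₁, hlx₁⟩ := exists_conormal_eq_one e b hb
  have hker : ∀ x, conormal e (fun j => (b j : StrongDual ℝ N)) x = 0 → x ∈ linSpace F :=
    fun x hx => by_contra fun h => conormal_ne_zero e b h hx
  have hzero : ∀ x ∈ linSpace F, conormal e (fun j => (b j : StrongDual ℝ N)) x = 0 :=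
    fun x hx => conormal_eq_zero e b hx
  set l := conormal e (fun j => (b j : StrongDual ℝ N)) with hl
  set c : ℝ := ((σ : ℤ) : ℝ) with hc
  have hcc : c * c = 1 := by
    rw [hc, ← Int.cast_mul, ← Units.val_mul, Int.units_mul_self]; simp
  obtain ⟨v, hv⟩ := (bidualEquiv N).surjective (LinearMap.toContinuousLinearMap (-c • l))
  have hvx : ∀ x, x v = -(c * l x) := fun x => by
    rw [← bidualEquiv_apply, hv]
    simp
  have hvL : v ∈ L := by
    rw [mem_lattice_iff bN hL]
    intro x hx
    obtain ⟨k, hk⟩ := hint x (hspan ▸ hx)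
    exact ⟨-(σ * k), by rw [hvx, hk]; push_cast; rfl⟩
  have hle : ∀ y ∈ Δ, p v ≤ y v := by
    have hcl : Continuous fun y : StrongDual ℝ N => y v := by fun_prop
    intro y hy
    have hy' : y ∈ closure (interior Δ) := by
      rw [hΔ.closure_interior_eq_closure_of_nonempty_interior hne]
      exact subset_closure hy
    refine closure_minimal (fun z hz => ?_) (isClosed_le continuous_const hcl) hy'
    have := hσ z hz
    rw [mem_ofPred_eq, hvx, hvx]
    linarith
  have hv0 : v ≠ 0 := by
    rintro rfl
    have := hvx x₁
    rw [map_zero, hlx₁, mul_one] at this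
    have hc0 : c = 0 := by linarith
    rw [hc0] at hcc
    norm_num at hcc
  have hmem : v ∈ innerNormals L Δ F := by
    refine ⟨hvL, hv0, fun x hx => by rw [hvx, hzero x hx, mul_zero, neg_zero], fun x hx y hy => ?_⟩
    have h1 := hzero _ (sub_mem_linSpace hx hpF)
    rw [map_sub, sub_eq_zero] at h1
    have : x v = p v := by rw [hvx, hvx, h1]
    rw [this]
    exact hle y hy
  have hray : ∀ w ∈ innerNormals L Δ F, ∃ k : ℤ, 1 ≤ k ∧ w = (k : ℝ) • v := by
    rintro w ⟨hwL, hw0, hworth, hwle⟩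
    obtain ⟨k, hk⟩ := (mem_lattice_iff bN hL).1 hwL x₁ (hspan ▸ hx₁)
    have hwx : ∀ x : StrongDual ℝ N, x w = l x * k := by
      intro x
      -- A form that vanishes on the directions of `F` is determined by its value at `x₁`, because
      -- `x - l x • x₁` is such a direction.
      have h1 := hworth (x - l x • x₁) (hker _ (by rw [map_sub, map_smul, hlx₁]; simp))
      rw [sub_apply, smul_apply, hk, sub_eq_zero] at h1
      exact h1
    have hwv : w = ((-(σ * k) : ℤ) : ℝ) • v := by
      refine (bidualEquiv N).injective ?_
      ext x
      rw [bidualEquiv_apply, bidualEquiv_apply, map_smul, hwx, hvx]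
      push_cast
      rw [← hc, smul_eq_mul]
      linear_combination (-(l x * k)) * hcc
    refine ⟨_, ?_, hwv⟩
    obtain ⟨y, hy⟩ := hne
    have h1 := hwle p hpF y (interior_subset hy)
    have h2 := hσ y hy
    rw [hwx, hwx] at h1
    have h3 : 0 ≤ -(σ * k : ℤ) := by
      have : (0 : ℝ) ≤ ((-(σ * k) : ℤ) : ℝ) := by
        push_cast
        rw [← hc]
        have h4 : 0 ≤ (c * (l p - l y)) * (-(c * k)) := by
          have : (c * (l p - l y)) * (-(c * k)) = (l y * k - l p * k) * (c * c) := by ring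
          rw [this, hcc]
          linarith
        exact nonneg_of_mul_nonneg_right h4 h2
      exact_mod_cast this
    rcases h3.lt_or_eq with h | h
    · omega
    · rw [← h] at hwv
      simp only [Int.cast_zero, zero_smul] at hwv
      exact absurd hwv hw0
  have hmin : ∀ w ∈ innerNormals L Δ F, ‖v‖ ≤ ‖w‖ := by
    intro w hw
    obtain ⟨k, hk, rfl⟩ := hray w hw
    rw [norm_smul]
    have : (1 : ℝ) ≤ ‖(k : ℝ)‖ := by
      rw [Real.norm_eq_abs]
      exact le_trans (by exact_mod_cast hk) (le_abs_self _)
    exact le_mul_of_one_le_left (norm_nonneg _) this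
  have hn : facetNormal L Δ F = v := by
    have hspec : facetNormal L Δ F ∈ innerNormals L Δ F ∧
        ∀ w ∈ innerNormals L Δ F, ‖facetNormal L Δ F‖ ≤ ‖w‖ :=
      Classical.epsilon_spec (p := fun v => v ∈ innerNormals L Δ F ∧
        ∀ w ∈ innerNormals L Δ F, ‖v‖ ≤ ‖w‖) ⟨v, hmem, hmin⟩
    obtain ⟨k, hk, hkv⟩ := hray _ hspec.1
    have h1 := hspec.2 v hmem
    rw [hkv, norm_smul, Real.norm_eq_abs] at h1
    have h2 : |(k : ℝ)| ≤ 1 := le_of_mul_le_mul_right (by linarith) (norm_pos_iff.2 hv0)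
    have h3 : k ≤ 1 := by exact_mod_cast (le_abs_self _).trans h2
    rw [hkv, le_antisymm h3 hk]
    simp
  rw [facetLevel, hn, ← hp, hvx]

end FacetNormal

/-! ### Finiteness of the function when its stability set is compact. -/

section Domain

variable {N : Type*} [NormedAddCommGroup N] [NormedSpace ℝ N] [FiniteDimensional ℝ N]
  {C : Set N} {f : N → ℝ}

/-- If `C` has interior points, separate them from a point outside `C`; if not, `C` lies in a proper
affine subspace and some nonzero form is constant on it. -/
lemma exists_bounded_below_form (hC : Convex ℝ C) (hne : C.Nonempty) (hC' : C ≠ univ) :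
    ∃ x : StrongDual ℝ N, x ≠ 0 ∧ ∃ c, ∀ u ∈ C, c ≤ x u := by
  by_cases hi : (interior C).Nonempty
  · obtain ⟨z, hz⟩ := (ne_univ_iff_exists_notMem C).1 hC'
    obtain ⟨l, hl⟩ := geometric_hahn_banach_open_point hC.interior isOpen_interior
      fun h => hz (interior_subset h)
    refine ⟨-l, ?_, -l z, fun u hu => ?_⟩
    · rintro h
      obtain ⟨y, hy⟩ := hi
      have h1 := hl y hy
      rw [neg_eq_zero] at h
      simp [h] at h1
    · have hu' : u ∈ closure (interior C) := by
        rw [hC.closure_interior_eq_closure_of_nonempty_interior hi]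
        exact subset_closure hu
      have h1 : l u ≤ l z := closure_minimal (fun y hy => (hl y hy).le)
        (isClosed_le l.continuous continuous_const) hu'
      simpa using h1
  · rw [hC.interior_nonempty_iff_affineSpan_eq_top,
      AffineSubspace.affineSpan_eq_top_iff_vectorSpan_eq_top_of_nonempty ℝ _ _ hne] at hi
    obtain ⟨l, hl0, hl⟩ := Submodule.exists_le_ker_of_lt_top _ (lt_top_iff_ne_top.2 hi)
    obtain ⟨y, hy⟩ := hne
    refine ⟨LinearMap.toContinuousLinearMap l, by simpa using hl0, l y, fun u hu => ?_⟩
    have h1 : l (u - y) = 0 := hl (vsub_mem_vectorSpan ℝ hu hy)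
    rw [map_sub, sub_eq_zero] at h1
    exact h1.ge

/-- A concave function with a compact stability set is finite everywhere. -/
lemma eq_univ_of_isCompact_stab (hC : Convex ℝ C) (hne : C.Nonempty)
    (hs : (stab C f).Nonempty) (hK : IsCompact (stab C f)) : C = univ := by
  by_contra hC'
  obtain ⟨x, hx0, c, hc⟩ := exists_bounded_below_form hC hne hC'
  obtain ⟨y, hy⟩ := hs
  obtain ⟨R, hR⟩ := hK.isBounded.exists_norm_le
  -- A form bounded below on `C` is a recession direction of the stability set.
  have hmem : ∀ t : ℝ, 0 ≤ t → y + t • x ∈ stab C f := by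
    intro t ht
    obtain ⟨a, ha⟩ := hy
    refine ⟨a + t * c, ?_⟩
    rintro _ ⟨u, hu, rfl⟩
    have h1 : a ≤ y u - f u := ha ⟨u, hu, rfl⟩
    have h2 := mul_le_mul_of_nonneg_left (hc u hu) ht
    simp only [add_apply, smul_apply, smul_eq_mul]
    linarith
  have hxn : 0 < ‖x‖ := norm_pos_iff.2 hx0
  have hR0 : ‖y‖ ≤ R := hR y hy
  -- With this choice `t • x` has norm `R + ‖y‖ + 1`, while the bound `R` on the stability set
  -- allows at most `R + ‖y‖`.
  set t : ℝ := (R + ‖y‖ + 1) / ‖x‖ with ht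
  have ht0 : 0 ≤ t := by
    have := norm_nonneg y
    refine div_nonneg ?_ hxn.le
    linarith
  have h1 := hR _ (hmem t ht0)
  have h2 : ‖t • x‖ ≤ ‖y + t • x‖ + ‖y‖ := by
    have := norm_sub_le (y + t • x) y
    rwa [add_sub_cancel_left] at this
  rw [norm_smul, Real.norm_of_nonneg ht0, ht, div_mul_cancel₀ _ hxn.ne'] at h2
  linarith

end Domain

/-! ### The formula for lattice polytopes. -/

section LatticePolytopes

/-- A concave function on a polytope is bounded below by its values at the vertices; compactness and
semicontinuity bound it above. This makes all the integrals converge. -/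
lemma exists_norm_le_of_concaveOn_convexHull {E : Type*} [NormedAddCommGroup E] [NormedSpace ℝ E]
    {s : Finset E} {g : E → ℝ} (hg : ConcaveOn ℝ (convexHull ℝ (s : Set E)) g)
    (hus : UpperSemicontinuousOn g (convexHull ℝ (s : Set E))) :
    ∃ R, ∀ x ∈ convexHull ℝ (s : Set E), ‖g x‖ ≤ R := by
  obtain ⟨a, ha⟩ := hus.bddAbove_of_isCompact (s.finite_toSet.isCompact_convexHull ℝ)
  obtain ⟨c, hc⟩ := hg.bddBelow_convexHull (subset_convexHull ℝ _) (s.finite_toSet.image g).bddBelow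
  refine ⟨max |a| |c|, fun x hx => ?_⟩
  exact abs_le_max_abs_abs (hc ⟨x, hx, rfl⟩) (ha ⟨x, hx, rfl⟩) |>.trans (max_comm _ _).le

lemma integrableOn_of_bounded_comp {E X : Type*} [TopologicalSpace E] [MeasurableSpace E]
    [BorelSpace E] [MeasurableSpace X] {μ : Measure X} {D : Set E} {A : Set X} {g : E → ℝ}
    {h : X → E} (hh : Measurable h) (hA : MeasurableSet A) (hμA : μ A ≠ ⊤) (hAD : MapsTo h A D)
    (hgm : Measurable (D.indicator g)) {R : ℝ} (hR : ∀ x ∈ D, ‖g x‖ ≤ R) :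
    IntegrableOn (fun t => g (h t)) A μ := by
  have h1 : IntegrableOn (fun t => D.indicator g (h t)) A μ := by
    refine Measure.integrableOn_of_bounded (M := R) hμA
      (hgm.comp hh).aestronglyMeasurable ?_
    refine (ae_restrict_iff' hA).2 (Eventually.of_forall fun t ht => ?_)
    rw [indicator_of_mem (hAD ht)]
    exact hR _ (hAD ht)
  exact h1.congr_fun (fun t ht => indicator_of_mem (hAD ht) g) hA

lemma interior_nonempty_of_finrank_linSpace {E : Type*} [NormedAddCommGroup E] [NormedSpace ℝ E]
    [FiniteDimensional ℝ E] {Δ : Set E} (hΔ : Convex ℝ Δ) (hne : Δ.Nonempty)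
    (h : finrank ℝ (linSpace Δ) = finrank ℝ E) : (interior Δ).Nonempty := by
  rw [hΔ.interior_nonempty_iff_affineSpan_eq_top,
    AffineSubspace.affineSpan_eq_top_iff_vectorSpan_eq_top_of_nonempty ℝ _ _ hne,
    ← direction_affineSpan]
  exact Submodule.eq_top_of_finrank_eq h

variable {N : Type*} [NormedAddCommGroup N] [NormedSpace ℝ N] [FiniteDimensional ℝ N]
  [MeasurableSpace N] [BorelSpace N]

/-- The integral of a concave function whose stability set is a lattice polytope with respect to
its Monge-Ampère measure. -/
theorem integral_mongeAmpere_of_isLatticePolytope {n : ℕ} (hn : finrank ℝ N = n)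
    (L : Submodule ℤ N) [DiscreteTopology L] [IsZLattice ℝ L] {C : Set N} {f : N → ℝ}
    (hC : C.Nonempty) (hf : ConcaveOn ℝ C f) {Δ : Set (StrongDual ℝ N)} (hΔ : Δ = stab C f)
    (hpoly : IsLatticePolytope (dualLattice L) Δ) (hdim : finrank ℝ (linSpace Δ) = n) :
    ∃ ν : Measure N, IsMongeAmpere (latticeVol (dualLattice L)) C f ν ∧ Integrable f ν ∧
      IntegrableOn (legendreDual C f) Δ (latticeVol (dualLattice L)) ∧
      (facets Δ).Finite ∧
      (∀ F ∈ facets Δ, IntegrableOn (legendreDual C f) F (faceVol (dualLattice L) F)) ∧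
      -(n ! : ℝ) * ∫ u, f u ∂ν =
        ((n + 1)! : ℝ) * ∫ x in Δ, legendreDual C f x ∂(latticeVol (dualLattice L))
          + ∑ᶠ F ∈ facets Δ, facetLevel L Δ F *
              ((n ! : ℝ) * ∫ x in F, legendreDual C f x ∂(faceVol (dualLattice L) F)) := by
  obtain ⟨s, hs0, hsΛ, hs⟩ := hpoly
  have hΔc : IsCompact Δ := hs ▸ s.finite_toSet.isCompact_convexHull ℝ
  have hΔne : Δ.Nonempty := by
    rw [hs]
    exact hs0.to_set.convexHull
  have hΔconv : Convex ℝ Δ := hs ▸ convex_convexHull ℝ _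
  obtain rfl : C = univ :=
    eq_univ_of_isCompact_stab hf.1 hC (hΔ ▸ hΔne) (hΔ ▸ hΔc)
  have hconc : ConcaveOn ℝ Δ (legendreDual univ f) := hΔ ▸ concaveOn_legendreDual univ_nonempty
  have hus : UpperSemicontinuousOn (legendreDual univ f) Δ :=
    hΔ ▸ upperSemicontinuousOn_legendreDual univ_nonempty
  obtain ⟨R, hR⟩ : ∃ R, ∀ x ∈ Δ, ‖legendreDual univ f x‖ ≤ R := by
    rw [hs] at hconc hus ⊢
    exact exists_norm_le_of_concaveOn_convexHull hconc hus
  have hgm := measurable_indicator_of_upperSemicontinuousOn hΔc.isClosed hus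
  obtain ⟨bN, hbN⟩ := exists_basis_span_eq (L := L) hn
  set e := strongDualBasis bN with he
  have hspan : Submodule.span ℤ (range e) = dualLattice L := span_strongDualBasis bN hbN
  have hvol : latticeVol (dualLattice L) = e.addHaar := by rw [← hspan, latticeVol_span]
  have hdual : finrank ℝ (StrongDual ℝ N) = n := by rw [finrank_eq_card_basis e, Fintype.card_fin]
  have hne : (interior Δ).Nonempty :=
    interior_nonempty_of_finrank_linSpace hΔconv hΔne (hdim.trans hdual.symm)
  have hfin : (facets Δ).Finite := hs ▸ finite_facets
  rw [hvol]
  cases n with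
  -- In dimension zero there are no facets and the radial derivative vanishes, so the formula
  -- reduces to `f = -g`.
  | zero =>
    have hss : Subsingleton (StrongDual ℝ N) := finrank_zero_iff.1 hdual
    have hempty : facets Δ = ∅ := by
      refine eq_empty_of_forall_notMem fun F hF => ?_
      have := hF.2.2.2
      omega
    obtain ⟨ν, hν, hint⟩ := exists_isMongeAmpere e.addHaar hf.locallyLipschitz.continuous
    have hz : (fun x => fderiv ℝ (legendreDual univ f) x x - legendreDual univ f x) =
        fun x => -legendreDual univ f x := by
      funext x
      rw [Subsingleton.elim x 0, map_zero, zero_sub]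
    have hI : IntegrableOn (legendreDual univ f) Δ e.addHaar :=
      integrableOn_of_bounded_comp measurable_id hΔc.isClosed.measurableSet hΔc.measure_ne_top
        (mapsTo_id Δ) hgm hR
    rw [hz, ← hΔ] at hint
    obtain ⟨h1, h2⟩ := hint hI.neg
    refine ⟨ν, hν, h1, hI, hfin, by simp [hempty], ?_⟩
    rw [h2, hempty, integral_neg]
    simp
  | succ m =>
    have hdisc : DiscreteTopology (dualLattice L) := by
      rw [← hspan]
      infer_instance
    have hFdim : ∀ F ∈ facets Δ, finrank ℝ (linSpace F) = m := fun F hF => by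
      have := hF.2.2.2
      omega
    choose b hb using fun F : facets Δ =>
      exists_basis_inducedLattice (Λ := dualLattice L) hsΛ (F := F) (hs ▸ F.2) (hFdim F F.2)
    choose σ hσ using fun F : facets Δ =>
      exists_sign_conormal e hΔconv hne F.2 (b F) (somePoint_mem F.2.1)
    have hemb : ∀ F : facets Δ, MeasurableEmbedding (facetChart (somePoint (F : Set _)) (b F)) :=
      fun F => (isClosedEmbedding_facetChart _ _).measurableEmbedding
    have hFI : ∀ F : facets Δ, IntegrableOn
        (fun t => legendreDual univ f (facetChart (somePoint (F : Set _)) (b F) t))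
        (facetChart (somePoint (F : Set _)) (b F) ⁻¹' F) := by
      intro F
      have hFc : IsCompact (F : Set (StrongDual ℝ N)) :=
        isCompact_of_mem_facets (s := s) (hs ▸ F.2)
      exact integrableOn_of_bounded_comp (hemb F).measurable
        ((hemb F).measurable hFc.isClosed.measurableSet)
        ((isClosedEmbedding_facetChart _ _).isCompact_preimage hFc).measure_ne_top
        (fun t ht => F.2.2.2.1.subset ht) hgm hR
    obtain ⟨P, hP⟩ := exists_piecewiseSmoothBoundary e hs hne b σ hσ
    obtain ⟨hPI, hPint⟩ := hP (legendreDual univ f)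
    subst hΔ
    obtain ⟨ν, h1, h2, h3, h4⟩ :=
      integral_mongeAmpere_of_boundary e hf hΔc P (hPI hFI)
    refine ⟨ν, h1, h2, h3, hfin, fun F hF => ?_, ?_⟩
    · rw [faceVol_eq_map (b ⟨F, hF⟩) (hb ⟨F, hF⟩), (hemb ⟨F, hF⟩).integrableOn_map_iff]
      exact hFI ⟨F, hF⟩
    · have := hfin.fintype
      rw [h4, hPint, ← finsum_set_coe_eq_finsum_mem, finsum_eq_sum_of_fintype,
        finsum_eq_sum_of_fintype, sub_eq_add_neg, Finset.mul_sum, ← Finset.sum_neg_distrib]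
      congr 1
      refine Finset.sum_congr rfl fun F _ => ?_
      -- The facet level is minus the signed conormal at the facet, which turns the subtracted
      -- boundary integral into an added sum.
      rw [facetLevel_eq bN hbN hΔconv hne F.2 (b F) (hb F) (hσ F), faceVol_eq_map (b F) (hb F),
        (hemb F).setIntegral_map]
      ring

end LatticePolytopes

end ConcaveMA

theorem mainTheorem6 {N : Type*} [NormedAddCommGroup N] [NormedSpace ℝ N]
    [FiniteDimensional ℝ N] [MeasurableSpace N] [BorelSpace N] :
    (∀ (m n : ℕ), n = m + 1 →
      ∀ (μ : Measure (StrongDual ℝ N)) [μ.IsAddHaarMeasure]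
        (e : Basis (Fin (m + 1)) ℝ (StrongDual ℝ N)), e.addHaar = μ →
      ∀ f : N → ℝ, ConcaveOn ℝ Set.univ f → UpperSemicontinuous f →
        IsCompact (stab Set.univ f) →
      ∀ P : PiecewiseSmoothBoundary e (stab Set.univ f),
        P.Integrable (legendreDual Set.univ f) →
      ∃ ν : Measure N, IsMongeAmpere μ Set.univ f ν ∧ Integrable f ν ∧
        IntegrableOn (legendreDual Set.univ f) (stab Set.univ f) μ ∧
        -(n ! : ℝ) * ∫ u, f u ∂ν =
          ((n + 1)! : ℝ) * ∫ x in stab Set.univ f, legendreDual Set.univ f x ∂μ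
            - (n ! : ℝ) * P.integral (legendreDual Set.univ f)) ∧
    (∀ n : ℕ, finrank ℝ N = n →
      ∀ (L : Submodule ℤ N) [DiscreteTopology L] [IsZLattice ℝ L]
        (C : Set N) (f : N → ℝ), C.Nonempty → ConcaveOn ℝ C f →
      ∀ Δ : Set (StrongDual ℝ N), Δ = stab C f → IsLatticePolytope (dualLattice L) Δ →
        finrank ℝ (linSpace Δ) = n →
      ∃ ν : Measure N, IsMongeAmpere (latticeVol (dualLattice L)) C f ν ∧ Integrable f ν ∧
        IntegrableOn (legendreDual C f) Δ (latticeVol (dualLattice L)) ∧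
        (facets Δ).Finite ∧
        (∀ F ∈ facets Δ, IntegrableOn (legendreDual C f) F (faceVol (dualLattice L) F)) ∧
        -(n ! : ℝ) * ∫ u, f u ∂ν =
          ((n + 1)! : ℝ) * ∫ x in Δ, legendreDual C f x ∂(latticeVol (dualLattice L))
            + ∑ᶠ F ∈ facets Δ, facetLevel L Δ F *
                ((n ! : ℝ) * ∫ x in F, legendreDual C f x ∂(faceVol (dualLattice L) F))) := by
  refine ⟨?_, ?_⟩
  · rintro m n rfl μ _ e rfl f hf - hD P hP
    exact integral_mongeAmpere_of_boundary e hf hD P hP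
  · intro n hn L _ _ C f hC hf Δ hΔ hpoly hdim
    exact integral_mongeAmpere_of_isLatticePolytope hn L hC hf hΔ hpoly hdim
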